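/- **Setting.** Let $\widehat\Pi$ be an affine Dynkin diagram, untwisted ($A^1_n$ $(n\ge1)$, $B^1_n$ $(n\ge3)$, $C^1_n$ $(n\ge2)$, $D^1_n$ $(n\ge4)$, $E^1_6,E^1_7,E^1_8,F^1_4,G^1_2$) or twisted ($A^2_{2n}$ $(n\ge1)$, $A^2_{2n-1}$ $(n\ge3)$, $D^2_{n+1}$ $(n\ge2)$, $E^2_6$, $D^3_4$), with vertices $I=\{0,\dots,r\}$ and Cartan matrix $C=(C_{ij})$. Let $\mathfrak h'$ be the complex vector space with basis the simple co-roots $\check\alpha_0,\dots,\check\alpha_r$, and let $\alpha_j$ be the linear form with $\alpha_j(\check\alpha_i)=C_{ij}$. Put $s_i(x)=x-\alpha_i(x)\check\alpha_i$. A diagram automorphism is a permutation $\tau$ of $I$ with $C_{\tau(i)\tau(j)}=C_{ij}$; it acts by $\tau(\check\alpha_i)=\check\alpha_{\tau(i)}$. Let $c=\sum_i\check a_i\check\alpha_i$ be the canonical central element, where $(\check a_i)$ is the coprime positive integral vector with $\sum_i\check a_iC_{ij}=0$ for all $j$. Let $\mathbb N\langle\check{\widehat\Pi}\rangle$ be the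 set of combinations of the $\check\alpha_i$ with coefficients in $\{0,1,2,\dots\}$. The vertices are labelled as follows (Kac's labelling). $A^1_n$: a cycle $0,1,\dots,n$. $B^1_n$ and $A^2_{2n-1}$: $0$ and $1$ are joined to $2$, followed by a chain $2,\dots,n$ with a double bond between $n-1$ and $n$ ($\alpha_n$ short for $B^1_n$, long for $A^2_{2n-1}$). $C^1_n$ and $D^2_{n+1}$: a chain $0,\dots,n$ with double bonds at both ends ($\alpha_0,\alpha_n$ long for $C^1_n$, short for $D^2_{n+1}$). $D^1_n$: $0,1$ are joined to $2$, there is a chain $2,\dots,n-2$, and $n-1,n$ are joined to $n-2$. $E^1_6$: a chain $1,2,3,4,5$, with $6$ joined to $3$ and $0$ joined to $6$. $E^1_7$: a chain $0,1,\dots,6$, with $7$ joined to $3$. **Twisted Coxeter elements.** For a diagram automorphism $\tau\ne\mathrm{id}$ put $\mathrm{cox}^\tau=s_{i_1}\cdots s_{i_s}\tau$ with the following representatives $i_1,\dots,i_s$ of the $\tau$-orbits on $I$, always in increasing order: for $B^1_n$ and $A^2_{2n-1}$, $1,\dots,n$; for $E^1_6$ and $\tau$ of order $3$, $1,2,3$;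 for $D^1_n$ when $0$ and $1$ lie in the same $\tau$-orbit, the smallest element of each orbit within $I\setminus\{0\}$; in all other cases the smallest element of each orbit. **Proposition.** (1) For every affine diagram $\widehat\Pi$ and every diagram automorphism $\tau\neq\mathrm{id}$ there are an integer $k\ge1$ and an element $b\in\mathbb N\langle\check{\widehat\Pi}\rangle$ with $(\mathrm{cox}^\tau-1)(b)=kc$. The pair $(k,b)$ is uniquely determined by requiring that $k\ge1$ is the smallest positive integer for which such a $b$ exists and that $b-c\notin\mathbb N\langle\check{\widehat\Pi}\rangle$. (2) For the following diagram automorphisms this pair is as listed; $b$ is given by its coordinates $(b_0,\dots,b_r)$. * $A^1_n$, $n\ge1$, $\gamma(i)=i+1 \bmod (n+1)$, and $\tau=\gamma^l$ with $l\mid n+1$, $l<n+1$: $k=l$, $b_i=n-i$. * $A^1_n$, $n=2m\ge2$, $\tau=\sigma$, where $\sigma(0)=0$, $\sigma(i)=n+1-i$: $k=1$, $b_0=m$, $b_i=|m+1-i|$ for $i\ge1$. * $A^1_n$, $n=2m+1\ge3$, $\tau=\sigma$: $k=1$, $b_0=m$, $b_i=m+1-i$ for $1\le i\le m+1$, $b_i=i-m-2$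 for $i\ge m+2$. * $A^1_n$, $n=2m+1\ge3$, $\tau=\sigma\gamma$: $k=1$, $b_i=|m+1-i|$. * $B^1_n$, $\tau=\gamma$ exchanging $0$ and $1$. For $n=2m$: $k=1$, $b=(m-1,m,n-2,n-3,\dots,1,0)$. For $n$ odd: $k=2$, $b=(n-2,n,2n-4,2n-6,\dots,2,0)$. * $C^1_n$, $\tau=\gamma$, $\gamma(i)=n-i$. For $n=2m$: $k=1$, $b=(m,m-1,\dots,1,0,0,1,\dots,m-1)$. For $n=2m+1$: $k=1$, $b_i=|m+1-i|$. * $D^1_4$: for $\gamma$ ($0\mapsto4\mapsto1\mapsto3\mapsto0$, $2\mapsto 2$), $k=1$, $b=(1,3,2,2,0)$; for $\gamma^2$, $k=1$, $b=(1,2,2,1,0)$; for $\sigma$ (exchanging $3$ and $4$), $k=2$, $b=(3,3,4,2,0)$; for $\rho$ ($1\mapsto3\mapsto4\mapsto1$, fixing $0$ and $2$), $k=1$, $b=(1,2,1,1,0)$. * $D^1_n$, $n\ge5$, with $\gamma(0)=n$, $\gamma(1)=n-1$, $\gamma(n-1)=0$, $\gamma(n)=1$, $\gamma(i)=n-i$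 otherwise, and $\sigma$ exchanging $n-1$ and $n$. For $n=2m$: * $\gamma$: $k=1$; $b_0=m-2$, $b_1=m$, $b_i=2(m-i)$ for $2\le i\le m$, $b_i=2(i-m-1)$ for $m+1\le i\le n-2$, $b_{n-1}=m-1$, $b_n=m-3$; * $\gamma^2$: $k=1$, $b=(m-1,m,n-2,n-3,\dots,1,0)$; * $\sigma$: $k=2$, $b=(n-1,n-1,2n-4,2n-6,\dots,2,0)$; * $\gamma\sigma$: $k=1$; $b_0=b_1=m-1$, $b_i=2(m-i)$ for $2\le i\le m$, $b_i=2(i-m-1)$ for $m+1\le i\le n-2$, $b_{n-1}=b_n=m-2$. For $n=2m+1$: * $\gamma$: $k=1$; $b_0=m-1$, $b_1=m+1$, $b_i=2|m+1-i|$ for $2\le i\le n-2$, $b_{n-1}=m$, $b_n=m-2$; * $\gamma^2$: $k=2$, $b=(n-2,n,2n-4,2n-6,\dots,2,0)$; * $\sigma$: $k=1$, $b=(m,m,n-2,n-3,\dots,1,0)$; * $\gamma\sigma$: $k=1$; $b_0=b_1=m$, $b_i=2|m+1-i|$ for $2\le i\le n-2$, $b_{n-1}=b_n=m-1$. * $E^1_6$: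 for $\gamma$ (with cycles $0\mapsto1\mapsto5\mapsto0$ and $2\mapsto4\mapsto6\mapsto2$), $k=1$, $b=(2,4,5,3,3,3,1)$; for $\sigma$ (exchanging $1,5$ and $2,4$), $k=1$, $b=(1,3,4,3,2,2,1)$. * $E^1_7$, $\gamma(i)=6-i$ for $i\le6$, $\gamma(7)=7$: $k=1$, $b=(4,6,6,4,3,4,3,1)$. * $A^2_{2n-1}$, $\tau=\gamma$ exchanging $0$ and $1$. For $n=2m$: $k=1$, $b=(m-1,m,n-2,n-3,\dots,1,0)$. For $n=2m+1$: $k=1$, $b=(m,m+1,n-1,n-2,\dots,2,1)$. * $D^2_{n+1}$, $\tau=\gamma$, $\gamma(i)=n-i$. For $n=2m$: $k=1$, $b_0=m$, $b_i=2(m-i)$ for $1\le i\le m$, $b_i=2(i-m-1)$ for $m+1\le i\le n-1$, $b_n=m-1$. For $n=2m+1$: $k=1$, $b_0=m+1$, $b_i=2|m+1-i|$ for $1\le i\le n-1$, $b_n=m$. -/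

import Mathlib

namespace AffineCoxeter

open Equiv

/-- The affine Dynkin diagrams, untwisted (`A1 n` is `A_n^{(1)}`, ..., `G2` is `G_2^{(1)}`) and
twisted (`A2even n` is `A_{2n}^{(2)}`, `A2odd n` is `A_{2n-1}^{(2)}`, `D2 n` is `D_{n+1}^{(2)}`,
`E62` is `E_6^{(2)}`, `D43` is `D_4^{(3)}`). -/
inductive AffineType : Type
  | A1 (n : ℕ) (hn : 1 ≤ n)
  | B1 (n : ℕ) (hn : 3 ≤ n)
  | C1 (n : ℕ) (hn : 2 ≤ n)
  | D1 (n : ℕ) (hn : 4 ≤ n)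
  | E6
  | E7
  | E8
  | F4
  | G2
  | A2even (n : ℕ) (hn : 1 ≤ n)
  | A2odd (n : ℕ) (hn : 3 ≤ n)
  | D2 (n : ℕ) (hn : 2 ≤ n)
  | E62
  | D43

/-- The vertices of the diagram are labelled `0, ..., rank`. -/
def AffineType.rank : AffineType → ℕ
  | .A1 n _ => n
  | .B1 n _ => n
  | .C1 n _ => n
  | .D1 n _ => n
  | .E6 => 6
  | .E7 => 7
  | .E8 => 8
  | .F4 => 4
  | .G2 => 2
  | .A2even n _ => n
  | .A2odd n _ => n
  | .D2 n _ => n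
  | .E62 => 4
  | .D43 => 2

/-- The index set of the diagram. -/
abbrev AffineType.Node (X : AffineType) : Type := Fin (X.rank + 1)

/-! ### Cartan matrices -/

/-- A cycle of `n + 1` vertices (a double bond with entries `-2` if `n = 1`). -/
def cartanA (n i j : ℕ) : ℤ :=
  if i = j then 2
  else if n = 1 then -2
  else if i + 1 = j ∨ j + 1 = i ∨ (i = 0 ∧ j = n) ∨ (i = n ∧ j = 0) then -1
  else 0

/-- Vertices `0` and `1` are both joined to `2`, then a chain `2, ..., n`; `α_n` is short. -/
def cartanB (n i j : ℕ) : ℤ :=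
  if i = j then 2
  else if i = n ∧ j + 1 = n then -2
  else if (1 ≤ i ∧ i + 1 = j) ∨ (1 ≤ j ∧ j + 1 = i) ∨ (i = 0 ∧ j = 2) ∨ (i = 2 ∧ j = 0) then -1
  else 0

/-- A chain `0, ..., n` with `α_0` and `α_n` long. -/
def cartanC (n i j : ℕ) : ℤ :=
  if i = j then 2
  else if (i = 1 ∧ j = 0) ∨ (i + 1 = n ∧ j = n) then -2
  else if i + 1 = j ∨ j + 1 = i then -1
  else 0

/-- Vertices `0` and `1` are both joined to `2`, then a chain `2, ..., n - 2`, and `n - 1` and `n`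
are both joined to `n - 2`. -/
def cartanD (n i j : ℕ) : ℤ :=
  if i = j then 2
  else if (1 ≤ i ∧ i + 1 = j ∧ j < n) ∨ (1 ≤ j ∧ j + 1 = i ∧ i < n) ∨
      (i = 0 ∧ j = 2) ∨ (i = 2 ∧ j = 0) ∨ (i + 2 = n ∧ j = n) ∨ (i = n ∧ j + 2 = n) then -1
  else 0

/-- A chain `0, ..., n` with `α_0` shortest and `α_n` longest. -/
def cartanAeven (n i j : ℕ) : ℤ :=
  if i = j then 2
  else if n = 1 then (if i = 0 then -4 else -1)
  else if (i = 0 ∧ j = 1) ∨ (i + 1 = n ∧ j = n) then -2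
  else if i + 1 = j ∨ j + 1 = i then -1
  else 0

/-- The Cartan matrix, `C i j = ⟨α̌_i, α_j⟩`. -/
def AffineType.cartan : (X : AffineType) → Matrix X.Node X.Node ℤ
  | .A1 n _ => fun i j => cartanA n i.val j.val
  | .B1 n _ => fun i j => cartanB n i.val j.val
  | .C1 n _ => fun i j => cartanC n i.val j.val
  | .D1 n _ => fun i j => cartanD n i.val j.val
  | .E6 =>
    !![ 2,  0,  0,  0,  0,  0, -1;
        0,  2, -1,  0,  0,  0,  0;
        0, -1,  2, -1,  0,  0,  0;
        0,  0, -1,  2, -1,  0, -1;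
        0,  0,  0, -1,  2, -1,  0;
        0,  0,  0,  0, -1,  2,  0;
       -1,  0,  0, -1,  0,  0,  2]
  | .E7 =>
    !![ 2, -1,  0,  0,  0,  0,  0,  0;
       -1,  2, -1,  0,  0,  0,  0,  0;
        0, -1,  2, -1,  0,  0,  0,  0;
        0,  0, -1,  2, -1,  0,  0, -1;
        0,  0,  0, -1,  2, -1,  0,  0;
        0,  0,  0,  0, -1,  2, -1,  0;
        0,  0,  0,  0,  0, -1,  2,  0;
        0,  0,  0, -1,  0,  0,  0,  2]
  | .E8 =>
    !![ 2, -1,  0,  0,  0,  0,  0,  0,  0;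
       -1,  2, -1,  0,  0,  0,  0,  0,  0;
        0, -1,  2, -1,  0,  0,  0,  0,  0;
        0,  0, -1,  2, -1,  0,  0,  0,  0;
        0,  0,  0, -1,  2, -1,  0,  0,  0;
        0,  0,  0,  0, -1,  2, -1,  0, -1;
        0,  0,  0,  0,  0, -1,  2, -1,  0;
        0,  0,  0,  0,  0,  0, -1,  2,  0;
        0,  0,  0,  0,  0, -1,  0,  0,  2]
  | .F4 =>
    !![ 2, -1,  0,  0,  0;
       -1,  2, -1,  0,  0;
        0, -1,  2, -1,  0;
        0,  0, -2,  2, -1;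
        0,  0,  0, -1,  2]
  | .G2 =>
    !![ 2, -1,  0;
       -1,  2, -1;
        0, -3,  2]
  | .A2even n _ => fun i j => cartanAeven n i.val j.val
  | .A2odd n _ => fun i j => cartanB n j.val i.val
  | .D2 n _ => fun i j => cartanC n j.val i.val
  | .E62 =>
    !![ 2, -1,  0,  0,  0;
       -1,  2, -1,  0,  0;
        0, -1,  2, -2,  0;
        0,  0, -1,  2, -1;
        0,  0,  0, -1,  2]
  | .D43 =>
    !![ 2, -1,  0;
       -1,  2, -3;
        0, -1,  2]

/-- The dual Kac labels `ǎ_0, ..., ǎ_r`. -/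
def AffineType.dualLabel : (X : AffineType) → X.Node → ℕ
  | .A1 _ _ => fun _ => 1
  | .B1 n _ => fun i => if i.val ≤ 1 ∨ i.val = n then 1 else 2
  | .C1 _ _ => fun _ => 1
  | .D1 n _ => fun i => if i.val ≤ 1 ∨ n ≤ i.val + 1 then 1 else 2
  | .E6 => ![1, 1, 2, 3, 2, 1, 2]
  | .E7 => ![1, 2, 3, 4, 3, 2, 1, 2]
  | .E8 => ![1, 2, 3, 4, 5, 6, 4, 2, 3]
  | .F4 => ![1, 2, 3, 2, 1]
  | .G2 => ![1, 2, 1]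
  | .A2even _ _ => fun i => if i.val = 0 then 1 else 2
  | .A2odd _ _ => fun i => if i.val ≤ 1 then 1 else 2
  | .D2 n _ => fun i => if i.val = 0 ∨ i.val = n then 1 else 2
  | .E62 => ![1, 2, 3, 4, 2]
  | .D43 => ![1, 2, 3]

/-- The dual Kac labels are positive. -/
theorem AffineType.dualLabel_pos (X : AffineType) (i : X.Node) : 0 < X.dualLabel i := by
  cases X
  case E6 | E7 | E8 | F4 | G2 | E62 | D43 => revert i; decide
  all_goals (simp only [dualLabel]; try split_ifs) <;> norm_num

/-- The dual Kac labels are coprime (the label at the vertex `0` is `1`). -/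
theorem AffineType.dualLabel_zero (X : AffineType) : X.dualLabel 0 = 1 := by
  cases X <;> simp [dualLabel]

/-- A sum over `0, ..., n` whose terms vanish off a given finite set. -/
theorem sum_eq_of_support (n : ℕ) (f : ℕ → ℤ) (s : Finset ℕ) (hs : ∀ i ∈ s, i < n + 1)
    (h : ∀ i, i < n + 1 → i ∉ s → f i = 0) : ∑ i : Fin (n + 1), f i.val = ∑ i ∈ s, f i := by
  rw [Fin.sum_univ_eq_sum_range f]
  symm
  apply Finset.sum_subset
  · intro i hi; exact Finset.mem_range.2 (hs i hi)
  · intro i hi hi'; exact h i (Finset.mem_range.1 hi) hi'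

theorem sum_neighbours (n j : ℕ) (f : ℕ → ℤ) (hj : 1 ≤ j) (hjn : j < n)
    (h : ∀ i, i < n + 1 → i + 1 ≠ j → i ≠ j → i ≠ j + 1 → f i = 0) :
    ∑ i : Fin (n + 1), f i.val = f (j - 1) + f j + f (j + 1) := by
  rw [sum_eq_of_support n f {j - 1, j, j + 1}]
  · rw [Finset.sum_insert, Finset.sum_insert, Finset.sum_singleton, add_assoc] <;> simp <;> omega
  · intro i hi; simp at hi; omega
  · intro i hi hi'; simp at hi'; apply h i hi <;> omega

theorem sum_two (n p q : ℕ) (f : ℕ → ℤ) (hp : p < n + 1) (hq : q < n + 1) (hpq : p ≠ q)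
    (h : ∀ i, i < n + 1 → i ≠ p → i ≠ q → f i = 0) :
    ∑ i : Fin (n + 1), f i.val = f p + f q := by
  rw [sum_eq_of_support n f {p, q}]
  · rw [Finset.sum_insert, Finset.sum_singleton]; simpa using hpq
  · intro i hi; simp at hi; omega
  · intro i hi hi'; simp at hi'; exact h i hi hi'.1 hi'.2

theorem sum_three (n p q r : ℕ) (f : ℕ → ℤ) (hp : p < n + 1) (hq : q < n + 1) (hr : r < n + 1)
    (hpq : p ≠ q) (hpr : p ≠ r) (hqr : q ≠ r)
    (h : ∀ i, i < n + 1 → i ≠ p → i ≠ q → i ≠ r → f i = 0) :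
    ∑ i : Fin (n + 1), f i.val = f p + f q + f r := by
  rw [sum_eq_of_support n f {p, q, r}]
  · rw [Finset.sum_insert, Finset.sum_insert, Finset.sum_singleton, add_assoc] <;> simp <;> omega
  · intro i hi; simp at hi; omega
  · intro i hi hi'; simp at hi'; exact h i hi hi'.1 hi'.2.1 hi'.2.2

theorem sum_four (n p q r t : ℕ) (f : ℕ → ℤ) (hp : p < n + 1) (hq : q < n + 1) (hr : r < n + 1)
    (ht : t < n + 1) (hpq : p ≠ q) (hpr : p ≠ r) (hqr : q ≠ r) (hpt : p ≠ t) (hqt : q ≠ t)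
    (hrt : r ≠ t) (h : ∀ i, i < n + 1 → i ≠ p → i ≠ q → i ≠ r → i ≠ t → f i = 0) :
    ∑ i : Fin (n + 1), f i.val = f p + f q + f r + f t := by
  rw [sum_eq_of_support n f {p, q, r, t}]
  · rw [Finset.sum_insert, Finset.sum_insert, Finset.sum_insert, Finset.sum_singleton] <;>
      simp [add_assoc] <;> omega
  · intro i hi; simp at hi; omega
  · intro i hi hi'; simp at hi'; exact h i hi hi'.1 hi'.2.1 hi'.2.2.1 hi'.2.2.2

theorem dualLabel_cartanA (n j : ℕ) (hn : 1 ≤ n) (hj : j < n + 1) :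
    ∑ i : Fin (n + 1), ((1 : ℕ) : ℤ) * cartanA n i.val j = 0 := by
  let f : ℕ → ℤ := fun i => ((1 : ℕ) : ℤ) * cartanA n i j
  change ∑ i : Fin (n + 1), f i.val = 0
  rcases Nat.lt_or_ge n 2 with h2 | h2
  · rw [sum_two n 0 1 f] <;> grind [cartanA]
  · rcases Nat.eq_zero_or_pos j with h | h
    · rw [sum_three n 0 1 n f] <;> grind [cartanA]
    · rcases Nat.lt_or_ge j n with h' | h'
      · rw [sum_neighbours n j f] <;> grind [cartanA]
      · rw [sum_three n 0 (n - 1) n f] <;> grind [cartanA]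

theorem dualLabel_cartanB (n j : ℕ) (hn : 3 ≤ n) (hj : j < n + 1) :
    ∑ i : Fin (n + 1), ((if i.val ≤ 1 ∨ i.val = n then 1 else 2 : ℕ) : ℤ) * cartanB n i.val j
      = 0 := by
  let f : ℕ → ℤ := fun i => ((if i ≤ 1 ∨ i = n then 1 else 2 : ℕ) : ℤ) * cartanB n i j
  change ∑ i : Fin (n + 1), f i.val = 0
  by_cases h0 : j ≤ 1
  · rw [sum_two n j 2 f] <;> grind [cartanB]
  by_cases h2 : j = 2
  · rw [sum_four n 0 1 2 3 f] <;> grind [cartanB]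
  by_cases hjn : j = n
  · rw [sum_two n (n - 1) n f] <;> grind [cartanB]
  · rw [sum_neighbours n j f] <;> grind [cartanB]

theorem dualLabel_cartanB' (n j : ℕ) (hn : 3 ≤ n) (hj : j < n + 1) :
    ∑ i : Fin (n + 1), ((if i.val ≤ 1 then 1 else 2 : ℕ) : ℤ) * cartanB n j i.val = 0 := by
  let f : ℕ → ℤ := fun i => ((if i ≤ 1 then 1 else 2 : ℕ) : ℤ) * cartanB n j i
  change ∑ i : Fin (n + 1), f i.val = 0
  by_cases h0 : j ≤ 1
  · rw [sum_two n j 2 f] <;> grind [cartanB]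
  by_cases h2 : j = 2
  · rw [sum_four n 0 1 2 3 f] <;> grind [cartanB]
  by_cases hjn : j = n
  · rw [sum_two n (n - 1) n f] <;> grind [cartanB]
  · rw [sum_neighbours n j f] <;> grind [cartanB]

theorem dualLabel_cartanC (n j : ℕ) (hn : 2 ≤ n) (hj : j < n + 1) :
    ∑ i : Fin (n + 1), ((1 : ℕ) : ℤ) * cartanC n i.val j = 0 := by
  let f : ℕ → ℤ := fun i => ((1 : ℕ) : ℤ) * cartanC n i j
  change ∑ i : Fin (n + 1), f i.val = 0
  by_cases h0 : j = 0
  · rw [sum_two n 0 1 f] <;> grind [cartanC]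
  by_cases hjn : j = n
  · rw [sum_two n (n - 1) n f] <;> grind [cartanC]
  · rw [sum_neighbours n j f] <;> grind [cartanC]

theorem dualLabel_cartanC' (n j : ℕ) (hn : 2 ≤ n) (hj : j < n + 1) :
    ∑ i : Fin (n + 1), ((if i.val = 0 ∨ i.val = n then 1 else 2 : ℕ) : ℤ) * cartanC n j i.val
      = 0 := by
  let f : ℕ → ℤ := fun i => ((if i = 0 ∨ i = n then 1 else 2 : ℕ) : ℤ) * cartanC n j i
  change ∑ i : Fin (n + 1), f i.val = 0
  by_cases h0 : j = 0
  · rw [sum_two n 0 1 f] <;> grind [cartanC]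
  by_cases hjn : j = n
  · rw [sum_two n (n - 1) n f] <;> grind [cartanC]
  · rw [sum_neighbours n j f] <;> grind [cartanC]

theorem dualLabel_cartanD (n j : ℕ) (hn : 4 ≤ n) (hj : j < n + 1) :
    ∑ i : Fin (n + 1), ((if i.val ≤ 1 ∨ n ≤ i.val + 1 then 1 else 2 : ℕ) : ℤ) *
      cartanD n i.val j = 0 := by
  let f : ℕ → ℤ := fun i => ((if i ≤ 1 ∨ n ≤ i + 1 then 1 else 2 : ℕ) : ℤ) * cartanD n i j
  change ∑ i : Fin (n + 1), f i.val = 0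
  by_cases h0 : j ≤ 1
  · rw [sum_two n j 2 f] <;> grind [cartanD]
  by_cases hjn : n ≤ j + 1
  · rw [sum_two n (n - 2) j f] <;> grind [cartanD]
  by_cases h2 : j = 2
  · by_cases h4 : n = 4
    · subst h4 h2; decide
    · rw [sum_four n 0 1 2 3 f] <;> grind [cartanD]
  by_cases hn2 : j + 2 = n
  · rw [sum_four n (n - 3) (n - 2) (n - 1) n f] <;> grind [cartanD]
  · rw [sum_neighbours n j f] <;> grind [cartanD]

theorem dualLabel_cartanAeven (n j : ℕ) (hn : 1 ≤ n) (hj : j < n + 1) :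
    ∑ i : Fin (n + 1), ((if i.val = 0 then 1 else 2 : ℕ) : ℤ) * cartanAeven n i.val j = 0 := by
  let f : ℕ → ℤ := fun i => ((if i = 0 then 1 else 2 : ℕ) : ℤ) * cartanAeven n i j
  change ∑ i : Fin (n + 1), f i.val = 0
  by_cases h0 : j = 0
  · rw [sum_two n 0 1 f] <;> grind [cartanAeven]
  by_cases hjn : j = n
  · rw [sum_two n (n - 1) n f] <;> grind [cartanAeven]
  · rw [sum_neighbours n j f] <;> grind [cartanAeven]

/-- The dual Kac labels form a left null vector of the Cartan matrix. -/
theorem AffineType.dualLabel_cartan (X : AffineType) (j : X.Node) :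
    ∑ i, (X.dualLabel i : ℤ) * X.cartan i j = 0 := by
  cases X
  case A1 n hn => exact dualLabel_cartanA n j.val hn j.isLt
  case B1 n hn => exact dualLabel_cartanB n j.val hn j.isLt
  case C1 n hn => exact dualLabel_cartanC n j.val hn j.isLt
  case D1 n hn => exact dualLabel_cartanD n j.val hn j.isLt
  case A2even n hn => exact dualLabel_cartanAeven n j.val hn j.isLt
  case A2odd n hn => exact dualLabel_cartanB' n j.val hn j.isLt
  case D2 n hn => exact dualLabel_cartanC' n j.val hn j.isLt
  all_goals revert j; decide

/-! ### Diagram automorphisms and the action on the Cartan subalgebra -/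

/-- Diagram automorphisms: permutations of the vertices that preserve the Cartan matrix. -/
def IsDiagramAut (X : AffineType) (τ : Perm X.Node) : Prop :=
  ∀ i j, X.cartan (τ i) (τ j) = X.cartan i j

/-- The complex vector space `𝔥'` with basis the simple co-roots; a vector is given by its
coordinates in this basis. -/
abbrev Cartan' (X : AffineType) : Type := X.Node → ℂ

/-- The simple co-root `α̌_i`. -/
def coroot (X : AffineType) (i : X.Node) : Cartan' X := Pi.single i 1

/-- The simple root `α_j` as a linear form on `𝔥'`, with `α_j(α̌_i) = C i j`. -/
noncomputable def root (X : AffineType) (j : X.Node) : Module.Dual ℂ (Cartan' X) :=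
  ∑ i, (X.cartan i j : ℂ) • LinearMap.proj i

/-- The simple reflection `s_i(x) = x - α_i(x) α̌_i`. -/
noncomputable def simpleReflection (X : AffineType) (i : X.Node) : Module.End ℂ (Cartan' X) :=
  Module.preReflection (coroot X i) (root X i)

/-- The action of a diagram automorphism, `τ(α̌_i) = α̌_{τ(i)}`. -/
def autAction (X : AffineType) (τ : Perm X.Node) : Module.End ℂ (Cartan' X) :=
  LinearMap.funLeft ℂ ℂ τ.symm

/-- The canonical central element `c = ∑ ǎ_i α̌_i`. -/
noncomputable def central (X : AffineType) : Cartan' X := ∑ i, X.dualLabel i • coroot X i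

/-- The set of linear combinations of the simple co-roots with coefficients in `{0, 1, 2, ...}`. -/
def corootCone (X : AffineType) : AddSubmonoid (Cartan' X) :=
  AddSubmonoid.closure (Set.range (coroot X))

/-! ### Twisted Coxeter elements -/

/-- The smallest elements of the orbits of `τ`, in increasing order. -/
def leastReps {n : ℕ} (τ : Perm (Fin (n + 1))) : List (Fin (n + 1)) :=
  (List.finRange (n + 1)).filter fun i => ∀ j, τ.SameCycle i j → i ≤ j

/-- The smallest nonzero elements of the orbits of `τ`, in increasing order. -/
def leastNonzeroReps {n : ℕ} (τ : Perm (Fin (n + 1))) : List (Fin (n + 1)) :=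
  (List.finRange (n + 1)).filter fun i => i ≠ 0 ∧ ∀ j, j ≠ 0 → τ.SameCycle i j → i ≤ j

/-- In type `D_n^{(1)}`: if `0` and `1` lie in one orbit, the smallest nonzero representatives,
otherwise the smallest representatives. -/
def wordD {n : ℕ} (τ : Perm (Fin (n + 1))) : List (Fin (n + 1)) :=
  if τ.SameCycle 0 1 then leastNonzeroReps τ else leastReps τ

/-- In type `E_6^{(1)}`: the word `1, 2, 3` for the automorphisms of order `3`, and the smallest
representatives for the involutions. -/
def wordE6 (τ : Perm (Fin 7)) : List (Fin 7) :=
  if τ ^ 3 = 1 then [1, 2, 3] else leastReps τ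

/-- The chosen word `i_1, ..., i_s` of representatives of the orbits of a nontrivial diagram
automorphism `τ`. -/
def coxeterWord : (X : AffineType) → Perm X.Node → List X.Node
  | .B1 n _, _ => (List.finRange (n + 1)).filter fun i => i ≠ 0
  | .A2odd n _, _ => (List.finRange (n + 1)).filter fun i => i ≠ 0
  | .D1 n _, τ => wordD (n := n) τ
  | .E6, τ => wordE6 τ
  | _, τ => leastReps τ

/-- The twisted Coxeter element `s_{i_1} ⋯ s_{i_s} τ`, acting on `𝔥'`. -/
noncomputable def twistedCoxeter (X : AffineType) (τ : Perm X.Node) : Module.End ℂ (Cartan' X) :=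
  ((coxeterWord X τ).map (simpleReflection X)).prod * autAction X τ

/-- `b` is a combination of simple co-roots with coefficients in `{0, 1, 2, ...}` and
`(cox^τ - 1)(b) = k c`. -/
def IsSolution (X : AffineType) (τ : Perm X.Node) (k : ℕ) (b : Cartan' X) : Prop :=
  b ∈ corootCone X ∧ (twistedCoxeter X τ - 1) b = k • central X

/-- A solution with `k` positive and minimal, and such that `b - c` is not a combination of simple
co-roots with coefficients in `{0, 1, 2, ...}`. -/
def IsMinimalSolution (X : AffineType) (τ : Perm X.Node) (k : ℕ) (b : Cartan' X) : Prop :=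
  0 < k ∧ IsSolution X τ k b ∧ b - central X ∉ corootCone X ∧
    ∀ (k' : ℕ) (b' : Cartan' X), 0 < k' → IsSolution X τ k' b' → k ≤ k'

/-! ### The chosen automorphisms and the table -/

/-- In type `A_n^{(1)}`: `γ(i) = i + 1 mod n + 1`. -/
def gammaA (n : ℕ) : Perm (Fin (n + 1)) := finRotate (n + 1)

/-- In type `A_n^{(1)}`: `σ(0) = 0` and `σ(i) = n + 1 - i` otherwise. -/
def sigmaA (n : ℕ) : Perm (Fin (n + 1)) := Equiv.neg (Fin (n + 1))

/-- In types `B_n^{(1)}` and `A_{2n-1}^{(2)}`: the exchange of `0` and `1`. -/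
def gammaB (n : ℕ) : Perm (Fin (n + 1)) := swap 0 1

/-- In types `C_n^{(1)}` and `D_{n+1}^{(2)}`: `γ(i) = n - i`. -/
def gammaC (n : ℕ) : Perm (Fin (n + 1)) := Fin.revPerm

/-- In type `D_n^{(1)}`: `γ(0) = n`, `γ(1) = n - 1`, `γ(n - 1) = 0`, `γ(n) = 1`, and
`γ(i) = n - i` otherwise. -/
def gammaD (n : ℕ) : Perm (Fin (n + 1)) := swap 0 1 * Fin.revPerm

/-- In type `D_n^{(1)}`: the exchange of `n - 1` and `n`. -/
def sigmaD (n : ℕ) : Perm (Fin (n + 1)) := swap (Fin.rev 1) (Fin.rev 0)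

/-- In type `D_4^{(1)}`: `ρ(1) = 3`, `ρ(3) = 4`, `ρ(4) = 1`. -/
def rhoD4 : Perm (Fin 5) := swap 1 3 * swap 3 4

/-- In type `E_6^{(1)}`: the cycles `0 ↦ 1 ↦ 5 ↦ 0` and `2 ↦ 4 ↦ 6 ↦ 2`. -/
def gammaE6 : Perm (Fin 7) := swap 0 1 * swap 1 5 * (swap 2 4 * swap 4 6)

/-- In type `E_6^{(1)}`: the exchanges `1 ↔ 5` and `2 ↔ 4`. -/
def sigmaE6 : Perm (Fin 7) := swap 1 5 * swap 2 4

/-- In type `E_7^{(1)}`: the exchanges `0 ↔ 6`, `1 ↔ 5` and `2 ↔ 4`. -/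
def gammaE7 : Perm (Fin 8) := swap 0 6 * swap 1 5 * swap 2 4

/-- The table: `TableRow X τ k b` says that the pair listed for the automorphism `τ` of the diagram
`X` is the number `k` and the element `b` with coordinates `b 0, ..., b r`. -/
inductive TableRow : (X : AffineType) → Perm X.Node → ℕ → (X.Node → ℕ) → Prop
  | A_gamma (n l : ℕ) (hn : 1 ≤ n) (hl : l ∣ n + 1) (hln : l < n + 1) :
      TableRow (.A1 n hn) (gammaA n ^ l) l fun i => n - i.val
  | A_sigma_even (n m : ℕ) (hn : 2 ≤ n) (hm : n = 2 * m) :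
      TableRow (.A1 n (by omega)) (sigmaA n) 1 fun i =>
        if i.val = 0 then m else if i.val ≤ m + 1 then m + 1 - i.val else i.val - (m + 1)
  | A_sigma_odd (n m : ℕ) (hn : 3 ≤ n) (hm : n = 2 * m + 1) :
      TableRow (.A1 n (by omega)) (sigmaA n) 1 fun i =>
        if i.val = 0 then m else if i.val ≤ m + 1 then m + 1 - i.val else i.val - (m + 2)
  | A_sigma_gamma_odd (n m : ℕ) (hn : 3 ≤ n) (hm : n = 2 * m + 1) :
      TableRow (.A1 n (by omega)) (sigmaA n * gammaA n) 1 fun i =>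
        if i.val ≤ m + 1 then m + 1 - i.val else i.val - (m + 1)
  | B_even (n m : ℕ) (hn : 3 ≤ n) (hm : n = 2 * m) :
      TableRow (.B1 n hn) (gammaB n) 1 fun i =>
        if i.val = 0 then m - 1 else if i.val = 1 then m else n - i.val
  | B_odd (n m : ℕ) (hn : 3 ≤ n) (hm : n = 2 * m + 1) :
      TableRow (.B1 n hn) (gammaB n) 2 fun i =>
        if i.val = 0 then n - 2 else if i.val = 1 then n else 2 * (n - i.val)
  | C_even (n m : ℕ) (hn : 2 ≤ n) (hm : n = 2 * m) :
      TableRow (.C1 n hn) (gammaC n) 1 fun i =>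
        if i.val ≤ m then m - i.val else i.val - (m + 1)
  | C_odd (n m : ℕ) (hn : 2 ≤ n) (hm : n = 2 * m + 1) :
      TableRow (.C1 n hn) (gammaC n) 1 fun i =>
        if i.val ≤ m + 1 then m + 1 - i.val else i.val - (m + 1)
  | D4_gamma (hn : 4 ≤ 4) : TableRow (.D1 4 hn) (gammaD 4) 1 ![1, 3, 2, 2, 0]
  | D4_gamma_sq (hn : 4 ≤ 4) : TableRow (.D1 4 hn) (gammaD 4 ^ 2) 1 ![1, 2, 2, 1, 0]
  | D4_sigma (hn : 4 ≤ 4) : TableRow (.D1 4 hn) (sigmaD 4) 2 ![3, 3, 4, 2, 0]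
  | D4_rho (hn : 4 ≤ 4) : TableRow (.D1 4 hn) rhoD4 1 ![1, 2, 1, 1, 0]
  | D_gamma_even (n m : ℕ) (hn : 5 ≤ n) (hm : n = 2 * m) :
      TableRow (.D1 n (by omega)) (gammaD n) 1 fun i =>
        if i.val = 0 then m - 2 else if i.val = 1 then m
        else if i.val ≤ m then 2 * (m - i.val)
        else if i.val ≤ n - 2 then 2 * (i.val - (m + 1))
        else if i.val = n - 1 then m - 1 else m - 3
  | D_gamma_sq_even (n m : ℕ) (hn : 5 ≤ n) (hm : n = 2 * m) :
      TableRow (.D1 n (by omega)) (gammaD n ^ 2) 1 fun i =>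
        if i.val = 0 then m - 1 else if i.val = 1 then m else n - i.val
  | D_sigma_even (n m : ℕ) (hn : 5 ≤ n) (hm : n = 2 * m) :
      TableRow (.D1 n (by omega)) (sigmaD n) 2 fun i =>
        if i.val ≤ 1 then n - 1 else 2 * (n - i.val)
  | D_gamma_sigma_even (n m : ℕ) (hn : 5 ≤ n) (hm : n = 2 * m) :
      TableRow (.D1 n (by omega)) (gammaD n * sigmaD n) 1 fun i =>
        if i.val ≤ 1 then m - 1
        else if i.val ≤ m then 2 * (m - i.val)
        else if i.val ≤ n - 2 then 2 * (i.val - (m + 1))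
        else m - 2
  | D_gamma_odd (n m : ℕ) (hn : 5 ≤ n) (hm : n = 2 * m + 1) :
      TableRow (.D1 n (by omega)) (gammaD n) 1 fun i =>
        if i.val = 0 then m - 1 else if i.val = 1 then m + 1
        else if i.val ≤ m + 1 then 2 * (m + 1 - i.val)
        else if i.val ≤ n - 2 then 2 * (i.val - (m + 1))
        else if i.val = n - 1 then m else m - 2
  | D_gamma_sq_odd (n m : ℕ) (hn : 5 ≤ n) (hm : n = 2 * m + 1) :
      TableRow (.D1 n (by omega)) (gammaD n ^ 2) 2 fun i =>
        if i.val = 0 then n - 2 else if i.val = 1 then n else 2 * (n - i.val)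
  | D_sigma_odd (n m : ℕ) (hn : 5 ≤ n) (hm : n = 2 * m + 1) :
      TableRow (.D1 n (by omega)) (sigmaD n) 1 fun i =>
        if i.val ≤ 1 then m else n - i.val
  | D_gamma_sigma_odd (n m : ℕ) (hn : 5 ≤ n) (hm : n = 2 * m + 1) :
      TableRow (.D1 n (by omega)) (gammaD n * sigmaD n) 1 fun i =>
        if i.val ≤ 1 then m
        else if i.val ≤ m + 1 then 2 * (m + 1 - i.val)
        else if i.val ≤ n - 2 then 2 * (i.val - (m + 1))
        else m - 1
  | E6_gamma : TableRow .E6 gammaE6 1 ![2, 4, 5, 3, 3, 3, 1]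
  | E6_sigma : TableRow .E6 sigmaE6 1 ![1, 3, 4, 3, 2, 2, 1]
  | E7_gamma : TableRow .E7 gammaE7 1 ![4, 6, 6, 4, 3, 4, 3, 1]
  | Aodd_even (n m : ℕ) (hn : 3 ≤ n) (hm : n = 2 * m) :
      TableRow (.A2odd n hn) (gammaB n) 1 fun i =>
        if i.val = 0 then m - 1 else if i.val = 1 then m else n - i.val
  | Aodd_odd (n m : ℕ) (hn : 3 ≤ n) (hm : n = 2 * m + 1) :
      TableRow (.A2odd n hn) (gammaB n) 1 fun i =>
        if i.val = 0 then m else if i.val = 1 then m + 1 else n + 1 - i.val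
  | D2_even (n m : ℕ) (hn : 2 ≤ n) (hm : n = 2 * m) :
      TableRow (.D2 n hn) (gammaC n) 1 fun i =>
        if i.val = 0 then m
        else if i.val ≤ m then 2 * (m - i.val)
        else if i.val < n then 2 * (i.val - (m + 1))
        else m - 1
  | D2_odd (n m : ℕ) (hn : 2 ≤ n) (hm : n = 2 * m + 1) :
      TableRow (.D2 n hn) (gammaC n) 1 fun i =>
        if i.val = 0 then m + 1
        else if i.val ≤ m + 1 then 2 * (m + 1 - i.val)
        else if i.val < n then 2 * (i.val - (m + 1))
        else m

end AffineCoxeter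

/-!
# Twisted Coxeter elements of affine diagrams

Let `C` be the Cartan matrix of an affine diagram with `N` vertices, `τ` a nontrivial diagram
automorphism and `g = s_{i_1} ⋯ s_{i_s} τ` the twisted Coxeter element.

*Fixed vectors.* The word `i_1, ..., i_s` is a transversal of the orbits of `τ`
(`isTransversal_coxeterWord`). If `g x = x`, then `τ x` and `x` agree off the transversal, which
forces `τ x = x`; then the product of the reflections fixes `x`, so that all simple roots vanish on
`x`, and `x` is a multiple of `c` (`IsAffineMatrix.exists_eq_smul_of_coxEnd_eq`). This gives the
uniqueness of the minimal solution.

*Existence.* The transformation `g` is an isometry of the symmetrized Cartan matrix, a symmetric form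
whose radical is spanned by `c`. Since the sign of `τ` is `(-1)^(N-s)`, the determinant of `g` is
`(-1)^N` (`det_coxEnd`). An isometry of a nondegenerate form on an `N`-dimensional space without
eigenvalue `1` has this determinant; on the quotient by the radical, of dimension `N - 1`, the sign is
the wrong one, so that `g` has a nonzero fixed vector there. As the fixed vectors of `g` itself are
the multiples of `c`, a preimage `b` of it satisfies `(g - 1) b ∈ ℚ^× c`. Technically the quotient is
avoided by making the form nondegenerate with the help of an invariant linear form
(`exists_sub_eq_of_isometry`). Clearing denominators and adding a multiple of `c` yields a solution in
natural numbers.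

*The table.* Let `(k, b)` and `(k', b')` be solutions. Then `k b' - k' b` is an integral multiple of
`c`, and comparison of two coordinates with dual Kac label `1` at which the values of `b` have a
difference prime to `k` shows that `k` divides `k'` (`isMinimalSolution_of_isCoprime`). The equation
`g b = b + k c` itself is checked one reflection at a time: the reflections are applied in decreasing
order of the vertices, and each replaces one coordinate of `τ b` by that of `b + k c`
(`prod_refl_filter_apply`). Each step involves only the neighbours of one vertex, and is a linear
identity in each of the finitely many positions of the vertex relative to the ends of the diagram and
to the breaks in the definition of `b`.
-/

namespace AffineCoxeter

open Equiv

/-! ### Isometries of a semidefinite form -/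

section Isometry

variable {ι : Type*} [Fintype ι] [DecidableEq ι] {K : Type*} [Field K]

open Matrix in
/-- An isometry of a nondegenerate form on an `N`-dimensional space has the eigenvalue `1` if its
determinant is `-(-1)^N`. -/
theorem det_sub_one_eq_zero_of_isometry [CharZero K] (S G : Matrix ι ι K) (hS : S.det ≠ 0)
    (h : Gᵀ * S * G = S) (hG : G.det = -(-1) ^ Fintype.card ι) : (G - 1).det = 0 := by
  have h1 : Gᵀ * S * (G - 1) = (-(G - 1))ᵀ * S := by
    rw [mul_sub, h, neg_sub, transpose_sub, transpose_one, sub_mul, one_mul, mul_one]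
  have h2 := congrArg Matrix.det h1
  rw [det_mul, det_mul, det_mul, det_transpose, det_transpose, det_neg, hG] at h2
  have h3 : (-1 : K) ^ Fintype.card ι ≠ 0 := pow_ne_zero _ (by simp)
  have h4 : 2 * ((-1 : K) ^ Fintype.card ι * S.det) * (G - 1).det = 0 := by linear_combination -h2
  simpa [h3, hS] using h4

open Matrix in
/-- Let `g` be an isometry of a symmetric form `S` whose radical is the line through `c`. If the
space of fixed vectors of `g` is that line and `det g = (-1)^N`, then `c` lies in the image of
`g - 1`.

Otherwise some `g`-invariant linear form `u` takes the value `1` at `c`. Then `S + u ⊗ u` is a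
nondegenerate form preserved by `g` and by the reflection `x ↦ x - 2 u(x) c`; their product has
determinant `-(-1)^N`, hence a fixed vector, and such a vector is fixed by `g` and killed by `u`. -/
theorem exists_sub_eq_of_isometry [CharZero K] (M S : Matrix ι ι K) (c : ι → K)
    (hS : Sᵀ = S) (hSc : S *ᵥ c = 0) (hrad : ∀ x, S *ᵥ x = 0 → ∃ t : K, x = t • c)
    (hM : Mᵀ * S * M = S) (hMc : M *ᵥ c = c) (hfix : ∀ x, M *ᵥ x = x → ∃ t : K, x = t • c)
    (hdet : M.det = (-1) ^ Fintype.card ι) : ∃ b, M *ᵥ b - b = c := by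
  by_contra hcon
  have hnot : c ∉ LinearMap.range (Matrix.toLin' (M - 1)) := by
    rintro ⟨b, hb⟩
    exact hcon ⟨b, by simpa [Matrix.sub_mulVec] using hb⟩
  obtain ⟨φ, hφc, hφ⟩ := Submodule.exists_le_ker_of_notMem hnot
  set u : ι → K := fun i => (φ c)⁻¹ * φ (Pi.single i 1) with hu
  have hval : ∀ x, u ⬝ᵥ x = (φ c)⁻¹ * φ x := by
    intro x
    conv_rhs => rw [LinearMap.pi_apply_eq_sum_univ φ x]
    simp only [dotProduct, hu, Finset.mul_sum, smul_eq_mul]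
    refine Finset.sum_congr rfl fun i _ => ?_
    have : (fun j => if i = j then (1 : K) else 0) = Pi.single i 1 := by
      ext j; simp [Pi.single_apply, eq_comm]
    rw [this]; ring
  have huc : u ⬝ᵥ c = 1 := by rw [hval, inv_mul_cancel₀ hφc]
  have huM : ∀ x, u ⬝ᵥ (M *ᵥ x) = u ⬝ᵥ x := by
    intro x
    have : φ (M *ᵥ x - x) = 0 := hφ ⟨x, by simp⟩
    rw [map_sub, sub_eq_zero] at this
    rw [hval, hval, this]
  have huM' : u ᵥ* M = u := by
    refine dotProduct_eq _ _ fun x => ?_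
    rw [← dotProduct_mulVec, huM]
  have hcS : c ᵥ* S = 0 := by rw [← hS, vecMul_transpose, hSc]
  -- the nondegenerate form
  set S' : Matrix ι ι K := S + vecMulVec u u with hS'
  have hS'x : ∀ x, S' *ᵥ x = S *ᵥ x + (u ⬝ᵥ x) • u := by
    intro x
    rw [hS', add_mulVec, vecMulVec_mulVec]
    simp
  have hS'det : S'.det ≠ 0 := by
    intro h0
    obtain ⟨x, hx0, hx⟩ := Matrix.exists_mulVec_eq_zero_iff.2 h0
    have h1 := congrArg (c ⬝ᵥ ·) hx
    simp only [hS'x, dotProduct_add, dotProduct_smul, dotProduct_zero] at h1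
    rw [dotProduct_mulVec, hcS, zero_dotProduct, zero_add, dotProduct_comm c u, huc, smul_eq_mul,
      mul_one] at h1
    have h2 := hx
    rw [hS'x, h1, zero_smul, add_zero] at h2
    obtain ⟨t, rfl⟩ := hrad x h2
    rw [dotProduct_smul, huc, smul_eq_mul, mul_one] at h1
    exact hx0 (by rw [h1, zero_smul])
  -- the isometry with the other determinant
  set G : Matrix ι ι K := M * (1 - (2 : K) • vecMulVec c u) with hG
  have hGx : ∀ x, G *ᵥ x = M *ᵥ x - (2 * (u ⬝ᵥ x)) • c := by
    intro x
    rw [hG, ← mulVec_mulVec, sub_mulVec, one_mulVec, smul_mulVec, vecMulVec_mulVec, mulVec_sub]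
    simp [mulVec_smul, hMc, smul_smul]
  have hGS : Gᵀ * S' * G = S' := by
    have hMS' : Mᵀ * S' * M = S' := by
      rw [hS', mul_add, add_mul, hM, mul_vecMulVec, vecMulVec_mul, mulVec_transpose, huM']
    have hr : (1 - (2 : K) • vecMulVec c u)ᵀ * S' * (1 - (2 : K) • vecMulVec c u) = S' := by
      have h1 : S' * vecMulVec c u = vecMulVec u u := by
        rw [mul_vecMulVec, hS'x, hSc, huc]; simp
      have h2 : vecMulVec u c * S' = vecMulVec u u := by
        rw [vecMulVec_mul, hS', vecMul_add, hcS, vecMul_vecMulVec, dotProduct_comm, huc]; simp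
      have h3 : vecMulVec u u * vecMulVec c u = vecMulVec u u := by
        rw [vecMulVec_mul_vecMulVec, huc]; simp
      rw [transpose_sub, transpose_one, transpose_smul, transpose_vecMulVec]
      simp only [sub_mul, mul_sub, one_mul, mul_one, smul_mul_assoc, mul_smul_comm, h1, h2, h3]
      module
    calc Gᵀ * S' * G = (1 - (2 : K) • vecMulVec c u)ᵀ * (Mᵀ * S' * M) *
          (1 - (2 : K) • vecMulVec c u) := by
          rw [hG, transpose_mul]; simp only [mul_assoc]
      _ = S' := by rw [hMS', hr]
  have hGdet : G.det = -(-1) ^ Fintype.card ι := by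
    have : (1 - (2 : K) • vecMulVec c u).det = -1 := by
      have h1 : (1 - (2 : K) • vecMulVec c u) =
          1 + replicateCol Unit ((-2 : K) • c) * replicateRow Unit u := by
        rw [← vecMulVec_eq, smul_vecMulVec, neg_smul, sub_eq_add_neg]
      rw [h1, det_one_add_replicateCol_mul_replicateRow, dotProduct_smul, huc]
      norm_num
    rw [hG, det_mul, this, hdet]; ring
  obtain ⟨x, hx0, hx⟩ := Matrix.exists_mulVec_eq_zero_iff.2
    (det_sub_one_eq_zero_of_isometry S' G hS'det hGS hGdet)
  rw [sub_mulVec, one_mulVec, sub_eq_zero, hGx] at hx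
  have h1 := congrArg (u ⬝ᵥ ·) hx
  simp only [dotProduct_sub, dotProduct_smul, huM, huc, smul_eq_mul, mul_one] at h1
  have h2 : u ⬝ᵥ x = 0 := by
    have : (2 : K) * (u ⬝ᵥ x) = 0 := by linear_combination -h1
    simpa using this
  rw [h2, mul_zero, zero_smul, sub_zero] at hx
  obtain ⟨t, rfl⟩ := hfix x hx
  rw [dotProduct_smul, huc, smul_eq_mul, mul_one] at h2
  exact hx0 (by rw [h2, zero_smul])

end Isometry

/-! ### Orbit transversals of a permutation -/

section Transversal

variable {ι : Type*}

/-- The list `w` consists of exactly one element of each orbit of `τ`. -/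
structure IsTransversal (τ : Perm ι) (w : List ι) : Prop where
  nodup : w.Nodup
  exists_mem : ∀ i, ∃ j ∈ w, τ.SameCycle i j
  unique : ∀ i ∈ w, ∀ j ∈ w, τ.SameCycle i j → i = j

/-- The number of orbits of `τ` determines its sign. -/
theorem IsTransversal.sign_mul [Fintype ι] [DecidableEq ι] {τ : Perm ι} {w : List ι}
    (h : IsTransversal τ w) :
    (-1 : ℤ) ^ w.length * (Perm.sign τ : ℤ) = (-1) ^ Fintype.card ι := by
  classical
  have hlen : w.length = w.toFinset.card := (List.toFinset_card_of_nodup h.nodup).symm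
  have hfix : (w.toFinset.filter (· ∉ τ.support)) = τ.supportᶜ := by
    ext i
    simp only [Finset.mem_filter, List.mem_toFinset, Finset.mem_compl, and_iff_right_iff_imp]
    intro hi
    obtain ⟨j, hj, hij⟩ := h.exists_mem i
    rw [Perm.notMem_support] at hi
    rwa [hij.eq_of_left hi]
  have hcyc : (w.toFinset.filter (· ∈ τ.support)).card = τ.cycleFactorsFinset.card := by
    refine Finset.card_bij (fun i _ => τ.cycleOf i) ?_ ?_ ?_
    · intro i hi
      exact Perm.cycleOf_mem_cycleFactorsFinset_iff.2 (Finset.mem_filter.1 hi).2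
    · intro i hi j hj hij
      simp only [Finset.mem_filter, List.mem_toFinset] at hi hj
      exact h.unique i hi.1 j hj.1
        ((Perm.sameCycle_iff_cycleOf_eq_of_mem_support hi.2 hj.2).2 hij)
    · intro f hf
      obtain ⟨i, hi⟩ := (Perm.mem_cycleFactorsFinset_iff.1 hf).1.nonempty_support
      have hfi := Perm.cycle_is_cycleOf hi hf
      obtain ⟨j, hj, hij⟩ := h.exists_mem i
      refine ⟨j, ?_, ?_⟩
      · simp only [Finset.mem_filter, List.mem_toFinset]
        refine ⟨hj, ?_⟩
        rw [← Perm.cycleOf_mem_cycleFactorsFinset_iff, ← hij.cycleOf_eq, ← hfi]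
        exact hf
      · rw [← hij.cycleOf_eq, hfi]
  have hsum := Finset.card_filter_add_card_filter_not (s := w.toFinset) (· ∈ τ.support)
  rw [hfix, hcyc, Finset.card_compl, ← hlen] at hsum
  have hct : τ.cycleType.card = τ.cycleFactorsFinset.card := by
    rw [Perm.cycleType_def, Multiset.card_map]; rfl
  have hle := τ.sum_cycleType_le
  rw [Perm.sign_of_cycleType, hct]
  rw [Perm.sum_cycleType] at hle ⊢
  push_cast
  rw [← pow_add]
  refine (neg_one_pow_congr ?_)
  rw [← hsum]
  have : τ.cycleFactorsFinset.card + (Fintype.card ι - τ.support.card) +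
      (τ.support.card + τ.cycleFactorsFinset.card) =
      Fintype.card ι + 2 * τ.cycleFactorsFinset.card := by omega
  rw [this]
  simp [Nat.even_add]

/-- A function that is invariant under `τ` off a transversal is invariant under `τ`. -/
theorem IsTransversal.apply_eq [Finite ι] {R : Type*} {τ : Perm ι} {w : List ι}
    (h : IsTransversal τ w) (x : ι → R) (hx : ∀ i, i ∉ w → x (τ.symm i) = x i) (i : ι) :
    x (τ i) = x i := by
  have key : ∀ i ∈ w, ∀ k : ℕ, x ((τ ^ k) i) = x i := by
    intro i hi k
    induction k with
    | zero => rfl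
    | succ k ih =>
      by_cases hk : (τ ^ (k + 1)) i ∈ w
      · rw [← h.unique i hi _ hk ⟨(k + 1 : ℕ), by rw [zpow_natCast]⟩]
      · rw [← hx _ hk, pow_succ', Perm.mul_apply, Equiv.symm_apply_apply, ih]
  obtain ⟨j, hj, hij⟩ := h.exists_mem i
  obtain ⟨k, hk⟩ := hij.symm.exists_nat_pow_eq
  rw [← hk, ← Perm.mul_apply, ← pow_succ', key j hj, key j hj]

end Transversal

/-! ### Twisted Coxeter elements over a commutative ring -/

section Generic

variable {ι : Type*} [Fintype ι] [DecidableEq ι]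

/-- The simple reflection `x ↦ x - α_i(x) α̌_i` in the coordinates of the simple co-roots, over any
commutative ring. -/
def refl (R : Type*) [CommRing R] (C : Matrix ι ι ℤ) (i : ι) : Module.End R (ι → R) :=
  Module.preReflection (Pi.single i 1) (∑ j, (C j i : R) • LinearMap.proj j)

/-- The product of simple reflections along the word `w`, composed with the action of `τ`, over any
commutative ring. -/
def coxEnd (R : Type*) [CommRing R] (C : Matrix ι ι ℤ) (w : List ι) (τ : Perm ι) :
    Module.End R (ι → R) :=
  (w.map (refl R C)).prod * LinearMap.funLeft R R τ.symm

variable {R : Type*} [CommRing R] {C : Matrix ι ι ℤ}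

theorem refl_apply (i : ι) (x : ι → R) :
    refl R C i x = x - (∑ j, (C j i : R) * x j) • Pi.single i 1 := by
  simp [refl, Module.preReflection_apply, LinearMap.sum_apply]

theorem refl_apply_same (i : ι) (x : ι → R) :
    refl R C i x i = x i - ∑ j, (C j i : R) * x j := by
  simp [refl_apply]

theorem refl_apply_of_ne {i k : ι} (h : k ≠ i) (x : ι → R) : refl R C i x k = x k := by
  simp [refl_apply, h]

theorem refl_eq_self_iff (i : ι) (x : ι → R) :
    refl R C i x = x ↔ ∑ j, (C j i : R) * x j = 0 := by
  constructor
  · intro h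
    have := congrFun h i
    rw [refl_apply_same] at this
    linear_combination -this
  · intro h
    rw [refl_apply, h, zero_smul, sub_zero]

theorem refl_refl (i : ι) (hi : C i i = 2) (x : ι → R) : refl R C i (refl R C i x) = x := by
  have : Function.Involutive (refl R C i) := by
    refine Module.involutive_preReflection ?_
    simp [LinearMap.sum_apply, Pi.single_apply, hi]
  exact this x

theorem refl_map {S : Type*} [CommRing S] (f : R →+* S) (i : ι) (x : ι → R) :
    refl S C i (f ∘ x) = f ∘ refl R C i x := by
  ext k
  by_cases h : k = i
  · subst h
    simp [refl_apply_same]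
  · simp [refl_apply_of_ne h]

theorem prod_refl_map {S : Type*} [CommRing S] (f : R →+* S) (w : List ι) (x : ι → R) :
    (w.map (refl S C)).prod (f ∘ x) = f ∘ (w.map (refl R C)).prod x := by
  induction w with
  | nil => rfl
  | cons i w ih => simp only [List.map_cons, List.prod_cons, Module.End.mul_apply, ih, refl_map]

theorem coxEnd_apply (w : List ι) (τ : Perm ι) (x : ι → R) :
    coxEnd R C w τ x = (w.map (refl R C)).prod (x ∘ τ.symm) := rfl

theorem coxEnd_map {S : Type*} [CommRing S] (f : R →+* S) (w : List ι) (τ : Perm ι) (x : ι → R) :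
    coxEnd S C w τ (f ∘ x) = f ∘ coxEnd R C w τ x := by
  rw [coxEnd_apply, Function.comp_assoc, prod_refl_map, coxEnd_apply]

theorem prod_refl_apply_of_notMem {w : List ι} {k : ι} (hk : k ∉ w) (x : ι → R) :
    (w.map (refl R C)).prod x k = x k := by
  induction w with
  | nil => rfl
  | cons i w ih =>
    simp only [List.mem_cons, not_or] at hk
    rw [List.map_cons, List.prod_cons, Module.End.mul_apply, refl_apply_of_ne hk.1, ih hk.2]

/-- A product of distinct simple reflections fixes `x` only if each of them does. -/
theorem sum_eq_zero_of_prod_refl_eq {w : List ι} (hw : w.Nodup) (hC : ∀ i, C i i = 2) (x : ι → R)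
    (hx : (w.map (refl R C)).prod x = x) : ∀ i ∈ w, ∑ j, (C j i : R) * x j = 0 := by
  induction w with
  | nil => simp
  | cons i w ih =>
    rw [List.nodup_cons] at hw
    rw [List.map_cons, List.prod_cons, Module.End.mul_apply] at hx
    have h1 : (w.map (refl R C)).prod x = refl R C i x := by
      rw [← hx, refl_refl i (hC i), hx]
    have h2 := congrFun h1 i
    rw [prod_refl_apply_of_notMem hw.1, refl_apply_same] at h2
    have h3 : ∑ j, (C j i : R) * x j = 0 := by linear_combination h2
    rw [(refl_eq_self_iff i x).2 h3] at h1
    intro k hk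
    rcases List.mem_cons.1 hk with rfl | hk
    · exact h3
    · exact ih hw.2 h1 k hk

theorem det_refl (i : ι) (hi : C i i = 2) : LinearMap.det (refl R C i) = -1 := by
  have h : refl R C i = LinearMap.transvection (-(∑ j, (C j i : R) • LinearMap.proj j))
      (Pi.single i 1) := by
    ext x
    simp [refl, Module.preReflection_apply, LinearMap.transvection.apply, sub_eq_add_neg]
  rw [h, LinearMap.transvection.det]
  simp [LinearMap.sum_apply, Pi.single_apply, hi]
  norm_num

theorem det_funLeft (τ : Perm ι) :
    LinearMap.det (LinearMap.funLeft R R τ) = ((Perm.sign τ : ℤ) : R) := by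
  rw [← LinearMap.det_toMatrix', ← Matrix.det_permutation]
  congr 1
  ext i j
  simp [LinearMap.toMatrix'_apply, PEquiv.toMatrix_apply, Pi.single_apply, eq_comm]

/-- Each reflection contributes `-1`, and the sign of `τ` is given by the number of its orbits, which
is the length of the word. -/
theorem det_coxEnd {w : List ι} {τ : Perm ι} (h : IsTransversal τ w) (hC : ∀ i, C i i = 2) :
    LinearMap.det (coxEnd R C w τ) = (-1) ^ Fintype.card ι := by
  have hw : LinearMap.det (w.map (refl R C)).prod = (-1) ^ w.length := by
    rw [map_list_prod, List.map_map, List.map_congr_left (g := fun _ => (-1 : R))]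
    · simp
    · intro i _
      exact det_refl i (hC i)
  rw [coxEnd, map_mul, hw, det_funLeft, Perm.sign_symm]
  have := congrArg (Int.cast : ℤ → R) h.sign_mul
  push_cast at this
  exact this

end Generic

/-! ### Affine Cartan matrices -/

section Affine

variable {ι : Type*} [Fintype ι] [DecidableEq ι]

/-- The properties of an indecomposable symmetrizable generalized Cartan matrix `C` of affine type
on which the argument rests; `a` is its positive left null vector. Indecomposability is expressed
by a height function with respect to which every vertex but one has a lower neighbour. -/
structure IsAffineMatrix (C : Matrix ι ι ℤ) (a : ι → ℕ) : Prop where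
  diag : ∀ i, C i i = 2
  nonpos : ∀ i j, i ≠ j → C i j ≤ 0
  pos : ∀ i, 0 < a i
  null : ∀ j, ∑ i, (a i : ℤ) * C i j = 0
  connected : ∃ (r : ι) (h : ι → ℕ), ∀ i, i ≠ r → ∃ j, h j < h i ∧ C i j ≠ 0 ∧ C j i ≠ 0
  symmetrizable : ∃ d : ι → ℕ, (∀ i, 0 < d i) ∧ ∀ i j, C i j * d j = C j i * d i

variable {C : Matrix ι ι ℤ} {a : ι → ℕ}

/-- A function on the vertices that is constant along the edges is constant. -/
theorem IsAffineMatrix.eq_of_edge (h : IsAffineMatrix C a) {R : Type*} (f : ι → R)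
    (hf : ∀ i j, C i j ≠ 0 → C j i ≠ 0 → f i = f j) (i j : ι) : f i = f j := by
  obtain ⟨r, ht, hr⟩ := h.connected
  have key : ∀ (n : ℕ) (i : ι), ht i = n → f i = f r := by
    intro n
    induction n using Nat.strong_induction_on with
    | _ n ih =>
      intro i hi
      by_cases hir : i = r
      · rw [hir]
      · obtain ⟨j, hj, h1, h2⟩ := hr i hir
        rw [hf i j h1 h2]
        exact ih (ht j) (hi ▸ hj) j rfl
  rw [key _ i rfl, key _ j rfl]

/-- The left null space of an affine Cartan matrix is the line spanned by the null vector `a`: at a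
vertex where the ratio `x i / a i` is maximal the equation forces the neighbouring ratios to be
equal to it. -/
theorem IsAffineMatrix.exists_eq_smul (h : IsAffineMatrix C a) (x : ι → ℚ)
    (hx : ∀ j, ∑ i, (C i j : ℚ) * x i = 0) : ∃ t : ℚ, x = t • fun i => (a i : ℚ) := by
  have ha : ∀ i, (0 : ℚ) < a i := fun i => by exact_mod_cast h.pos i
  obtain ⟨r, ht, hr⟩ := h.connected
  obtain ⟨m, -, hm⟩ := Finset.exists_max_image Finset.univ (fun i => x i / a i)
    ⟨r, Finset.mem_univ r⟩
  set t := x m / a m with htdef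
  have hle : ∀ i, x i ≤ t * a i := fun i => (div_le_iff₀ (ha i)).1 (hm i (Finset.mem_univ i))
  have hnb : ∀ i j, C i j ≠ 0 → x j = t * a j → x i = t * a i := by
    intro i j hij hj
    have h0 : ∑ i, (C i j : ℚ) * (t * a i - x i) = 0 := by
      have h1 : ∑ i, (a i : ℚ) * (C i j : ℚ) = 0 := by exact_mod_cast h.null j
      calc ∑ i, (C i j : ℚ) * (t * a i - x i)
          = t * ∑ i, (a i : ℚ) * (C i j : ℚ) - ∑ i, (C i j : ℚ) * x i := by
            rw [Finset.mul_sum, ← Finset.sum_sub_distrib]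
            exact Finset.sum_congr rfl fun i _ => by ring
        _ = 0 := by rw [h1, hx]; ring
    have hterm : ∀ i ∈ Finset.univ, (C i j : ℚ) * (t * a i - x i) ≤ 0 := by
      intro i _
      by_cases hi : i = j
      · subst hi; rw [hj, sub_self, mul_zero]
      · exact mul_nonpos_of_nonpos_of_nonneg (by exact_mod_cast h.nonpos i j hi)
          (sub_nonneg.2 (hle i))
    have := (Finset.sum_eq_zero_iff_of_nonpos hterm).1 h0 i (Finset.mem_univ i)
    have hC : (C i j : ℚ) ≠ 0 := by exact_mod_cast hij
    have := (mul_eq_zero.1 this).resolve_left hC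
    linarith
  have hconst := h.eq_of_edge (fun i => x i = t * a i) fun i j h1 h2 =>
    propext ⟨hnb j i h2, hnb i j h1⟩
  refine ⟨t, funext fun i => ?_⟩
  have hmm : x m = t * a m := by rw [htdef, div_mul_cancel₀ _ (ha m).ne']
  have := (hconst m i).mp hmm
  simpa using this

/-- Every automorphism of an affine Cartan matrix preserves each symmetrizer: the ratio of a
symmetrizer and its image is constant along the edges, and averages to `1`. -/
theorem IsAffineMatrix.symmetrizer_apply (h : IsAffineMatrix C a) {τ : Perm ι}
    (hτ : ∀ i j, C (τ i) (τ j) = C i j) {d : ι → ℕ} (hd : ∀ i, 0 < d i)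
    (hs : ∀ i j, C i j * d j = C j i * d i) (i : ι) : d (τ i) = d i := by
  have hd' : ∀ i, (0 : ℚ) < d i := fun i => by exact_mod_cast hd i
  have hconst := h.eq_of_edge (fun i => (d (τ i) : ℚ) / d i) (by
    intro i j h1 h2
    have e1 : (C i j : ℚ) * d j = C j i * d i := by exact_mod_cast hs i j
    have e2 : (C i j : ℚ) * d (τ j) = C j i * d (τ i) := by
      have := hs (τ i) (τ j)
      rw [hτ, hτ] at this
      exact_mod_cast this
    have h1' : (C i j : ℚ) ≠ 0 := by exact_mod_cast h1
    have h2' : (C j i : ℚ) ≠ 0 := by exact_mod_cast h2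
    rw [div_eq_div_iff (hd' i).ne' (hd' j).ne']
    apply mul_left_cancel₀ (mul_ne_zero h1' h2')
    linear_combination (C j i : ℚ) * d (τ i) * e1 - (C j i : ℚ) * d i * e2)
  set q := (d (τ i) : ℚ) / d i with hq
  have hall : ∀ j, (d (τ j) : ℚ) = q * d j := by
    intro j
    rw [hq, hconst i j, div_mul_cancel₀ _ (hd' j).ne']
  have hsum : ∑ j, (d j : ℚ) = q * ∑ j, (d j : ℚ) := by
    rw [Finset.mul_sum, ← Equiv.sum_comp τ fun j => (d j : ℚ)]
    exact Finset.sum_congr rfl fun j _ => hall j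
  have hpos : (0 : ℚ) < ∑ j, (d j : ℚ) := Finset.sum_pos (fun j _ => hd' j) ⟨i, Finset.mem_univ i⟩
  have hq1 : q = 1 := by
    have : (q - 1) * ∑ j, (d j : ℚ) = 0 := by linear_combination -hsum
    rcases mul_eq_zero.1 this with h1 | h1
    · linarith
    · exact absurd h1 hpos.ne'
  have := hall i
  rw [hq1, one_mul] at this
  exact_mod_cast this

omit [DecidableEq ι] in
theorem sum_mul_comp_symm {R : Type*} [CommRing R] {τ : Perm ι}
    (hτ : ∀ i j, C (τ i) (τ j) = C i j) (x : ι → R) (i : ι) :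
    ∑ j, (C j (τ i) : R) * (x ∘ τ.symm) j = ∑ j, (C j i : R) * x j := by
  rw [← Equiv.sum_comp τ]
  exact Finset.sum_congr rfl fun j _ => by rw [hτ, Function.comp_apply, Equiv.symm_apply_apply]

/-- The canonical central element is fixed by twisted Coxeter elements. -/
theorem IsAffineMatrix.coxEnd_null {R : Type*} [CommRing R] (h : IsAffineMatrix C a) {τ : Perm ι}
    (hτ : ∀ i j, C (τ i) (τ j) = C i j) (w : List ι) :
    coxEnd R C w τ (fun i => (a i : R)) = fun i => (a i : R) := by
  have hQ : ∀ j, ∑ i, (C i j : ℚ) * (a i : ℚ) = 0 := fun j => by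
    have := h.null j
    simp only [mul_comm (C _ j : ℚ)]
    exact_mod_cast this
  -- `a ∘ τ⁻¹` is a null vector, hence proportional to `a`, and the sums of the entries agree
  obtain ⟨t, ht⟩ := h.exists_eq_smul ((fun i => (a i : ℚ)) ∘ τ.symm) (by
    intro j
    obtain ⟨i, rfl⟩ := τ.surjective j
    rw [sum_mul_comp_symm hτ]
    exact hQ i)
  obtain ⟨r, -⟩ := h.connected
  have ha : ∀ i, (0 : ℚ) < a i := fun i => by exact_mod_cast h.pos i
  have hpos : (0 : ℚ) < ∑ j, (a j : ℚ) := Finset.sum_pos (fun j _ => ha j) ⟨r, Finset.mem_univ r⟩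
  have hsum : ∑ j, (a j : ℚ) = t * ∑ j, (a j : ℚ) := by
    rw [Finset.mul_sum, ← Equiv.sum_comp τ.symm fun j => (a j : ℚ)]
    exact Finset.sum_congr rfl fun j _ => by simpa using congrFun ht j
  have ht1 : t = 1 := by
    have : (t - 1) * ∑ j, (a j : ℚ) = 0 := by linear_combination -hsum
    rcases mul_eq_zero.1 this with h1 | h1
    · linarith
    · exact absurd h1 hpos.ne'
  have hinv : (fun i => (a i : R)) ∘ τ.symm = fun i => (a i : R) := by
    ext i
    have := congrFun ht i
    rw [ht1, one_smul, Function.comp_apply] at this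
    have h2 : a (τ.symm i) = a i := by exact_mod_cast this
    simp [h2]
  rw [coxEnd_apply, hinv]
  induction w with
  | nil => rfl
  | cons i w ih =>
    rw [List.map_cons, List.prod_cons, Module.End.mul_apply, ih, refl_eq_self_iff]
    have := congrArg (Int.cast : ℤ → R) (h.null i)
    push_cast at this
    simpa only [mul_comm] using this

/-- The fixed vectors of a twisted Coxeter element are the multiples of the central element: such a
vector is fixed by `τ` and by the product of the reflections, so all simple roots vanish on it. -/
theorem IsAffineMatrix.exists_eq_smul_of_coxEnd_eq (h : IsAffineMatrix C a) {τ : Perm ι}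
    {w : List ι} (hτ : ∀ i j, C (τ i) (τ j) = C i j) (hw : IsTransversal τ w) (x : ι → ℚ)
    (hx : coxEnd ℚ C w τ x = x) : ∃ t : ℚ, x = t • fun i => (a i : ℚ) := by
  have h1 : ∀ i, x (τ i) = x i := hw.apply_eq x fun i hi => by
    conv_rhs => rw [← hx]
    rw [coxEnd_apply, prod_refl_apply_of_notMem hi, Function.comp_apply]
  have h2 : x ∘ τ.symm = x := by
    ext i
    rw [Function.comp_apply, ← h1, Equiv.apply_symm_apply]
  have hα : ∀ i, ∑ j, (C j (τ i) : ℚ) * x j = ∑ j, (C j i : ℚ) * x j := by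
    intro i
    conv_lhs => rw [← h2]
    exact sum_mul_comp_symm hτ x i
  rw [coxEnd_apply, h2] at hx
  have h3 := sum_eq_zero_of_prod_refl_eq hw.nodup h.diag x hx
  refine h.exists_eq_smul x fun i => ?_
  obtain ⟨j, hj, hij⟩ := hw.exists_mem i
  obtain ⟨k, rfl⟩ := hij.symm.exists_nat_pow_eq
  have : ∀ k : ℕ, ∑ l, (C l ((τ ^ k) j) : ℚ) * x l = 0 := by
    intro k
    induction k with
    | zero => exact h3 j hj
    | succ k ih => rw [pow_succ', Perm.mul_apply, hα, ih]
  exact this k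

omit [DecidableEq ι] in
/-- The symmetrized Cartan matrix, acting on coordinate vectors. -/
theorem symm_mulVec_apply (d : ι → ℕ) (hs : ∀ i j, C i j * d j = C j i * d i) (x : ι → ℚ) (i : ι) :
    (Matrix.of fun i j => (C i j : ℚ) * d j).mulVec x i = d i * ∑ j, (C j i : ℚ) * x j := by
  rw [Matrix.mulVec, dotProduct, Finset.mul_sum]
  refine Finset.sum_congr rfl fun j _ => ?_
  have : (C i j : ℚ) * d j = C j i * d i := by exact_mod_cast hs i j
  rw [Matrix.of_apply, this]
  ring

open Matrix in
/-- Twisted Coxeter elements are isometries of the symmetrized Cartan matrix; its invariance under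
`τ` rests on that of the symmetrizer. -/
theorem coxEnd_isometry (h : IsAffineMatrix C a) {τ : Perm ι}
    (hτ : ∀ i j, C (τ i) (τ j) = C i j) {d : ι → ℕ} (hd : ∀ i, 0 < d i)
    (hs : ∀ i j, C i j * d j = C j i * d i) (w : List ι) (x y : ι → ℚ) :
    coxEnd ℚ C w τ x ⬝ᵥ (Matrix.of fun i j => (C i j : ℚ) * d j) *ᵥ coxEnd ℚ C w τ y =
      x ⬝ᵥ (Matrix.of fun i j => (C i j : ℚ) * d j) *ᵥ y := by
  have hτ' : ∀ x y : ι → ℚ, (x ∘ τ.symm) ⬝ᵥ (Matrix.of fun i j => (C i j : ℚ) * d j) *ᵥ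
      (y ∘ τ.symm) = x ⬝ᵥ (Matrix.of fun i j => (C i j : ℚ) * d j) *ᵥ y := by
    intro x y
    rw [dotProduct, dotProduct, ← Equiv.sum_comp τ]
    refine Finset.sum_congr rfl fun i _ => ?_
    rw [symm_mulVec_apply d hs, symm_mulVec_apply d hs, sum_mul_comp_symm hτ,
      h.symmetrizer_apply hτ hd hs, Function.comp_apply, Equiv.symm_apply_apply]
  have hsymm : ∀ x y : ι → ℚ, x ⬝ᵥ (Matrix.of fun i j => (C i j : ℚ) * d j) *ᵥ y =
      y ⬝ᵥ (Matrix.of fun i j => (C i j : ℚ) * d j) *ᵥ x := by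
    intro x y
    rw [dotProduct_mulVec, ← mulVec_transpose, dotProduct_comm]
    congr 2
    ext i j
    have : (C i j : ℚ) * d j = C j i * d i := by exact_mod_cast hs i j
    simp [this]
  have hsx : ∀ (x : ι → ℚ) (i : ι), Pi.single i (1 : ℚ) ⬝ᵥ
      (Matrix.of fun i j => (C i j : ℚ) * d j) *ᵥ x = d i * ∑ j, (C j i : ℚ) * x j := by
    intro x i
    rw [single_dotProduct, one_mul, symm_mulVec_apply d hs]
  have hrefl : ∀ (i : ι) (x y : ι → ℚ), refl ℚ C i x ⬝ᵥ
      (Matrix.of fun i j => (C i j : ℚ) * d j) *ᵥ refl ℚ C i y =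
      x ⬝ᵥ (Matrix.of fun i j => (C i j : ℚ) * d j) *ᵥ y := by
    intro i x y
    have hii : ∑ j, (C j i : ℚ) * (Pi.single i 1 : ι → ℚ) j = 2 := by
      simp [Pi.single_apply, h.diag]
    rw [refl_apply, refl_apply, mulVec_sub, mulVec_smul, sub_dotProduct, dotProduct_sub,
      dotProduct_sub, smul_dotProduct, smul_dotProduct, dotProduct_smul, dotProduct_smul, hsymm x
      (Pi.single i 1), hsx, hsx, hsx, hii]
    simp only [smul_eq_mul]
    ring
  have hprod : ∀ x y : ι → ℚ, (w.map (refl ℚ C)).prod x ⬝ᵥ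
      (Matrix.of fun i j => (C i j : ℚ) * d j) *ᵥ (w.map (refl ℚ C)).prod y =
      x ⬝ᵥ (Matrix.of fun i j => (C i j : ℚ) * d j) *ᵥ y := by
    intro x y
    induction w with
    | nil => rfl
    | cons i w ih => rw [List.map_cons, List.prod_cons, Module.End.mul_apply, Module.End.mul_apply,
        hrefl, ih]
  rw [coxEnd_apply, coxEnd_apply, hprod, hτ']

open Matrix in
/-- The central element lies in the image of `cox^τ - 1`, over the rational numbers. -/
theorem IsAffineMatrix.exists_coxEnd_sub_eq (h : IsAffineMatrix C a) {τ : Perm ι} {w : List ι}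
    (hτ : ∀ i j, C (τ i) (τ j) = C i j) (hw : IsTransversal τ w) :
    ∃ x : ι → ℚ, coxEnd ℚ C w τ x = x + fun i => (a i : ℚ) := by
  obtain ⟨d, hd, hs⟩ := h.symmetrizable
  have hd' : ∀ i, (d i : ℚ) ≠ 0 := fun i => by exact_mod_cast (hd i).ne'
  set S : Matrix ι ι ℚ := Matrix.of fun i j => (C i j : ℚ) * d j with hS
  set M : Matrix ι ι ℚ := LinearMap.toMatrix' (coxEnd ℚ C w τ) with hM
  have hMx : ∀ x, M *ᵥ x = coxEnd ℚ C w τ x := fun x => LinearMap.toMatrix'_mulVec _ x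
  obtain ⟨b, hb⟩ := exists_sub_eq_of_isometry M S (fun i => (a i : ℚ)) (by
      ext i j
      have : (C i j : ℚ) * d j = C j i * d i := by exact_mod_cast hs i j
      simp [hS, this])
    (by
      ext i
      rw [symm_mulVec_apply d hs]
      have h1 : ∑ j, (a j : ℚ) * (C j i : ℚ) = 0 := by exact_mod_cast h.null i
      simp only [mul_comm (C _ i : ℚ), h1, mul_zero, Pi.zero_apply])
    (fun x hx => h.exists_eq_smul x fun i => by
      have := congrFun hx i
      rw [symm_mulVec_apply d hs] at this
      exact (mul_eq_zero.1 this).resolve_left (hd' i))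
    (by
      refine Matrix.ext_of_mulVec_single fun j => ?_
      refine dotProduct_eq _ _ fun x => ?_
      have := coxEnd_isometry h hτ hd hs w x (Pi.single j 1)
      rw [← hMx, ← hMx] at this
      rw [dotProduct_comm, dotProduct_comm _ x, ← this, ← mulVec_mulVec, ← mulVec_mulVec,
        dotProduct_mulVec, vecMul_transpose])
    (by rw [hMx, h.coxEnd_null hτ w])
    (fun x hx => h.exists_eq_smul_of_coxEnd_eq hτ hw x (by rw [← hMx, hx]))
    (by rw [hM, LinearMap.det_toMatrix', det_coxEnd hw h.diag])
  exact ⟨b, by rw [← hb, hMx]; abel⟩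

end Affine

/-! ### Integral solutions -/

section Solutions

variable {X : AffineType} {τ : Perm X.Node}

theorem twistedCoxeter_eq_coxEnd (X : AffineType) (τ : Perm X.Node) :
    twistedCoxeter X τ = coxEnd ℂ X.cartan (coxeterWord X τ) τ := rfl

theorem sum_smul_coroot (β : X.Node → ℕ) :
    ∑ i, β i • coroot X i = fun i => (β i : ℂ) := by
  ext i
  simp [coroot, Finset.sum_apply, Pi.single_apply]

theorem mem_corootCone_iff (X : AffineType) (b : Cartan' X) :
    b ∈ corootCone X ↔ ∃ β : X.Node → ℕ, b = fun i => (β i : ℂ) := by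
  rw [corootCone, AddSubmonoid.mem_closure_range_iff_of_fintype]
  exact exists_congr fun β => by rw [sum_smul_coroot, eq_comm]

theorem central_eq (X : AffineType) : central X = fun i => (X.dualLabel i : ℂ) :=
  sum_smul_coroot _

/-- The solutions are the natural solutions of an equation over the integers. -/
theorem isSolution_natCast_iff (k : ℕ) (β : X.Node → ℕ) :
    IsSolution X τ k (fun i => (β i : ℂ)) ↔
      coxEnd ℤ X.cartan (coxeterWord X τ) τ (fun i => (β i : ℤ)) =
        fun i => (β i : ℤ) + k * X.dualLabel i := by
  have hmap := coxEnd_map (C := X.cartan) (Int.castRingHom ℂ) (coxeterWord X τ) τ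
    (fun i => (β i : ℤ))
  have hcomp : (Int.castRingHom ℂ : ℤ → ℂ) ∘ (fun i => (β i : ℤ)) = fun i => (β i : ℂ) := by
    ext i; simp
  rw [hcomp] at hmap
  rw [IsSolution, twistedCoxeter_eq_coxEnd, LinearMap.sub_apply, hmap, central_eq,
    and_iff_right ((mem_corootCone_iff X _).2 ⟨β, rfl⟩), Module.End.one_apply]
  constructor
  · intro h
    ext i
    have := congrFun h i
    simp only [Pi.sub_apply, Function.comp_apply, Pi.smul_apply, nsmul_eq_mul, eq_intCast] at this
    rw [sub_eq_iff_eq_add'] at this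
    exact_mod_cast this
  · intro h
    ext i
    rw [h]
    simp

/-- The subtraction of `c` leaves the cone exactly if some coordinate is smaller than that of `c`. -/
theorem natCast_sub_central_mem_iff (β : X.Node → ℕ) :
    (fun i => (β i : ℂ)) - central X ∈ corootCone X ↔ ∀ i, X.dualLabel i ≤ β i := by
  rw [mem_corootCone_iff, central_eq]
  constructor
  · rintro ⟨δ, hδ⟩ i
    have := congrFun hδ i
    simp only [Pi.sub_apply] at this
    rw [sub_eq_iff_eq_add] at this
    have h2 : β i = δ i + X.dualLabel i := by exact_mod_cast this
    omega
  · intro h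
    refine ⟨fun i => β i - X.dualLabel i, ?_⟩
    ext i
    simp [Nat.cast_sub (h i)]

variable (hX : IsAffineMatrix X.cartan X.dualLabel) (hτ : IsDiagramAut X τ)
  (hw : IsTransversal τ (coxeterWord X τ))

include hX hτ hw in
/-- Integral fixed vectors of a twisted Coxeter element are integral multiples of `c`, because one
of the dual Kac labels is `1`. -/
theorem exists_eq_mul_of_coxEnd_int_eq (x : X.Node → ℤ)
    (hx : coxEnd ℤ X.cartan (coxeterWord X τ) τ x = x) :
    ∃ t : ℤ, ∀ i, x i = t * X.dualLabel i := by
  obtain ⟨t, ht⟩ := hX.exists_eq_smul_of_coxEnd_eq hτ hw ((Int.castRingHom ℚ) ∘ x)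
    (by rw [coxEnd_map, hx])
  have h0 := congrFun ht 0
  simp only [Function.comp_apply, eq_intCast, Pi.smul_apply, AffineType.dualLabel_zero,
    Nat.cast_one, smul_eq_mul, mul_one] at h0
  refine ⟨x 0, fun i => ?_⟩
  have hi := congrFun ht i
  simp only [Function.comp_apply, eq_intCast, Pi.smul_apply, smul_eq_mul] at hi
  rw [← h0] at hi
  exact_mod_cast hi

include hX hτ hw in
/-- A solution exists: clear the denominators of a rational solution and add a large multiple of
`c`. -/
theorem exists_isSolution : ∃ (k : ℕ) (β : X.Node → ℕ), 0 < k ∧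
    IsSolution X τ k (fun i => (β i : ℂ)) := by
  obtain ⟨x, hx⟩ := hX.exists_coxEnd_sub_eq hτ hw
  obtain ⟨N, hN, y, hy⟩ : ∃ N : ℕ, 0 < N ∧ ∃ y : X.Node → ℤ, ∀ i, (y i : ℚ) = N * x i := by
    refine ⟨∏ i, (x i).den, Finset.prod_pos fun i _ => (x i).den_pos,
      fun i => (∏ j ∈ Finset.univ.erase i, (x j).den : ℕ) * (x i).num, fun i => ?_⟩
    rw [← Finset.mul_prod_erase Finset.univ _ (Finset.mem_univ i)]
    push_cast
    have := Rat.mul_den_eq_num (x i)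
    rw [← this]
    ring
  have hy' : (Int.castRingHom ℚ) ∘ y = (N : ℚ) • x := by
    ext i; simpa using hy i
  have hyeq : coxEnd ℤ X.cartan (coxeterWord X τ) τ y = fun i => y i + N * X.dualLabel i := by
    have h1 := coxEnd_map (C := X.cartan) (Int.castRingHom ℚ) (coxeterWord X τ) τ y
    rw [hy', map_smul, hx, smul_add, ← hy'] at h1
    ext i
    have := congrFun h1 i
    simp only [Pi.add_apply, Function.comp_apply, eq_intCast, Pi.smul_apply, smul_eq_mul] at this
    exact_mod_cast this.symm
  set T : ℤ := ∑ i, |y i| with hT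
  have hnonneg : ∀ i, 0 ≤ y i + T * X.dualLabel i := by
    intro i
    have h1 : |y i| ≤ T := Finset.single_le_sum (f := fun i => |y i|) (fun j _ => abs_nonneg _)
      (Finset.mem_univ i)
    have h2 : (1 : ℤ) ≤ X.dualLabel i := by exact_mod_cast X.dualLabel_pos i
    have h3 := neg_abs_le (y i)
    have h4 : T ≤ T * X.dualLabel i := le_mul_of_one_le_right (le_trans (abs_nonneg _) h1) h2
    linarith
  refine ⟨N, fun i => (y i + T * X.dualLabel i).toNat, hN, (isSolution_natCast_iff _ _).2 ?_⟩
  have hcast : (fun i => (((y i + T * X.dualLabel i).toNat : ℕ) : ℤ)) =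
      y + T • fun i => (X.dualLabel i : ℤ) := by
    ext i
    simp [Int.toNat_of_nonneg (hnonneg i)]
  rw [hcast, map_add, map_smul, hyeq, hX.coxEnd_null hτ]
  ext i
  rw [Int.toNat_of_nonneg (hnonneg i)]
  simp only [Pi.add_apply, Pi.smul_apply, smul_eq_mul]
  ring

include hX hτ hw in
theorem IsMinimalSolution.unique {k k' : ℕ} {b b' : Cartan' X} (h : IsMinimalSolution X τ k b)
    (h' : IsMinimalSolution X τ k' b') : k = k' ∧ b = b' := by
  have hk : k = k' := le_antisymm (h.2.2.2 k' b' h'.1 h'.2.1) (h'.2.2.2 k b h.1 h.2.1)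
  subst hk
  refine ⟨rfl, ?_⟩
  obtain ⟨-, hs, hc, -⟩ := h
  obtain ⟨-, hs', hc', -⟩ := h'
  obtain ⟨β, rfl⟩ := (mem_corootCone_iff X b).1 hs.1
  obtain ⟨β', rfl⟩ := (mem_corootCone_iff X b').1 hs'.1
  rw [isSolution_natCast_iff] at hs hs'
  rw [natCast_sub_central_mem_iff] at hc hc'
  push Not at hc hc'
  obtain ⟨t, ht⟩ := exists_eq_mul_of_coxEnd_int_eq hX hτ hw
    ((fun i => (β i : ℤ)) - fun i => (β' i : ℤ)) (by
      rw [map_sub, hs, hs']; ext i; simp)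
  have ht' : ∀ i, (β i : ℤ) - β' i = t * X.dualLabel i := ht
  -- a nonzero multiple of `c` would make one of the two differences lie in the cone
  have h0 : t = 0 := by
    rcases lt_trichotomy t 0 with h | h | h
    · obtain ⟨i, hi⟩ := hc'
      have := ht' i
      have h2 : (0 : ℤ) ≤ (-1 - t) * X.dualLabel i := mul_nonneg (by omega) (by omega)
      have h3 : (-1 - t) * (X.dualLabel i : ℤ) = - X.dualLabel i - t * X.dualLabel i := by ring
      omega
    · exact h
    · obtain ⟨i, hi⟩ := hc
      have := ht' i
      have h2 : (0 : ℤ) ≤ (t - 1) * X.dualLabel i := mul_nonneg (by omega) (by omega)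
      have h3 : (t - 1) * (X.dualLabel i : ℤ) = t * X.dualLabel i - X.dualLabel i := by ring
      omega
  ext i
  have := ht' i
  rw [h0, zero_mul, sub_eq_zero] at this
  exact_mod_cast congrArg (Int.cast : ℤ → ℂ) this

include hX hτ hw in
theorem exists_isMinimalSolution : ∃ (k : ℕ) (b : Cartan' X), IsMinimalSolution X τ k b := by
  classical
  have hex : ∃ k : ℕ, 0 < k ∧ ∃ β : X.Node → ℕ, IsSolution X τ k (fun i => (β i : ℂ)) := by
    obtain ⟨k, β, hk, hβ⟩ := exists_isSolution hX hτ hw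
    exact ⟨k, hk, β, hβ⟩
  obtain ⟨hk, hβ⟩ := Nat.find_spec hex
  -- among the solutions for the least `k`, take one with the least sum of coordinates
  have hex2 : ∃ s : ℕ, ∃ β : X.Node → ℕ,
      IsSolution X τ (Nat.find hex) (fun i => (β i : ℂ)) ∧ ∑ i, β i = s := by
    obtain ⟨β, hβ⟩ := hβ
    exact ⟨_, β, hβ, rfl⟩
  obtain ⟨β, hβs, hsum⟩ := Nat.find_spec hex2
  refine ⟨Nat.find hex, fun i => (β i : ℂ), hk, hβs, ?_, ?_⟩
  · rw [natCast_sub_central_mem_iff]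
    intro hle
    refine Nat.find_min hex2 (m := ∑ i, (β i - X.dualLabel i)) ?_ ⟨_, ?_, rfl⟩
    · rw [← hsum]
      refine Finset.sum_lt_sum (fun i _ => Nat.sub_le _ _) ⟨0, Finset.mem_univ 0, ?_⟩
      have h1 := hle 0
      have h2 := X.dualLabel_pos 0
      omega
    · rw [isSolution_natCast_iff] at hβs ⊢
      have hcast : (fun i => ((β i - X.dualLabel i : ℕ) : ℤ)) =
          (fun i => (β i : ℤ)) - fun i => (X.dualLabel i : ℤ) := by
        ext i
        simp [Nat.cast_sub (hle i)]
      rw [hcast, map_sub, hβs, hX.coxEnd_null hτ]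
      ext i
      rw [Nat.cast_sub (hle i)]
      simp only [Pi.sub_apply]
      ring
  · intro k' b' hk' hs
    obtain ⟨β', rfl⟩ := (mem_corootCone_iff X b').1 hs.1
    exact Nat.find_min' hex ⟨hk', β', hs⟩

include hX hτ hw in
/-- A criterion for minimality. If `(k, β)` and `(k', β')` are solutions, then `k β' - k' β` is a
multiple of `c`, so that `k` divides `k' (β i - β j)` for all vertices `i`, `j` with dual Kac
label `1`. -/
theorem isMinimalSolution_of_isCoprime {k : ℕ} (hk : 0 < k) {β : X.Node → ℕ}
    (hs : coxEnd ℤ X.cartan (coxeterWord X τ) τ (fun i => (β i : ℤ)) =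
        fun i => (β i : ℤ) + k * X.dualLabel i)
    {i j l : X.Node} (hi : X.dualLabel i = 1) (hj : X.dualLabel j = 1)
    (hij : IsCoprime (k : ℤ) ((β i : ℤ) - β j)) (hl : β l < X.dualLabel l) :
    IsMinimalSolution X τ k (∑ i, β i • coroot X i) := by
  rw [sum_smul_coroot]
  refine ⟨hk, (isSolution_natCast_iff _ _).2 hs, ?_, ?_⟩
  · rw [natCast_sub_central_mem_iff]
    intro h
    exact absurd (h l) (not_le.2 hl)
  · intro k' b' hk' hs'
    obtain ⟨β', rfl⟩ := (mem_corootCone_iff X b').1 hs'.1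
    rw [isSolution_natCast_iff] at hs'
    obtain ⟨t, ht⟩ := exists_eq_mul_of_coxEnd_int_eq hX hτ hw
      ((k : ℤ) • (fun i => (β' i : ℤ)) - (k' : ℤ) • fun i => (β i : ℤ)) (by
        rw [map_sub, map_smul, map_smul, hs, hs']
        ext i
        simp only [Pi.sub_apply, Pi.smul_apply, smul_eq_mul]
        ring)
    have h1 := ht i
    have h2 := ht j
    rw [hi] at h1
    rw [hj] at h2
    simp only [Pi.sub_apply, Pi.smul_apply, smul_eq_mul, Nat.cast_one, mul_one] at h1 h2
    have hdvd : (k : ℤ) ∣ k' * ((β i : ℤ) - β j) :=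
      ⟨β' i - β' j, by linear_combination h2 - h1⟩
    exact Nat.le_of_dvd hk' (by exact_mod_cast hij.dvd_of_dvd_mul_right hdvd)

end Solutions

/-! ### The Cartan matrices of the affine diagrams -/

/-- The entries of the Cartan matrix as a plain function of two vertices. The type `Matrix` is
opaque to instance resolution, which finds the decidability of statements about the entries only in
this form. -/
def AffineType.entry (X : AffineType) (i j : X.Node) : ℤ := X.cartan i j

theorem AffineType.cartan_diag (X : AffineType) (i : X.Node) : X.cartan i i = 2 := by
  cases X
  case E6 | E7 | E8 | F4 | G2 | E62 | D43 => revert i; decide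
  all_goals simp [cartan, cartanA, cartanB, cartanC, cartanD, cartanAeven]

theorem AffineType.cartan_nonpos (X : AffineType) (i j : X.Node) (h : i ≠ j) :
    X.cartan i j ≤ 0 := by
  cases X
  case E6 => exact (by decide : ∀ i j, i ≠ j → entry .E6 i j ≤ 0) i j h
  case E7 => exact (by decide : ∀ i j, i ≠ j → entry .E7 i j ≤ 0) i j h
  case E8 => exact (by decide : ∀ i j, i ≠ j → entry .E8 i j ≤ 0) i j h
  case F4 => exact (by decide : ∀ i j, i ≠ j → entry .F4 i j ≤ 0) i j h
  case G2 => exact (by decide : ∀ i j, i ≠ j → entry .G2 i j ≤ 0) i j h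
  case E62 => exact (by decide : ∀ i j, i ≠ j → entry .E62 i j ≤ 0) i j h
  case D43 => exact (by decide : ∀ i j, i ≠ j → entry .D43 i j ≤ 0) i j h
  all_goals
    have h1 : i.val ≠ j.val := fun h' => h (Fin.ext h')
    simp only [cartan, cartanA, cartanB, cartanC, cartanD, cartanAeven]
    grind

/-- A height function on a diagram whose vertices other than `0` are joined to their predecessors. -/
theorem exists_height_of_chain {n : ℕ} (C : ℕ → ℕ → ℤ)
    (h : ∀ i, 1 ≤ i → i ≤ n → C i (i - 1) ≠ 0 ∧ C (i - 1) i ≠ 0) :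
    ∃ (r : Fin (n + 1)) (ht : Fin (n + 1) → ℕ), ∀ i, i ≠ r →
      ∃ j, ht j < ht i ∧ C i.val j.val ≠ 0 ∧ C j.val i.val ≠ 0 := by
  refine ⟨0, fun i => i.val, fun i hi => ?_⟩
  have h0 : i.val ≠ 0 := fun h' => hi (Fin.ext h')
  exact ⟨⟨i.val - 1, by omega⟩, by simp only []; omega, h i.val (by omega) (by omega)⟩

/-- A height function, the distance to the vertex `2`, on a diagram whose vertices `0` and `1` are
joined to `2` and whose vertices from `3` on are joined to smaller vertices from `2` on. -/
theorem exists_height_of_fork {n : ℕ} (hn : 2 ≤ n) (C : ℕ → ℕ → ℤ)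
    (h0 : ∀ i, i ≤ 1 → C i 2 ≠ 0 ∧ C 2 i ≠ 0)
    (h : ∀ i, 3 ≤ i → i ≤ n → ∃ j, 2 ≤ j ∧ j < i ∧ C i j ≠ 0 ∧ C j i ≠ 0) :
    ∃ (r : Fin (n + 1)) (ht : Fin (n + 1) → ℕ), ∀ i, i ≠ r →
      ∃ j, ht j < ht i ∧ C i.val j.val ≠ 0 ∧ C j.val i.val ≠ 0 := by
  refine ⟨⟨2, by omega⟩, fun i => if i.val ≤ 1 then 1 else i.val - 2, fun i hi => ?_⟩
  have h2 : i.val ≠ 2 := fun h' => hi (Fin.ext h')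
  by_cases h1 : i.val ≤ 1
  · exact ⟨⟨2, by omega⟩, by simp [h1], h0 i.val h1⟩
  · obtain ⟨j, hj2, hji, hC⟩ := h i.val (by omega) (by omega)
    exact ⟨⟨j, by omega⟩, by simp only [h1, if_false]; split_ifs <;> omega, hC⟩

theorem exists_height_of_entry {X : AffineType} (r : X.Node) (ht : ℕ → ℕ)
    (h : ∀ i, i = r ∨ ∃ j : X.Node, ht j.val < ht i.val ∧ X.entry i j ≠ 0 ∧ X.entry j i ≠ 0) :
    ∃ (r : X.Node) (ht : X.Node → ℕ), ∀ i, i ≠ r →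
      ∃ j, ht j < ht i ∧ X.entry i j ≠ 0 ∧ X.entry j i ≠ 0 :=
  ⟨r, fun i => ht i.val, fun i hi => (h i).resolve_left hi⟩

theorem AffineType.cartan_connected (X : AffineType) :
    ∃ (r : X.Node) (ht : X.Node → ℕ), ∀ i, i ≠ r →
      ∃ j, ht j < ht i ∧ X.cartan i j ≠ 0 ∧ X.cartan j i ≠ 0 := by
  change ∃ (r : X.Node) (ht : X.Node → ℕ), ∀ i, i ≠ r →
      ∃ j, ht j < ht i ∧ X.entry i j ≠ 0 ∧ X.entry j i ≠ 0
  cases X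
  case A1 n hn => exact exists_height_of_chain (cartanA n) (by grind [cartanA])
  case B1 n hn =>
    exact exists_height_of_fork (n := n) (by omega) (cartanB n) (by grind [cartanB])
      fun i h1 h2 => ⟨i - 1, by grind [cartanB]⟩
  case A2odd n hn =>
    exact exists_height_of_fork (n := n) (by omega) (fun i j => cartanB n j i) (by grind [cartanB])
      fun i h1 h2 => ⟨i - 1, by grind [cartanB]⟩
  case C1 n hn => exact exists_height_of_chain (cartanC n) (by grind [cartanC])
  case D2 n hn => exact exists_height_of_chain (fun i j => cartanC n j i) (by grind [cartanC])
  case D1 n hn =>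
    exact exists_height_of_fork (n := n) (by omega) (cartanD n) (by grind [cartanD])
      fun i h1 h2 => by
        by_cases h : i = n
        · exact ⟨n - 2, by grind [cartanD]⟩
        · exact ⟨i - 1, by grind [cartanD]⟩
  case A2even n hn => exact exists_height_of_chain (cartanAeven n) (by grind [cartanAeven])
  case E6 => exact exists_height_of_entry (3 : Node .E6) (fun i => [2, 2, 1, 0, 1, 2, 1].getD i 0) (by decide)
  case E7 => exact exists_height_of_entry (0 : Node .E7) (fun i => i) (by decide)
  case E8 => exact exists_height_of_entry (0 : Node .E8) (fun i => i) (by decide)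
  case F4 => exact exists_height_of_entry (0 : Node .F4) (fun i => i) (by decide)
  case G2 => exact exists_height_of_entry (0 : Node .G2) (fun i => i) (by decide)
  case E62 => exact exists_height_of_entry (0 : Node .E62) (fun i => i) (by decide)
  case D43 => exact exists_height_of_entry (0 : Node .D43) (fun i => i) (by decide)

theorem exists_symmetrizer {n : ℕ} (C : ℕ → ℕ → ℤ) (d : ℕ → ℕ) (hd : ∀ i, 0 < d i)
    (h : ∀ i j, i ≤ n → j ≤ n → C i j * d j = C j i * d i) :
    ∃ d : Fin (n + 1) → ℕ, (∀ i, 0 < d i) ∧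
      ∀ i j, C i.val j.val * d j = C j.val i.val * d i :=
  ⟨fun i => d i.val, fun i => hd i.val, fun i j => h i.val j.val (by omega) (by omega)⟩

theorem AffineType.cartan_symmetrizable (X : AffineType) :
    ∃ d : X.Node → ℕ, (∀ i, 0 < d i) ∧ ∀ i j, X.cartan i j * d j = X.cartan j i * d i := by
  change ∃ d : X.Node → ℕ, (∀ i, 0 < d i) ∧ ∀ i j, X.entry i j * d j = X.entry j i * d i
  cases X
  case A1 n hn =>
    exact exists_symmetrizer (cartanA n) (fun _ => 1) (fun _ => one_pos) fun i j hi hj => by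
      grind [cartanA]
  case D1 n hn =>
    exact exists_symmetrizer (cartanD n) (fun _ => 1) (fun _ => one_pos) fun i j hi hj => by
      unfold cartanD; grind
  case B1 n hn =>
    exact exists_symmetrizer (n := n) (cartanB n) (fun i => if i = n then 2 else 1)
      (fun i => by grind) fun i j hi hj => by
      unfold cartanB; push_cast; grind (splits := 20)
  case A2odd n hn =>
    exact exists_symmetrizer (n := n) (fun i j => cartanB n j i) (fun i => if i = n then 1 else 2)
      (fun i => by grind) fun i j hi hj => by
      unfold cartanB; push_cast; grind (splits := 20)
  case C1 n hn =>
    exact exists_symmetrizer (n := n) (cartanC n) (fun i => if i = 0 ∨ i = n then 1 else 2)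
      (fun i => by grind) fun i j hi hj => by
      unfold cartanC; push_cast; grind (splits := 20)
  case D2 n hn =>
    exact exists_symmetrizer (n := n) (fun i j => cartanC n j i)
      (fun i => if i = 0 ∨ i = n then 2 else 1)
      (fun i => by grind) fun i j hi hj => by
      unfold cartanC; push_cast; grind (splits := 20)
  case A2even n hn =>
    exact exists_symmetrizer (n := n) (cartanAeven n)
      (fun i => if i = 0 then 4 else if i = n then 1 else 2)
      (fun i => by grind) fun i j hi hj => by
      unfold cartanAeven; push_cast; grind (splits := 20)
  case E6 => exact ⟨fun _ => 1, by decide, by decide⟩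
  case E7 => exact ⟨fun _ => 1, by decide, by decide⟩
  case E8 => exact ⟨fun _ => 1, by decide, by decide⟩
  case F4 => exact ⟨![1, 1, 1, 2, 2], by decide, by decide⟩
  case G2 => exact ⟨![1, 1, 3], by decide, by decide⟩
  case E62 => exact ⟨![2, 2, 2, 1, 1], by decide, by decide⟩
  case D43 => exact ⟨![3, 3, 1], by decide, by decide⟩

theorem AffineType.isAffineMatrix (X : AffineType) : IsAffineMatrix X.cartan X.dualLabel where
  diag := X.cartan_diag
  nonpos := X.cartan_nonpos
  pos := X.dualLabel_pos
  null := X.dualLabel_cartan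
  connected := X.cartan_connected
  symmetrizable := X.cartan_symmetrizable

/-! ### The words are transversals -/

theorem isTransversal_filter {m : ℕ} {τ : Perm (Fin m)} (P : Fin m → Prop) [DecidablePred P]
    (hex : ∀ i, ∃ j, P j ∧ τ.SameCycle i j)
    (huniq : ∀ i j, P i → P j → τ.SameCycle i j → i = j) :
    IsTransversal τ ((List.finRange m).filter fun i => P i) where
  nodup := (List.nodup_finRange m).filter _
  exists_mem i := by simpa using hex i
  unique i hi j hj := huniq i j (by simpa using hi) (by simpa using hj)

theorem isTransversal_leastReps {n : ℕ} (τ : Perm (Fin (n + 1))) :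
    IsTransversal τ (leastReps τ) := by
  refine isTransversal_filter _ (fun i => ?_) fun i j hi hj hij =>
    le_antisymm (hi j hij) (hj i hij.symm)
  obtain ⟨j, hj, hmin⟩ := wellFounded_lt.has_min {j | τ.SameCycle i j} ⟨i, Perm.SameCycle.refl _ _⟩
  exact ⟨j, fun k hk => not_lt.1 (hmin k (hj.trans hk)), hj⟩

/-- The smallest nonzero elements form a transversal if the orbit of `0` contains `1`. -/
theorem isTransversal_leastNonzeroReps {n : ℕ} (hn : 1 ≤ n) (τ : Perm (Fin (n + 1)))
    (h01 : τ.SameCycle 0 1) : IsTransversal τ (leastNonzeroReps τ) := by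
  refine isTransversal_filter _ (fun i => ?_) fun i j hi hj hij =>
    le_antisymm (hi.2 j hj.1 hij) (hj.2 i hi.1 hij.symm)
  have hne : ({j | j ≠ 0 ∧ τ.SameCycle i j} : Set (Fin (n + 1))).Nonempty := by
    by_cases hi : i = 0
    · refine ⟨1, ?_, hi ▸ h01⟩
      intro h
      have := congrArg Fin.val h
      rw [Fin.val_one', Fin.val_zero, Nat.mod_eq_of_lt (by omega)] at this
      omega
    · exact ⟨i, hi, Perm.SameCycle.refl _ _⟩
  obtain ⟨j, hj, hmin⟩ := wellFounded_lt.has_min _ hne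
  exact ⟨j, ⟨hj.1, fun k hk0 hk => not_lt.1 (hmin k ⟨hk0, hj.2.trans hk⟩)⟩, hj.2⟩

/-- The automorphisms of the diagram `B_n^{(1)}` fix the vertices of the chain `2, ..., n`: the
double bond determines `n - 1` and `n`, and the others follow in descending order. -/
theorem cartanB_aut_apply {n : ℕ} (hn : 3 ≤ n) {τ : Perm (Fin (n + 1))}
    (hτ : ∀ i j, cartanB n (τ i).val (τ j).val = cartanB n i.val j.val) (i : Fin (n + 1))
    (hi : 2 ≤ i.val) : τ i = i := by
  have hend : (τ ⟨n, by omega⟩).val = n ∧ (τ ⟨n - 1, by omega⟩).val = n - 1 := by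
    have h1 := hτ ⟨n, by omega⟩ ⟨n - 1, by omega⟩
    have h2 : cartanB n n (n - 1) = -2 := by grind [cartanB]
    simp only [h2] at h1
    grind [cartanB]
  have key : ∀ (k : ℕ) (i : Fin (n + 1)), i.val + k = n → 2 ≤ i.val → τ i = i := by
    intro k
    induction k using Nat.strong_induction_on with
    | _ k ih =>
      intro i hik hi
      rcases Nat.lt_or_ge k 2 with hk | hk
      · interval_cases k
        · have : i = ⟨n, by omega⟩ := Fin.ext (by simpa using hik)
          rw [this]; exact Fin.ext hend.1
        · have : i = ⟨n - 1, by omega⟩ := Fin.ext (by simp only []; omega)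
          rw [this]; exact Fin.ext hend.2
      · have h1 := ih (k - 1) (by omega) ⟨i.val + 1, by omega⟩ (by simp only []; omega)
          (by simp only []; omega)
        have h2 := ih (k - 2) (by omega) ⟨i.val + 2, by omega⟩ (by simp only []; omega)
          (by simp only []; omega)
        have h3 := hτ i ⟨i.val + 1, by omega⟩
        rw [h1] at h3
        have h4 : cartanB n i.val (i.val + 1) = -1 := by grind [cartanB]
        simp only [h4] at h3
        have h5 : (τ i).val ≠ i.val + 2 := by
          intro h
          have h6 : τ i = τ ⟨i.val + 2, by omega⟩ := by rw [h2]; exact Fin.ext h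
          have := congrArg Fin.val (τ.injective h6)
          simp only [] at this
          omega
        apply Fin.ext
        have := (τ i).isLt
        clear h1 h2 ih hend hτ
        generalize (τ i).val = t at *
        generalize i.val = s at *
        grind [cartanB]
  exact key (n - i.val) i (by omega) hi

theorem isTransversal_of_cartanB {n : ℕ} (hn : 3 ≤ n) {τ : Perm (Fin (n + 1))}
    (hτ : ∀ i j, cartanB n (τ i).val (τ j).val = cartanB n i.val j.val) (hne : τ ≠ 1) :
    IsTransversal τ ((List.finRange (n + 1)).filter fun i => i ≠ 0) := by
  have hfix := cartanB_aut_apply hn hτ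
  have hv1 : (1 : Fin (n + 1)).val = 1 := by
    rw [Fin.val_one', Nat.mod_eq_of_lt (by omega)]
  have hcases : ∀ i : Fin (n + 1), i = 0 ∨ i = 1 ∨ 2 ≤ i.val := by
    intro i
    rcases Nat.lt_or_ge i.val 2 with h | h
    · rcases Nat.eq_zero_or_pos i.val with h0 | h0
      · exact Or.inl (Fin.ext h0)
      · exact Or.inr (Or.inl (Fin.ext (by omega)))
    · exact Or.inr (Or.inr h)
  have hsmall : ∀ i : Fin (n + 1), i.val < 2 → (τ i).val < 2 := by
    intro i hi
    by_contra h
    have := τ.injective (hfix (τ i) (by omega))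
    rw [this] at h
    omega
  have h0 : τ 0 = 1 := by
    rcases hcases (τ 0) with h | h | h
    · refine absurd (Equiv.ext fun i => ?_) hne
      rcases hcases i with rfl | rfl | hi
      · exact h
      · rcases hcases (τ 1) with h' | h' | h'
        · have := congrArg Fin.val (τ.injective (h'.trans h.symm))
          rw [hv1] at this
          simp at this
        · exact h'
        · have := hsmall 1 (by omega)
          omega
      · exact hfix i hi
    · exact h
    · have := hsmall 0 (by simp)
      omega
  refine isTransversal_filter _ (fun i => ?_) fun i j hi hj hij => ?_
  · by_cases hi : i = 0
    · refine ⟨1, ?_, 1, ?_⟩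
      · intro h
        have := congrArg Fin.val h
        rw [hv1] at this
        simp at this
      · rw [hi, zpow_one, h0]
    · exact ⟨i, hi, Perm.SameCycle.refl _ _⟩
  · rcases hcases i with h | rfl | h
    · exact absurd h hi
    · rcases hcases j with h' | rfl | h'
      · exact absurd h' hj
      · rfl
      · exact hij.eq_of_right (hfix j h')
    · exact hij.eq_of_left (hfix i h)

/-- A function that is invariant under `τ` is constant on the orbits. -/
theorem eq_of_sameCycle {ι R : Type*} [Finite ι] {τ : Perm ι} (f : ι → R) (hf : ∀ i, f (τ i) = f i)
    {i j : ι} (hij : τ.SameCycle i j) : f i = f j := by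
  obtain ⟨k, rfl⟩ := hij.exists_nat_pow_eq
  induction k with
  | zero => rfl
  | succ k ih =>
    rw [pow_succ', Perm.mul_apply, hf]
    exact ih ⟨k, by rw [zpow_natCast]⟩

/-- The automorphisms of order `3` of the diagram `E_6^{(1)}` permute the three leaves, their
neighbours and the central vertex transitively. -/
theorem isTransversal_E6 {τ : Perm (Fin 7)} (hτ : IsDiagramAut .E6 τ) (hne : τ ≠ 1)
    (h3 : τ ^ 3 = 1) : IsTransversal τ [1, 2, 3] := by
  -- the number of neighbours of a vertex, increased by one, is invariant
  let C : Fin 7 → Fin 7 → ℤ := AffineType.E6.entry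
  have hC : ∀ i j, C (τ i) (τ j) = C i j := hτ
  let f : Fin 7 → ℕ := fun i => (Finset.univ.filter fun j => C i j ≠ 0).card
  have hf : ∀ i, f (τ i) = f i := by
    intro i
    refine (Finset.card_bij (fun j _ => τ j) ?_ ?_ ?_).symm
    · intro j hj
      simpa [hC] using hj
    · intro j _ k _ h
      exact τ.injective h
    · intro j hj
      refine ⟨τ.symm j, ?_, τ.apply_symm_apply j⟩
      have h2 := hC i (τ.symm j)
      rw [Equiv.apply_symm_apply] at h2
      simpa [← h2] using hj
  have hleaf : ∀ a : Fin 7, f a = f 0 → a = 0 ∨ a = 1 ∨ a = 5 := by decide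
  have hmid : ∀ a b : Fin 7, (b = 0 ∨ b = 1 ∨ b = 5) → C b a = -1 →
      (b = 0 ∧ a = 6) ∨ (b = 1 ∧ a = 2) ∨ (b = 5 ∧ a = 4) := by decide
  have hcen : ∀ a : Fin 7, f a = f 3 → a = 3 := by decide
  have ht3 : τ 3 = 3 := hcen _ (hf 3)
  have ht0 := hleaf _ (hf 0)
  have ht1 := hleaf _ ((hf 1).trans (by decide))
  have ht5 := hleaf _ ((hf 5).trans (by decide))
  have ht6 := hmid _ _ ht0 (hC 0 6)
  have ht2 := hmid _ _ ht1 (hC 1 2)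
  have ht4 := hmid _ _ ht5 (hC 5 4)
  have hcube : ∀ i, τ (τ (τ i)) = i := fun i => by
    have := Perm.congr_fun h3 i
    simpa [pow_succ] using this
  have hinj01 : τ 0 ≠ τ 1 := fun h => absurd (τ.injective h) (by decide)
  have hinj05 : τ 0 ≠ τ 5 := fun h => absurd (τ.injective h) (by decide)
  have hinj15 : τ 1 ≠ τ 5 := fun h => absurd (τ.injective h) (by decide)
  have hc0 := hcube 0
  have hc1 := hcube 1
  have hc5 := hcube 5
  have hstep : ∀ i, τ.SameCycle i (τ i) := fun i => ⟨1, by simp⟩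
  have hs : τ.SameCycle 0 1 ∧ τ.SameCycle 5 1 ∧ τ.SameCycle 4 2 ∧ τ.SameCycle 6 2 := by
    have e0 := hstep 0
    have e1 := hstep 1
    have e2 := hstep 2
    have e4 := hstep 4
    have e5 := hstep 5
    have e6 := hstep 6
    rcases ht0 with h0 | h0 | h0 <;> rcases ht1 with h1 | h1 | h1 <;>
      rcases ht5 with h5 | h5 | h5
    all_goals first
      | exact absurd (h0.trans h1.symm) hinj01
      | exact absurd (h0.trans h5.symm) hinj05
      | exact absurd (h1.trans h5.symm) hinj15
      | (simp [h0, h1, h5] at hc0; done)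
      | (simp [h0, h1, h5] at hc1; done)
      | skip
    -- the identity of the leaves extends to the identity of the diagram
    · have k2 : τ 2 = 2 := by simpa [h1] using ht2
      have k4 : τ 4 = 4 := by simpa [h5] using ht4
      have k6 : τ 6 = 6 := by simpa [h0] using ht6
      refine absurd (Equiv.ext fun i => ?_) hne
      fin_cases i <;> assumption
    · have k2 : τ 2 = 4 := by simpa [h1] using ht2
      have k4 : τ 4 = 6 := by simpa [h5] using ht4
      have k6 : τ 6 = 2 := by simpa [h0] using ht6
      rw [h0] at e0
      rw [h1] at e1
      rw [k2] at e2
      rw [k6] at e6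
      exact ⟨e0, e1.symm, e2.symm, e6⟩
    · have k2 : τ 2 = 6 := by simpa [h1] using ht2
      have k4 : τ 4 = 2 := by simpa [h5] using ht4
      rw [h1] at e1
      rw [h5] at e5
      rw [k2] at e2
      rw [k4] at e4
      exact ⟨e1.symm, e5, e4, e2.symm⟩
  obtain ⟨s0, s5, s4, s6⟩ := hs
  refine ⟨by decide, fun i => ?_, fun i hi j hj hij => ?_⟩
  · fin_cases i
    · exact ⟨1, by decide, s0⟩
    · exact ⟨1, by decide, Perm.SameCycle.refl _ _⟩
    · exact ⟨2, by decide, Perm.SameCycle.refl _ _⟩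
    · exact ⟨3, by decide, Perm.SameCycle.refl _ _⟩
    · exact ⟨2, by decide, s4⟩
    · exact ⟨1, by decide, s5⟩
    · exact ⟨2, by decide, s6⟩
  · have hij' := eq_of_sameCycle f hf hij
    have : ∀ i j : Fin 7, i ∈ [(1 : Fin 7), 2, 3] → j ∈ [(1 : Fin 7), 2, 3] → f i = f j → i = j := by
      decide
    exact this i j hi hj hij'

theorem isTransversal_coxeterWord {X : AffineType} {τ : Perm X.Node} (hτ : IsDiagramAut X τ)
    (hne : τ ≠ 1) : IsTransversal τ (coxeterWord X τ) := by
  cases X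
  case B1 n hn => exact isTransversal_of_cartanB hn (fun i j => hτ i j) hne
  case A2odd n hn => exact isTransversal_of_cartanB hn (fun i j => hτ j i) hne
  case D1 n hn =>
    change IsTransversal τ (wordD (n := n) τ)
    unfold wordD
    split_ifs with h
    · exact isTransversal_leastNonzeroReps (n := n) (by omega) _ h
    · exact isTransversal_leastReps (n := n) τ
  case E6 =>
    change IsTransversal τ (wordE6 τ)
    unfold wordE6
    split_ifs with h
    · exact isTransversal_E6 hτ hne h
    · exact isTransversal_leastReps (n := 6) τ
  all_goals exact isTransversal_leastReps _

/-! ### Evaluation of twisted Coxeter elements -/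

/-- Applying the simple reflections of a subset in decreasing order of the vertices replaces the
coordinates of `y` by those of `z` one after the other, provided each step does so; when the
reflection at `i` is applied, the coordinates beyond `i` have already been replaced. -/
theorem prod_refl_filter_apply {m : ℕ} {R : Type*} [CommRing R] {C : Matrix (Fin m) (Fin m) ℤ}
    (P : Fin m → Prop) [DecidablePred P] (y z : Fin m → R)
    (h1 : ∀ i, P i → ∑ j, (C j i : R) * (if i < j then z j else y j) = y i - z i)
    (h2 : ∀ i, ¬ P i → y i = z i) :
    (((List.finRange m).filter fun i => P i).map (refl R C)).prod y = z := by
  have key : ∀ l : List (Fin m), l.Pairwise (· < ·) → (∀ i ∈ l, ∀ j, i < j → j ∈ l) →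
      ((l.filter fun i => P i).map (refl R C)).prod y = fun j => if j ∈ l then z j else y j := by
    intro l
    induction l with
    | nil => intro _ _; simp
    | cons i l ih =>
      intro hl hup
      rw [List.pairwise_cons] at hl
      have hmem : ∀ j, j ∈ l ↔ i < j := fun j =>
        ⟨hl.1 j, fun hj => (List.mem_cons.1 (hup i List.mem_cons_self j hj)).resolve_left hj.ne'⟩
      have ih' := ih hl.2 fun k hk j hj =>
        (List.mem_cons.1 (hup k (List.mem_cons_of_mem _ hk) j hj)).resolve_left
          ((hl.1 k hk).trans hj).ne'
      by_cases hi : P i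
      · rw [List.filter_cons_of_pos (by simpa using hi), List.map_cons, List.prod_cons,
          Module.End.mul_apply, ih']
        ext j
        by_cases hj : j = i
        · subst hj
          have := h1 j hi
          simp only [← hmem] at this
          rw [refl_apply_same, this]
          simp [hmem]
        · rw [refl_apply_of_ne hj]
          simp [hj]
      · rw [List.filter_cons_of_neg (by simpa using hi), ih']
        ext j
        by_cases hj : j = i
        · subst hj
          simp [hmem, h2 j hi]
        · simp [hj]
  rw [key _ (List.pairwise_lt_finRange m) fun i _ j _ => List.mem_finRange j]
  simp

/-- The criterion for minimality with the evaluation of the twisted Coxeter element split into its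
single steps: the word is the subset `P` of the vertices, and the coordinates of `τ b` are replaced
by those of `b + k c` one after the other. -/
theorem isMinimalSolution_of_step {X : AffineType} {τ : Perm X.Node} (hτ : IsDiagramAut X τ)
    (hne : τ ≠ 1) (P : X.Node → Prop) [DecidablePred P]
    (hword : coxeterWord X τ = (List.finRange (X.rank + 1)).filter fun i => P i)
    {k : ℕ} (hk : 0 < k) (b : X.Node → ℕ)
    (h1 : ∀ i, P i → ∑ j, X.entry j i *
      (if i < j then (b j : ℤ) + k * X.dualLabel j else b (τ.symm j)) =
        b (τ.symm i) - (b i + k * X.dualLabel i))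
    (h2 : ∀ i, ¬ P i → (b (τ.symm i) : ℤ) = b i + k * X.dualLabel i)
    {i j l : X.Node} (hi : X.dualLabel i = 1) (hj : X.dualLabel j = 1)
    (hij : IsCoprime (k : ℤ) ((b i : ℤ) - b j)) (hl : b l < X.dualLabel l) :
    IsDiagramAut X τ ∧ τ ≠ 1 ∧ IsMinimalSolution X τ k (∑ i, b i • coroot X i) := by
  refine ⟨hτ, hne, isMinimalSolution_of_isCoprime X.isAffineMatrix hτ
    (isTransversal_coxeterWord hτ hne) hk ?_ hi hj hij hl⟩
  rw [coxEnd_apply, hword]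
  exact prod_refl_filter_apply P _ _ h1 h2

/-- The vector to which the simple reflection at `i` is applied in the course of the evaluation: the
coordinates of `b + k a` beyond `i`, and those of `b ∘ s` up to `i`. -/
def stepVec (a s b : ℕ → ℕ) (k i j : ℕ) : ℤ := if i < j then (b j : ℤ) + k * a j else b (s j)

/-- The criterion for an infinite family, in which vertices are replaced by natural numbers: the
entries of the Cartan matrix, the labels, the automorphism `f`, its inverse `s` and the vector `b`
are given by functions on natural numbers. -/
theorem isMinimalSolution_of_local {X : AffineType} {τ : Perm X.Node} (n : ℕ) (hX : X.rank = n)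
    (C : ℕ → ℕ → ℤ) (a f s b : ℕ → ℕ) (k : ℕ) (Q : ℕ → Prop) [DecidablePred Q]
    (hC : ∀ i j : X.Node, X.cartan i j = C i.val j.val)
    (ha : ∀ i : X.Node, X.dualLabel i = a i.val)
    (hf : ∀ i : X.Node, (τ i).val = f i.val)
    (hs : ∀ i, i ≤ n → s i ≤ n ∧ f (s i) = i)
    (haut : ∀ i j, i ≤ n → j ≤ n → C (f i) (f j) = C i j)
    (hne : ∃ i, i ≤ n ∧ f i ≠ i)
    (hword : coxeterWord X τ = (List.finRange (X.rank + 1)).filter fun i => Q i.val)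
    (hk : 0 < k)
    (h1 : ∀ i, i ≤ n → Q i → ∑ j : Fin (n + 1), C j.val i * stepVec a s b k i j.val =
        b (s i) - (b i + k * a i))
    (h2 : ∀ i, i ≤ n → ¬ Q i → b (s i) = b i + k * a i)
    (hij : ∃ i j, i ≤ n ∧ j ≤ n ∧ a i = 1 ∧ a j = 1 ∧ IsCoprime (k : ℤ) ((b i : ℤ) - b j))
    (hl : ∃ l, l ≤ n ∧ b l < a l) :
    IsDiagramAut X τ ∧ τ ≠ 1 ∧ IsMinimalSolution X τ k (∑ i, b i.val • coroot X i) := by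
  subst hX
  have hsymm : ∀ i : X.Node, (τ.symm i).val = s i.val := by
    intro i
    obtain ⟨h3, h4⟩ := hs i.val (by omega)
    have : τ.symm i = ⟨s i.val, by omega⟩ := by
      rw [Equiv.symm_apply_eq]
      exact Fin.ext (by rw [hf, h4])
    rw [this]
  obtain ⟨i₀, j₀, hi, hj, hai, haj, hij⟩ := hij
  obtain ⟨l, hl, hbl⟩ := hl
  refine isMinimalSolution_of_step ?_ ?_ (fun i => Q i.val) hword hk (fun i => b i.val) ?_ ?_
    (i := ⟨i₀, by omega⟩) (j := ⟨j₀, by omega⟩) (l := ⟨l, by omega⟩) ?_ ?_ hij ?_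
  · intro i j
    rw [hC, hC, hf, hf, haut _ _ (by omega) (by omega)]
  · rintro rfl
    obtain ⟨i, hi, hfi⟩ := hne
    exact hfi (hf ⟨i, by omega⟩).symm
  · intro i hi
    have := h1 i.val (by omega) hi
    rw [hsymm, ha, ← this]
    refine Finset.sum_congr rfl fun j _ => ?_
    rw [hsymm, ha]
    simp only [AffineType.entry, hC, Fin.lt_def, stepVec]
  · intro i hi
    rw [hsymm, ha]
    exact_mod_cast h2 i.val (by omega) hi
  · rw [ha]; exact hai
  · rw [ha]; exact haj
  · rw [ha]; exact hbl

/-! ### Representatives of the orbits -/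

theorem sameCycle_iff_of_involutive {ι : Type*} {τ : Perm ι} (h : ∀ i, τ (τ i) = i) (i j : ι) :
    τ.SameCycle i j ↔ j = i ∨ j = τ i := by
  constructor
  · rintro ⟨k, rfl⟩
    have h2 : τ ^ (2 : ℤ) = 1 := by
      ext i
      rw [zpow_two, Perm.mul_apply, h, Perm.one_apply]
    rcases Int.even_or_odd' k with ⟨l, rfl | rfl⟩
    · left; rw [zpow_mul, h2, one_zpow, Perm.one_apply]
    · right; rw [zpow_add, zpow_mul, h2, one_zpow, one_mul, zpow_one]
  · rintro (rfl | rfl)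
    · exact Perm.SameCycle.refl _ _
    · exact ⟨1, by rw [zpow_one]⟩

theorem leastReps_eq_filter {n : ℕ} {τ : Perm (Fin (n + 1))} (Q : ℕ → Prop) [DecidablePred Q]
    (h : ∀ i : Fin (n + 1), (∀ j, τ.SameCycle i j → i ≤ j) ↔ Q i.val) :
    leastReps τ = (List.finRange (n + 1)).filter fun i => Q i.val :=
  List.filter_congr fun i _ => decide_eq_decide.2 (h i)

theorem leastNonzeroReps_eq_filter {n : ℕ} {τ : Perm (Fin (n + 1))} (Q : ℕ → Prop)
    [DecidablePred Q]
    (h : ∀ i : Fin (n + 1), (i ≠ 0 ∧ ∀ j, j ≠ 0 → τ.SameCycle i j → i ≤ j) ↔ Q i.val) :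
    leastNonzeroReps τ = (List.finRange (n + 1)).filter fun i => Q i.val :=
  List.filter_congr fun i _ => decide_eq_decide.2 (h i)

theorem leastReps_of_involutive {n : ℕ} {τ : Perm (Fin (n + 1))} {f : ℕ → ℕ}
    (hf : ∀ i, (τ i).val = f i.val) (hff : ∀ i, i ≤ n → f (f i) = i) :
    leastReps τ = (List.finRange (n + 1)).filter fun i => i.val ≤ f i.val := by
  have hinv : ∀ i, τ (τ i) = i := fun i => Fin.ext (by rw [hf, hf, hff _ (by omega)])
  refine leastReps_eq_filter (fun i => i ≤ f i) fun i => ?_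
  simp only [sameCycle_iff_of_involutive hinv]
  rw [← hf, Fin.val_fin_le]
  exact ⟨fun h => h _ (Or.inr rfl), fun h j hj => hj.elim (fun e => e ▸ le_rfl) fun e => e ▸ h⟩

theorem leastNonzeroReps_of_involutive {n : ℕ} {τ : Perm (Fin (n + 1))} {f : ℕ → ℕ}
    (hf : ∀ i, (τ i).val = f i.val) (hff : ∀ i, i ≤ n → f (f i) = i) :
    leastNonzeroReps τ =
      (List.finRange (n + 1)).filter fun i => i.val ≠ 0 ∧ (f i.val = 0 ∨ i.val ≤ f i.val) := by
  have hinv : ∀ i, τ (τ i) = i := fun i => Fin.ext (by rw [hf, hf, hff _ (by omega)])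
  refine leastNonzeroReps_eq_filter (fun i => i ≠ 0 ∧ (f i = 0 ∨ i ≤ f i)) fun i => ?_
  simp only [sameCycle_iff_of_involutive hinv]
  rw [← hf, Fin.val_fin_le]
  have h0 : ∀ j : Fin (n + 1), j.val = 0 ↔ j = 0 := fun j => by rw [Fin.ext_iff]; rfl
  simp only [Ne, h0]
  refine and_congr_right fun hi => ⟨fun h => ?_, fun h j hj hij => ?_⟩
  · by_cases h' : τ i = 0
    · exact Or.inl h'
    · exact Or.inr (h _ h' (Or.inr rfl))
  · rcases hij with rfl | rfl
    · exact le_rfl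
    · exact h.resolve_left hj

/-- The word in type `D_n^{(1)}` for an involution that exchanges `0` and `1`. -/
theorem wordD_of_involutive_of_swap {n : ℕ} (hn : 1 ≤ n) {τ : Perm (Fin (n + 1))} {f : ℕ → ℕ}
    (hf : ∀ i, (τ i).val = f i.val) (hff : ∀ i, i ≤ n → f (f i) = i) (h01 : f 0 = 1) :
    wordD τ =
      (List.finRange (n + 1)).filter fun i => i.val ≠ 0 ∧ (f i.val = 0 ∨ i.val ≤ f i.val) := by
  have h1 : τ 0 = 1 := Fin.ext (by
    rw [hf, Fin.val_zero, h01, Fin.val_one', Nat.mod_eq_of_lt (by omega)])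
  have : τ.SameCycle 0 1 := ⟨1, by rw [zpow_one, h1]⟩
  rw [wordD, if_pos this, leastNonzeroReps_of_involutive hf hff]

/-- The word in type `D_n^{(1)}` for an involution that does not exchange `0` and `1`. -/
theorem wordD_of_involutive {n : ℕ} (hn : 1 ≤ n) {τ : Perm (Fin (n + 1))} {f : ℕ → ℕ}
    (hf : ∀ i, (τ i).val = f i.val) (hff : ∀ i, i ≤ n → f (f i) = i) (h01 : f 0 ≠ 1) :
    wordD τ = (List.finRange (n + 1)).filter fun i => i.val ≤ f i.val := by
  have hinv : ∀ i, τ (τ i) = i := fun i => Fin.ext (by rw [hf, hf, hff _ (by omega)])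
  have h1 : (1 : Fin (n + 1)).val = 1 := by rw [Fin.val_one', Nat.mod_eq_of_lt (by omega)]
  have : ¬ τ.SameCycle 0 1 := by
    rw [sameCycle_iff_of_involutive hinv]
    rintro (h | h)
    · have := congrArg Fin.val h
      rw [h1] at this
      simp at this
    · have := congrArg Fin.val h
      rw [hf, h1] at this
      exact h01 this.symm
  rw [wordD, if_neg this, leastReps_of_involutive hf hff]

/-! ### The columns of the Cartan matrices -/

theorem sum_cartanA {n : ℕ} (hn : 1 ≤ n) (v : ℕ → ℤ) (i : ℕ) (hi : i ≤ n) :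
    ∑ j : Fin (n + 1), cartanA n j.val i * v j.val =
      2 * v i - v (if i = 0 then n else i - 1) - v (if i = n then 0 else i + 1) := by
  let f : ℕ → ℤ := fun j => cartanA n j i * v j
  change ∑ j : Fin (n + 1), f j.val = _
  rcases Nat.lt_or_ge n 2 with h2 | h2
  · rw [sum_two n 0 1 f] <;> grind [cartanA]
  · rcases Nat.eq_zero_or_pos i with h | h
    · rw [sum_three n 0 1 n f] <;> grind [cartanA]
    · rcases Nat.lt_or_ge i n with h' | h'
      · rw [sum_neighbours n i f] <;> grind [cartanA]
      · rw [sum_three n 0 (n - 1) n f] <;> grind [cartanA]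

theorem sum_cartanB {n : ℕ} (hn : 3 ≤ n) (v : ℕ → ℤ) (i : ℕ) (hi : i ≤ n) :
    ∑ j : Fin (n + 1), cartanB n j.val i * v j.val =
      if i ≤ 1 then 2 * v i - v 2
      else 2 * v i - (if i = 2 then v 0 + v 1 else v (i - 1)) -
        (if i = n then 0 else if i + 1 = n then 2 * v (i + 1) else v (i + 1)) := by
  let f : ℕ → ℤ := fun j => cartanB n j i * v j
  change ∑ j : Fin (n + 1), f j.val = _
  by_cases h0 : i ≤ 1
  · rw [sum_two n i 2 f] <;> grind [cartanB]
  by_cases h2 : i = 2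
  · rw [sum_four n 0 1 2 3 f] <;> grind [cartanB]
  by_cases hin : i = n
  · rw [sum_two n (n - 1) n f] <;> grind [cartanB]
  · rw [sum_neighbours n i f] <;> grind [cartanB]

theorem sum_cartanB_transpose {n : ℕ} (hn : 3 ≤ n) (v : ℕ → ℤ) (i : ℕ) (hi : i ≤ n) :
    ∑ j : Fin (n + 1), cartanB n i j.val * v j.val =
      if i ≤ 1 then 2 * v i - v 2
      else 2 * v i - (if i = 2 then v 0 + v 1 else if i = n then 2 * v (i - 1) else v (i - 1)) -
        (if i = n then 0 else v (i + 1)) := by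
  let f : ℕ → ℤ := fun j => cartanB n i j * v j
  change ∑ j : Fin (n + 1), f j.val = _
  by_cases h0 : i ≤ 1
  · rw [sum_two n i 2 f] <;> grind [cartanB]
  by_cases h2 : i = 2
  · rw [sum_four n 0 1 2 3 f] <;> grind [cartanB]
  by_cases hin : i = n
  · rw [sum_two n (n - 1) n f] <;> grind [cartanB]
  · rw [sum_neighbours n i f] <;> grind [cartanB]

theorem sum_cartanC {n : ℕ} (hn : 2 ≤ n) (v : ℕ → ℤ) (i : ℕ) (hi : i ≤ n) :
    ∑ j : Fin (n + 1), cartanC n j.val i * v j.val =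
      if i = 0 then 2 * v 0 - 2 * v 1
      else if i = n then 2 * v n - 2 * v (n - 1)
      else 2 * v i - v (i - 1) - v (i + 1) := by
  let f : ℕ → ℤ := fun j => cartanC n j i * v j
  change ∑ j : Fin (n + 1), f j.val = _
  by_cases h0 : i = 0
  · rw [sum_two n 0 1 f] <;> grind [cartanC]
  by_cases hin : i = n
  · rw [sum_two n (n - 1) n f] <;> grind [cartanC]
  · rw [sum_neighbours n i f] <;> grind [cartanC]

theorem sum_cartanC_transpose {n : ℕ} (hn : 2 ≤ n) (v : ℕ → ℤ) (i : ℕ) (hi : i ≤ n) :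
    ∑ j : Fin (n + 1), cartanC n i j.val * v j.val =
      if i = 0 then 2 * v 0 - v 1
      else if i = n then 2 * v n - v (n - 1)
      else 2 * v i - (if i = 1 then 2 * v 0 else v (i - 1)) -
        (if i + 1 = n then 2 * v n else v (i + 1)) := by
  let f : ℕ → ℤ := fun j => cartanC n i j * v j
  change ∑ j : Fin (n + 1), f j.val = _
  by_cases h0 : i = 0
  · rw [sum_two n 0 1 f] <;> grind [cartanC]
  by_cases hin : i = n
  · rw [sum_two n (n - 1) n f] <;> grind [cartanC]
  · rw [sum_neighbours n i f] <;> grind [cartanC]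

theorem sum_cartanD {n : ℕ} (hn : 5 ≤ n) (v : ℕ → ℤ) (i : ℕ) (hi : i ≤ n) :
    ∑ j : Fin (n + 1), cartanD n j.val i * v j.val =
      if i ≤ 1 then 2 * v i - v 2
      else if n ≤ i + 1 then 2 * v i - v (n - 2)
      else 2 * v i - (if i = 2 then v 0 + v 1 else v (i - 1)) -
        (if i + 2 = n then v (n - 1) + v n else v (i + 1)) := by
  let f : ℕ → ℤ := fun j => cartanD n j i * v j
  change ∑ j : Fin (n + 1), f j.val = _
  by_cases h0 : i ≤ 1
  · rw [sum_two n i 2 f] <;> grind [cartanD]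
  by_cases hin : n ≤ i + 1
  · rw [sum_two n (n - 2) i f] <;> grind [cartanD]
  by_cases h2 : i = 2
  · rw [sum_four n 0 1 2 3 f] <;> grind [cartanD]
  by_cases hn2 : i + 2 = n
  · rw [sum_four n (n - 3) (n - 2) (n - 1) n f] <;> grind [cartanD]
  · rw [sum_neighbours n i f] <;> grind [cartanD]

/-! ### Types `B_n^{(1)}` and `A_{2n-1}^{(2)}` -/

/-- The exchange of `0` and `1`. -/
def swapFun (i : ℕ) : ℕ := if i = 0 then 1 else if i = 1 then 0 else i

theorem swapFun_swapFun (i : ℕ) : swapFun (swapFun i) = i := by grind [swapFun]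

theorem swapFun_le {n i : ℕ} (hn : 1 ≤ n) (hi : i ≤ n) : swapFun i ≤ n := by grind [swapFun]

theorem val_one_of_le {n : ℕ} (hn : 1 ≤ n) : (1 : Fin (n + 1)).val = 1 := by
  rw [Fin.val_one', Nat.mod_eq_of_lt (by omega)]

theorem swap_zero_one_val {n : ℕ} (hn : 1 ≤ n) (i : Fin (n + 1)) :
    (swap (0 : Fin (n + 1)) 1 i).val = swapFun i.val := by
  rw [swap_apply_def, swapFun]
  simp only [Fin.ext_iff, val_one_of_le hn, Fin.val_zero]
  split_ifs
  · exact val_one_of_le hn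
  · rfl
  · rfl

theorem cartanB_swapFun {n : ℕ} (hn : 3 ≤ n) (i j : ℕ) :
    cartanB n (swapFun i) (swapFun j) = cartanB n i j := by
  unfold swapFun
  split_ifs <;> subst_vars <;> grind [cartanB]

theorem filter_ne_zero (n : ℕ) : ((List.finRange (n + 1)).filter fun i => i ≠ 0) =
    (List.finRange (n + 1)).filter fun i => i.val ≠ 0 :=
  List.filter_congr fun i _ => decide_eq_decide.2 (by rw [Ne, Fin.ext_iff]; rfl)

/-- A criterion in type `B_n^{(1)}`. The word omits only the vertex `0`, at which the condition is
`b 1 = b 0 + k`; the minimality of `k` rests on the vertices `0` and `n`. -/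
theorem isMinimalSolution_B {n : ℕ} (hn : 3 ≤ n) (b : ℕ → ℕ) (k : ℕ) (hk : 0 < k)
    (h1 : ∀ i, 1 ≤ i → i ≤ n → ∑ j : Fin (n + 1), cartanB n j.val i *
      stepVec (fun i => if i ≤ 1 ∨ i = n then 1 else 2) swapFun b k i j.val =
        b (swapFun i) - (b i + k * (if i ≤ 1 ∨ i = n then 1 else 2 : ℕ)))
    (hb0 : b 1 = b 0 + k) (hbn : b n = 0) (hco : IsCoprime (k : ℤ) (b 0)) :
    IsDiagramAut (.B1 n hn) (gammaB n) ∧ gammaB n ≠ 1 ∧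
      IsMinimalSolution (.B1 n hn) (gammaB n) k (∑ i, b i.val • coroot (.B1 n hn) i) := by
  refine isMinimalSolution_of_local n rfl (cartanB n)
    (fun i => if i ≤ 1 ∨ i = n then 1 else 2) swapFun swapFun b k (fun i => i ≠ 0) (fun _ _ => rfl)
    (fun _ => rfl) (swap_zero_one_val (n := n) (by omega))
    (fun i hi => ⟨swapFun_le (by omega) hi, swapFun_swapFun i⟩)
    (fun i j _ _ => cartanB_swapFun hn i j) ⟨0, by simp [swapFun]⟩
    (filter_ne_zero n) hk (fun i hi h0 => h1 i (by omega) hi) ?_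
    ⟨0, n, by omega, by omega, by simp, by simp, by
      rw [hbn, Nat.cast_zero, sub_zero]; exact hco⟩ ⟨n, by simp [hbn]⟩
  intro i hi hQ
  have : i = 0 := by omega
  subst this
  simp [swapFun, hb0]

theorem isMinimalSolution_B_even (n m : ℕ) (hn : 3 ≤ n) (hm : n = 2 * m) :
    IsDiagramAut (.B1 n hn) (gammaB n) ∧ gammaB n ≠ 1 ∧
      IsMinimalSolution (.B1 n hn) (gammaB n) 1 (∑ i,
        (if i.val = 0 then m - 1 else if i.val = 1 then m else n - i.val) •
          coroot (.B1 n hn) i) := by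
  refine isMinimalSolution_B hn (fun i => if i = 0 then m - 1 else if i = 1 then m else n - i) 1
    one_pos (fun i h1 hi => ?_) (by grind) (by grind) isCoprime_one_left
  rw [sum_cartanB hn _ i hi]
  simp only [stepVec, swapFun]
  grind (splits := 40)

theorem isMinimalSolution_B_odd (n m : ℕ) (hn : 3 ≤ n) (hm : n = 2 * m + 1) :
    IsDiagramAut (.B1 n hn) (gammaB n) ∧ gammaB n ≠ 1 ∧
      IsMinimalSolution (.B1 n hn) (gammaB n) 2 (∑ i,
        (if i.val = 0 then n - 2 else if i.val = 1 then n else 2 * (n - i.val)) •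
          coroot (.B1 n hn) i) := by
  refine isMinimalSolution_B hn
    (fun i => if i = 0 then n - 2 else if i = 1 then n else 2 * (n - i)) 2
    two_pos (fun i h1 hi => ?_) (by grind) (by grind) ?_
  · rw [sum_cartanB hn _ i hi]
    simp only [stepVec, swapFun]
    grind (splits := 40)
  · rw [Nat.isCoprime_iff_coprime, Nat.coprime_two_left]
    simp only [if_pos]
    rw [Nat.odd_iff]
    omega

/-- A criterion in type `A_{2n-1}^{(2)}`, whose Cartan matrix is the transpose of that of
`B_n^{(1)}`. -/
theorem isMinimalSolution_A2odd {n : ℕ} (hn : 3 ≤ n) (b : ℕ → ℕ)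
    (h1 : ∀ i, 1 ≤ i → i ≤ n → ∑ j : Fin (n + 1), cartanB n i j.val *
      stepVec (fun i => if i ≤ 1 then 1 else 2) swapFun b 1 i j.val =
        b (swapFun i) - (b i + (1 : ℕ) * (if i ≤ 1 then 1 else 2 : ℕ)))
    (hb0 : b 1 = b 0 + 1) (hbn : b n ≤ 1) :
    IsDiagramAut (.A2odd n hn) (gammaB n) ∧ gammaB n ≠ 1 ∧
      IsMinimalSolution (.A2odd n hn) (gammaB n) 1 (∑ i, b i.val • coroot (.A2odd n hn) i) := by
  refine isMinimalSolution_of_local n rfl (fun i j => cartanB n j i)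
    (fun i => if i ≤ 1 then 1 else 2) swapFun swapFun b 1 (fun i => i ≠ 0) (fun _ _ => rfl)
    (fun _ => rfl) (swap_zero_one_val (n := n) (by omega))
    (fun i hi => ⟨swapFun_le (by omega) hi, swapFun_swapFun i⟩)
    (fun i j _ _ => cartanB_swapFun hn j i) ⟨0, by simp [swapFun]⟩
    (filter_ne_zero n) one_pos (fun i hi h0 => h1 i (by omega) hi) ?_
    ⟨0, 0, by omega, by omega, by simp, by simp, isCoprime_one_left⟩ ⟨n, le_rfl, by grind⟩
  intro i hi hQ
  have : i = 0 := by omega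
  subst this
  simp [swapFun, hb0]

theorem isMinimalSolution_A2odd_even (n m : ℕ) (hn : 3 ≤ n) (hm : n = 2 * m) :
    IsDiagramAut (.A2odd n hn) (gammaB n) ∧ gammaB n ≠ 1 ∧
      IsMinimalSolution (.A2odd n hn) (gammaB n) 1 (∑ i,
        (if i.val = 0 then m - 1 else if i.val = 1 then m else n - i.val) •
          coroot (.A2odd n hn) i) := by
  refine isMinimalSolution_A2odd hn
    (fun i => if i = 0 then m - 1 else if i = 1 then m else n - i) (fun i h1 hi => ?_)
    (by grind) (by grind)
  rw [sum_cartanB_transpose hn _ i hi]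
  simp only [stepVec, swapFun]
  grind (splits := 40)

theorem isMinimalSolution_A2odd_odd (n m : ℕ) (hn : 3 ≤ n) (hm : n = 2 * m + 1) :
    IsDiagramAut (.A2odd n hn) (gammaB n) ∧ gammaB n ≠ 1 ∧
      IsMinimalSolution (.A2odd n hn) (gammaB n) 1 (∑ i,
        (if i.val = 0 then m else if i.val = 1 then m + 1 else n + 1 - i.val) •
          coroot (.A2odd n hn) i) := by
  refine isMinimalSolution_A2odd hn
    (fun i => if i = 0 then m else if i = 1 then m + 1 else n + 1 - i) (fun i h1 hi => ?_)
    (by grind) (by grind)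
  rw [sum_cartanB_transpose hn _ i hi]
  simp only [stepVec, swapFun]
  grind (splits := 40)

/-! ### Types `C_n^{(1)}` and `D_{n+1}^{(2)}` -/

theorem revPerm_val {n : ℕ} (i : Fin (n + 1)) : (Fin.revPerm i).val = n - i.val := by
  rw [Fin.revPerm_apply, Fin.val_rev]
  omega

theorem cartanC_rev {n : ℕ} (i j : ℕ) (hi : i ≤ n) (hj : j ≤ n) :
    cartanC n (n - i) (n - j) = cartanC n i j := by
  grind [cartanC]

/-- A criterion in type `C_n^{(1)}`; the word consists of the vertices of the first half of the
chain. -/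
theorem isMinimalSolution_C {n : ℕ} (hn : 2 ≤ n) (b : ℕ → ℕ)
    (h1 : ∀ i, i ≤ n → i ≤ n - i → ∑ j : Fin (n + 1), cartanC n j.val i *
      stepVec (fun _ => 1) (fun i => n - i) b 1 i j.val =
        b (n - i) - (b i + (1 : ℕ) * (1 : ℕ)))
    (h2 : ∀ i, i ≤ n → n - i < i → b (n - i) = b i + 1) (h0 : ∃ l, l ≤ n ∧ b l = 0) :
    IsDiagramAut (.C1 n hn) (gammaC n) ∧ gammaC n ≠ 1 ∧
      IsMinimalSolution (.C1 n hn) (gammaC n) 1 (∑ i, b i.val • coroot (.C1 n hn) i) := by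
  obtain ⟨l, hl, hbl⟩ := h0
  exact isMinimalSolution_of_local n rfl (cartanC n)
    (fun _ => 1) (fun i => n - i) (fun i => n - i) b 1 (fun i => i ≤ n - i) (fun _ _ => rfl)
    (fun _ => rfl) (revPerm_val (n := n)) (fun i hi => by omega)
    (fun i j hi hj => cartanC_rev i j hi hj) ⟨0, by omega, by omega⟩
    (leastReps_of_involutive (n := n) (f := fun i => n - i) revPerm_val fun i hi => by omega)
    one_pos h1 (fun i hi hQ => h2 i hi (by omega))
    ⟨0, 0, by omega, by omega, rfl, rfl, isCoprime_one_left⟩ ⟨l, hl, by omega⟩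

theorem isMinimalSolution_C_even (n m : ℕ) (hn : 2 ≤ n) (hm : n = 2 * m) :
    IsDiagramAut (.C1 n hn) (gammaC n) ∧ gammaC n ≠ 1 ∧
      IsMinimalSolution (.C1 n hn) (gammaC n) 1 (∑ i,
        (if i.val ≤ m then m - i.val else i.val - (m + 1)) • coroot (.C1 n hn) i) := by
  refine isMinimalSolution_C hn (fun i => if i ≤ m then m - i else i - (m + 1))
    (fun i hi h1 => ?_) (by grind) ⟨m, by grind⟩
  rw [sum_cartanC hn _ i hi]
  simp only [stepVec]
  grind (splits := 40)

theorem isMinimalSolution_C_odd (n m : ℕ) (hn : 2 ≤ n) (hm : n = 2 * m + 1) :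
    IsDiagramAut (.C1 n hn) (gammaC n) ∧ gammaC n ≠ 1 ∧
      IsMinimalSolution (.C1 n hn) (gammaC n) 1 (∑ i,
        (if i.val ≤ m + 1 then m + 1 - i.val else i.val - (m + 1)) • coroot (.C1 n hn) i) := by
  refine isMinimalSolution_C hn (fun i => if i ≤ m + 1 then m + 1 - i else i - (m + 1))
    (fun i hi h1 => ?_) (by grind) ⟨m + 1, by grind⟩
  rw [sum_cartanC hn _ i hi]
  simp only [stepVec]
  grind (splits := 40)

/-- A criterion in type `D_{n+1}^{(2)}`, whose Cartan matrix is the transpose of that of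
`C_n^{(1)}`. -/
theorem isMinimalSolution_D2 {n : ℕ} (hn : 2 ≤ n) (b : ℕ → ℕ)
    (h1 : ∀ i, i ≤ n → i ≤ n - i → ∑ j : Fin (n + 1), cartanC n i j.val *
      stepVec (fun i => if i = 0 ∨ i = n then 1 else 2) (fun i => n - i) b 1 i j.val =
        b (n - i) - (b i + (1 : ℕ) * (if i = 0 ∨ i = n then 1 else 2 : ℕ)))
    (h2 : ∀ i, i ≤ n → n - i < i → b (n - i) = b i + if i = 0 ∨ i = n then 1 else 2)
    (h0 : ∃ l, l ≤ n ∧ b l = 0) :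
    IsDiagramAut (.D2 n hn) (gammaC n) ∧ gammaC n ≠ 1 ∧
      IsMinimalSolution (.D2 n hn) (gammaC n) 1 (∑ i, b i.val • coroot (.D2 n hn) i) := by
  obtain ⟨l, hl, hbl⟩ := h0
  exact isMinimalSolution_of_local n rfl (fun i j => cartanC n j i)
    (fun i => if i = 0 ∨ i = n then 1 else 2) (fun i => n - i) (fun i => n - i) b 1
    (fun i => i ≤ n - i) (fun _ _ => rfl)
    (fun _ => rfl) (revPerm_val (n := n)) (fun i hi => by omega)
    (fun i j hi hj => cartanC_rev j i hj hi) ⟨0, by omega, by omega⟩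
    (leastReps_of_involutive (n := n) (f := fun i => n - i) revPerm_val fun i hi => by omega)
    one_pos h1 (fun i hi hQ => by rw [one_mul]; exact h2 i hi (by omega))
    ⟨0, 0, by omega, by omega, rfl, rfl, isCoprime_one_left⟩ ⟨l, hl, by grind⟩

theorem isMinimalSolution_D2_even (n m : ℕ) (hn : 2 ≤ n) (hm : n = 2 * m) :
    IsDiagramAut (.D2 n hn) (gammaC n) ∧ gammaC n ≠ 1 ∧
      IsMinimalSolution (.D2 n hn) (gammaC n) 1 (∑ i,
        (if i.val = 0 then m
        else if i.val ≤ m then 2 * (m - i.val)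
        else if i.val < n then 2 * (i.val - (m + 1))
        else m - 1) • coroot (.D2 n hn) i) := by
  refine isMinimalSolution_D2 hn (fun i => if i = 0 then m
        else if i ≤ m then 2 * (m - i)
        else if i < n then 2 * (i - (m + 1))
        else m - 1) (fun i hi h1 => ?_) (by grind) ⟨m, by grind⟩
  rw [sum_cartanC_transpose hn _ i hi]
  simp only [stepVec]
  grind (splits := 40)

theorem isMinimalSolution_D2_odd (n m : ℕ) (hn : 2 ≤ n) (hm : n = 2 * m + 1) :
    IsDiagramAut (.D2 n hn) (gammaC n) ∧ gammaC n ≠ 1 ∧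
      IsMinimalSolution (.D2 n hn) (gammaC n) 1 (∑ i,
        (if i.val = 0 then m + 1
        else if i.val ≤ m + 1 then 2 * (m + 1 - i.val)
        else if i.val < n then 2 * (i.val - (m + 1))
        else m) • coroot (.D2 n hn) i) := by
  refine isMinimalSolution_D2 hn (fun i => if i = 0 then m + 1
        else if i ≤ m + 1 then 2 * (m + 1 - i)
        else if i < n then 2 * (i - (m + 1))
        else m) (fun i hi h1 => ?_) (by grind) ⟨m + 1, by grind⟩
  rw [sum_cartanC_transpose hn _ i hi]
  simp only [stepVec]
  grind (splits := 40)

/-! ### Type `A_n^{(1)}` -/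

theorem gammaA_pow_val {n : ℕ} (hn : 1 ≤ n) (l : ℕ) (i : Fin (n + 1)) :
    ((gammaA n ^ l) i).val = (i.val + l) % (n + 1) := by
  induction l with
  | zero => rw [pow_zero, Perm.one_apply, add_zero, Nat.mod_eq_of_lt i.isLt]
  | succ l ih =>
    rw [pow_succ', Perm.mul_apply, gammaA, finRotate_apply, Fin.val_add, val_one_of_le hn]
    rw [gammaA] at ih
    rw [ih, Nat.mod_add_mod, add_assoc]

theorem gammaA_pow_val' {n l : ℕ} (hn : 1 ≤ n) (hl : l ≤ n) (i : Fin (n + 1)) :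
    ((gammaA n ^ l) i).val = if i.val + l ≤ n then i.val + l else i.val + l - (n + 1) := by
  rw [gammaA_pow_val hn]
  split_ifs with h
  · exact Nat.mod_eq_of_lt (by omega)
  · rw [Nat.mod_eq_sub_mod (by omega), Nat.mod_eq_of_lt (by omega)]

theorem cartanA_rotate {n l : ℕ} (hl : l ≤ n) (i j : ℕ) (hi : i ≤ n) (hj : j ≤ n) :
    cartanA n (if i + l ≤ n then i + l else i + l - (n + 1))
      (if j + l ≤ n then j + l else j + l - (n + 1)) = cartanA n i j := by
  by_cases h1 : i + l ≤ n <;> by_cases h2 : j + l ≤ n <;> simp only [h1, h2, if_true, if_false] <;>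
    grind [cartanA]

theorem cartanA_rev {n : ℕ} (i j : ℕ) (hi : i ≤ n) (hj : j ≤ n) :
    cartanA n (n - i) (n - j) = cartanA n i j := by
  grind [cartanA]

theorem cartanA_neg {n : ℕ} (i j : ℕ) (hi : i ≤ n) (hj : j ≤ n) :
    cartanA n (if i = 0 then 0 else n + 1 - i) (if j = 0 then 0 else n + 1 - j) =
      cartanA n i j := by
  by_cases h1 : i = 0 <;> by_cases h2 : j = 0 <;> simp only [h1, h2, if_true, if_false] <;>
    grind [cartanA]

/-- The orbits of the rotation by a divisor `l` of `n + 1` are the residue classes modulo `l`. -/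
theorem leastReps_gammaA_pow {n l : ℕ} (hn : 1 ≤ n) (hl0 : 0 < l) (hl : l ∣ n + 1) (hln : l ≤ n) :
    leastReps (gammaA n ^ l) = (List.finRange (n + 1)).filter fun i => i.val < l := by
  refine leastReps_eq_filter (fun i => i < l) fun i => ⟨fun h => ?_, fun h j hij => ?_⟩
  · by_contra hi
    have h1 : (gammaA n ^ l) ⟨i.val - l, by omega⟩ = i := Fin.ext (by
      rw [gammaA_pow_val' hn hln]
      simp only []
      rw [if_pos (by omega)]
      omega)
    have h2 : (gammaA n ^ l).SameCycle i ⟨i.val - l, by omega⟩ :=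
      Perm.SameCycle.symm ⟨1, by rw [zpow_one, h1]⟩
    have h3 := Fin.le_def.1 (h _ h2)
    simp only [] at h3
    omega
  · have := eq_of_sameCycle (fun i : Fin (n + 1) => i.val % l) (fun i => by
      rw [gammaA_pow_val hn, Nat.mod_mod_of_dvd _ hl, Nat.add_mod_right]) hij
    rw [Fin.le_def, ← Nat.mod_eq_of_lt h, this]
    exact Nat.mod_le _ _

/-- The row of the rotations. The coordinates of `b` at `n - 1` and `n` differ by `1`, which forces
every admissible `k` to be a multiple of `l`. -/
theorem isMinimalSolution_A_gamma (n l : ℕ) (hn : 1 ≤ n) (hl : l ∣ n + 1) (hln : l < n + 1) :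
    IsDiagramAut (.A1 n hn) (gammaA n ^ l) ∧ gammaA n ^ l ≠ 1 ∧
      IsMinimalSolution (.A1 n hn) (gammaA n ^ l) l (∑ i, (n - i.val) • coroot (.A1 n hn) i) := by
  have hl0 : 0 < l := Nat.pos_of_dvd_of_pos hl (by omega)
  refine isMinimalSolution_of_local n rfl (cartanA n) (fun _ => 1)
    (fun i => if i + l ≤ n then i + l else i + l - (n + 1))
    (fun i => if i < l then i + (n + 1) - l else i - l) (fun i => n - i) l (fun i => i < l)
    (fun _ _ => rfl) (fun _ => rfl) (gammaA_pow_val' (n := n) hn (by omega)) (fun i hi => by grind)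
    (cartanA_rotate (n := n) (by omega)) ⟨0, by omega, by grind⟩
    (leastReps_gammaA_pow (n := n) hn hl0 hl (by omega)) hl0 (fun i hi h1 => ?_) (fun i hi h1 => by grind)
    ⟨n - 1, n, by omega, by omega, rfl, rfl, ?_⟩ ⟨n, le_rfl, by omega⟩
  · rw [sum_cartanA hn _ i hi]
    simp only [stepVec]
    grind (splits := 40)
  · have : ((n - (n - 1) : ℕ) : ℤ) - ((n - n : ℕ) : ℤ) = 1 := by omega
    rw [this]
    exact isCoprime_one_right

theorem neg_val_involutive {n i : ℕ} (hi : i ≤ n) : (if i = 0 then 0 else n + 1 - i) ≤ n ∧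
    (if (if i = 0 then 0 else n + 1 - i) = 0 then 0 else
      n + 1 - (if i = 0 then 0 else n + 1 - i)) = i := by
  grind

theorem sigmaA_val {n : ℕ} (i : Fin (n + 1)) :
    (sigmaA n i).val = if i.val = 0 then 0 else n + 1 - i.val := by
  rw [sigmaA, Equiv.neg_apply, Fin.val_neg]
  split_ifs with h1 h2 h2
  · rfl
  · exact absurd (congrArg Fin.val h1) h2
  · exact absurd (Fin.ext h2) h1
  · rfl

theorem sigmaA_mul_gammaA_val {n : ℕ} (hn : 1 ≤ n) (i : Fin (n + 1)) :
    ((sigmaA n * gammaA n) i).val = n - i.val := by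
  have h := gammaA_pow_val' hn hn i
  rw [pow_one] at h
  rw [Perm.mul_apply, sigmaA_val, h]
  grind

/-- A criterion for the reflection `σ` in type `A_n^{(1)}`. -/
theorem isMinimalSolution_A_sigma {n : ℕ} (hn1 : 1 ≤ n) (hn : 2 ≤ n) (b : ℕ → ℕ)
    (h1 : ∀ i, i ≤ n → i ≤ (if i = 0 then 0 else n + 1 - i) → ∑ j : Fin (n + 1),
      cartanA n j.val i * stepVec (fun _ => 1) (fun i => if i = 0 then 0 else n + 1 - i) b 1 i j.val =
        b (if i = 0 then 0 else n + 1 - i) - (b i + (1 : ℕ) * (1 : ℕ)))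
    (h2 : ∀ i, i ≤ n → 2 * i > n + 1 → b (n + 1 - i) = b i + 1) (h0 : ∃ l, l ≤ n ∧ b l = 0) :
    IsDiagramAut (.A1 n hn1) (sigmaA n) ∧ sigmaA n ≠ 1 ∧
      IsMinimalSolution (.A1 n hn1) (sigmaA n) 1
        (∑ i, b i.val • coroot (.A1 n hn1) i) := by
  obtain ⟨l, hl, hbl⟩ := h0
  refine isMinimalSolution_of_local n rfl (cartanA n) (fun _ => 1)
    (fun i => if i = 0 then 0 else n + 1 - i) (fun i => if i = 0 then 0 else n + 1 - i) b 1
    (fun i => i ≤ (if i = 0 then 0 else n + 1 - i)) (fun _ _ => rfl) (fun _ => rfl)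
    (sigmaA_val (n := n)) (fun i hi => neg_val_involutive hi) cartanA_neg
    ⟨1, by omega, by simp only [one_ne_zero, if_false]; omega⟩
    (leastReps_of_involutive (n := n) (f := fun i => if i = 0 then 0 else n + 1 - i) sigmaA_val
      fun i hi => (neg_val_involutive hi).2) one_pos h1 (fun i hi hQ => ?_)
    ⟨0, 0, by omega, by omega, rfl, rfl, isCoprime_one_left⟩ ⟨l, hl, by omega⟩
  clear h1
  have := h2 i hi (by grind)
  grind

theorem isMinimalSolution_A_sigma_even (n m : ℕ) (hn1 : 1 ≤ n) (hn : 2 ≤ n) (hm : n = 2 * m) :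
    IsDiagramAut (.A1 n hn1) (sigmaA n) ∧ sigmaA n ≠ 1 ∧
      IsMinimalSolution (.A1 n hn1) (sigmaA n) 1 (∑ i,
        (if i.val = 0 then m else if i.val ≤ m + 1 then m + 1 - i.val else i.val - (m + 1)) •
          coroot (.A1 n hn1) i) := by
  refine isMinimalSolution_A_sigma hn1 hn
    (fun i => if i = 0 then m else if i ≤ m + 1 then m + 1 - i else i - (m + 1))
    (fun i hi h1 => ?_) (by grind) ⟨m + 1, by grind⟩
  rw [sum_cartanA hn1 _ i hi]
  simp only [stepVec]
  grind (splits := 40)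

theorem isMinimalSolution_A_sigma_odd (n m : ℕ) (hn1 : 1 ≤ n) (hn : 3 ≤ n) (hm : n = 2 * m + 1) :
    IsDiagramAut (.A1 n hn1) (sigmaA n) ∧ sigmaA n ≠ 1 ∧
      IsMinimalSolution (.A1 n hn1) (sigmaA n) 1 (∑ i,
        (if i.val = 0 then m else if i.val ≤ m + 1 then m + 1 - i.val else i.val - (m + 2)) •
          coroot (.A1 n hn1) i) := by
  refine isMinimalSolution_A_sigma hn1 (by omega)
    (fun i => if i = 0 then m else if i ≤ m + 1 then m + 1 - i else i - (m + 2))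
    (fun i hi h1 => ?_) (by grind) ⟨m + 1, by grind⟩
  rw [sum_cartanA hn1 _ i hi]
  simp only [stepVec]
  grind (splits := 40)

theorem isMinimalSolution_A_sigma_gamma_odd (n m : ℕ) (hn1 : 1 ≤ n) (hn : 3 ≤ n) (hm : n = 2 * m + 1) :
    IsDiagramAut (.A1 n hn1) (sigmaA n * gammaA n) ∧ sigmaA n * gammaA n ≠ 1 ∧
      IsMinimalSolution (.A1 n hn1) (sigmaA n * gammaA n) 1 (∑ i,
        (if i.val ≤ m + 1 then m + 1 - i.val else i.val - (m + 1)) •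
          coroot (.A1 n hn1) i) := by
  refine isMinimalSolution_of_local n rfl (cartanA n) (fun _ => 1) (fun i => n - i)
    (fun i => n - i) (fun i => if i ≤ m + 1 then m + 1 - i else i - (m + 1)) 1
    (fun i => i ≤ n - i) (fun _ _ => rfl) (fun _ => rfl)
    (sigmaA_mul_gammaA_val (n := n) hn1) (fun i hi => by omega) cartanA_rev
    ⟨0, by omega, by omega⟩
    (leastReps_of_involutive (n := n) (f := fun i => n - i) (sigmaA_mul_gammaA_val hn1)
      fun i hi => by omega) one_pos (fun i hi h1 => ?_) (fun i hi hQ => by grind)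
    ⟨0, 0, by omega, by omega, rfl, rfl, isCoprime_one_left⟩ ⟨m + 1, by omega, by grind⟩
  rw [sum_cartanA hn1 _ i hi]
  simp only [stepVec]
  grind (splits := 40)

/-! ### Type `D_n^{(1)}` -/

/-- The exchange of `n - 1` and `n`. -/
def endFun (n i : ℕ) : ℕ := if i = n then n - 1 else if i + 1 = n then n else i

theorem endFun_eq {n i : ℕ} (hn : 4 ≤ n) (hi : i ≤ n) : endFun n i = n - swapFun (n - i) := by
  grind [endFun, swapFun]

theorem endFun_endFun {n i : ℕ} (hn : 4 ≤ n) (hi : i ≤ n) :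
    endFun n i ≤ n ∧ endFun n (endFun n i) = i := by
  grind [endFun]

/-- The exchanges of `0` and `1` and of `n - 1` and `n`. -/
def endsFun (n i : ℕ) : ℕ :=
  if i = 0 then 1 else if i = 1 then 0 else if i = n then n - 1 else if i + 1 = n then n else i

theorem endsFun_eq {n : ℕ} (hn : 4 ≤ n) (i : ℕ) : endsFun n i = swapFun (endFun n i) := by
  grind [endsFun, endFun, swapFun]

theorem endsFun_endsFun {n i : ℕ} (hn : 4 ≤ n) (hi : i ≤ n) :
    endsFun n i ≤ n ∧ endsFun n (endsFun n i) = i := by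
  grind [endsFun]

theorem cartanD_swapFun {n : ℕ} (hn : 4 ≤ n) (i j : ℕ) :
    cartanD n (swapFun i) (swapFun j) = cartanD n i j := by
  unfold swapFun
  split_ifs <;> subst_vars <;> grind [cartanD]

theorem cartanD_rev {n : ℕ} (hn : 4 ≤ n) (i j : ℕ) (hi : i ≤ n) (hj : j ≤ n) :
    cartanD n (n - i) (n - j) = cartanD n i j := by
  grind (splits := 40) [cartanD]

theorem cartanD_endFun {n : ℕ} (hn : 4 ≤ n) (i j : ℕ) (hi : i ≤ n) (hj : j ≤ n) :
    cartanD n (endFun n i) (endFun n j) = cartanD n i j := by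
  rw [endFun_eq hn hi, endFun_eq hn hj, cartanD_rev hn _ _ (swapFun_le (by omega) (by omega))
    (swapFun_le (by omega) (by omega)), cartanD_swapFun hn, cartanD_rev hn _ _ hi hj]

theorem gammaD_val {n : ℕ} (hn : 1 ≤ n) (i : Fin (n + 1)) :
    (gammaD n i).val = swapFun (n - i.val) := by
  rw [gammaD, Perm.mul_apply, swap_zero_one_val hn, revPerm_val]

theorem sigmaD_val {n : ℕ} (hn : 4 ≤ n) (i : Fin (n + 1)) :
    (sigmaD n i).val = endFun n i.val := by
  have h : sigmaD n = Fin.revPerm * swap 0 1 * Fin.revPerm := by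
    rw [sigmaD, swap_comm, ← Fin.revPerm_apply, ← Fin.revPerm_apply, Equiv.swap_apply_apply]
    rfl
  rw [h, Perm.mul_apply, Perm.mul_apply, revPerm_val, swap_zero_one_val (by omega), revPerm_val,
    endFun_eq hn (by omega)]

theorem gammaD_sq_val {n : ℕ} (hn : 4 ≤ n) (i : Fin (n + 1)) :
    ((gammaD n ^ 2) i).val = endsFun n i.val := by
  rw [pow_two, Perm.mul_apply, gammaD_val (by omega), gammaD_val (by omega),
    endsFun_eq hn, endFun_eq hn (by omega)]

theorem gammaD_mul_sigmaD_val {n : ℕ} (hn : 4 ≤ n) (i : Fin (n + 1)) :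
    ((gammaD n * sigmaD n) i).val = n - i.val := by
  rw [Perm.mul_apply, gammaD_val (by omega), sigmaD_val hn, endFun_eq hn (by omega),
    Nat.sub_sub_self (swapFun_le (by omega) (by omega)), swapFun_swapFun]

/-- The word for the automorphism `γ` of order `4`, whose orbits are `{0, 1, n - 1, n}` and
the sets `{i, n - i}`. -/
theorem wordD_gammaD {n : ℕ} (hn : 5 ≤ n) : wordD (gammaD n) =
    (List.finRange (n + 1)).filter fun i => i.val ≠ 0 ∧ (i.val = 1 ∨ 2 * i.val ≤ n) := by
  have hval : ∀ i, (gammaD n i).val = swapFun (n - i.val) := gammaD_val (by omega)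
  have hstep : ∀ (k : ℕ) (i : Fin (n + 1)), (gammaD n).SameCycle i ((gammaD n ^ k) i) :=
    fun k i => ⟨k, by rw [zpow_natCast]⟩
  have h1 : (1 : Fin (n + 1)).val = 1 := val_one_of_le (by omega)
  have h01 : (gammaD n).SameCycle 0 1 := by
    have : (gammaD n ^ 2) 0 = 1 := Fin.ext (by
      rw [gammaD_sq_val (by omega), h1, Fin.val_zero]
      rfl)
    exact this ▸ hstep 2 0
  rw [wordD, if_pos h01]
  refine leastNonzeroReps_eq_filter (fun i => i ≠ 0 ∧ (i = 1 ∨ 2 * i ≤ n)) fun i => ?_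
  have hz : ∀ j : Fin (n + 1), j ≠ 0 ↔ j.val ≠ 0 := fun j => by rw [Ne, Fin.ext_iff]; rfl
  rw [hz]
  refine and_congr_right fun hi => ⟨fun h => ?_, fun h j hj hij => ?_⟩
  · by_contra hcon
    push Not at hcon
    -- one of the first three images of `i` is a smaller nonzero vertex
    by_cases hi2 : i.val + 1 = n
    · have h3 : (gammaD n ^ 3) i = 1 := Fin.ext (by
        rw [pow_succ', Perm.mul_apply, hval, gammaD_sq_val (by omega), h1]
        grind [swapFun, endsFun])
      have h4 := Fin.le_def.1 (h 1 ((hz 1).2 (by omega)) (h3 ▸ hstep 3 i))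
      omega
    · have h3 : (gammaD n i).val = if i.val = n then 1 else n - i.val := by
        rw [hval]
        grind [swapFun]
      have h4 := Fin.le_def.1 (h (gammaD n i) ((hz _).2 (by grind)) (by simpa using hstep 1 i))
      grind
  · rw [hz] at hj
    have := eq_of_sameCycle
      (fun i : Fin (n + 1) => if i.val ≤ 1 ∨ n ≤ i.val + 1 then 0 else min i.val (n - i.val))
      (fun i => by simp only [hval]; grind [swapFun]) hij
    rw [Fin.le_def]
    grind

/-- The criterion in type `D_n^{(1)}`; the minimality of `k` rests on the vertices `0` and `n`. -/
theorem isMinimalSolution_D {n : ℕ} (hn : 4 ≤ n) {τ : Perm (Fin (n + 1))} (f s b : ℕ → ℕ) (k : ℕ)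
    (Q : ℕ → Prop) [DecidablePred Q] (hf : ∀ i, (τ i).val = f i.val)
    (hs : ∀ i, i ≤ n → s i ≤ n ∧ f (s i) = i)
    (haut : ∀ i j, i ≤ n → j ≤ n → cartanD n (f i) (f j) = cartanD n i j)
    (hne : f n ≠ n) (hword : wordD τ = (List.finRange (n + 1)).filter fun i => Q i.val)
    (hk : 0 < k)
    (h1 : ∀ i, i ≤ n → Q i → ∑ j : Fin (n + 1), cartanD n j.val i *
      stepVec (fun i => if i ≤ 1 ∨ n ≤ i + 1 then 1 else 2) s b k i j.val =
        b (s i) - (b i + k * (if i ≤ 1 ∨ n ≤ i + 1 then 1 else 2 : ℕ)))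
    (h2 : ∀ i, i ≤ n → ¬ Q i → b (s i) = b i + k * (if i ≤ 1 ∨ n ≤ i + 1 then 1 else 2))
    (hco : IsCoprime (k : ℤ) ((b 0 : ℤ) - b n))
    (hl : ∃ l, l ≤ n ∧ b l < if l ≤ 1 ∨ n ≤ l + 1 then 1 else 2) :
    IsDiagramAut (.D1 n hn) τ ∧ τ ≠ 1 ∧
      IsMinimalSolution (.D1 n hn) τ k (∑ i, b i.val • coroot (.D1 n hn) i) :=
  isMinimalSolution_of_local (X := .D1 n hn) n rfl (cartanD n)
    (fun i => if i ≤ 1 ∨ n ≤ i + 1 then 1 else 2) f s b k Q (fun _ _ => rfl) (fun _ => rfl) hf hs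
    haut ⟨n, le_rfl, hne⟩ hword hk h1 h2
    ⟨0, n, by omega, by omega, if_pos (by omega), if_pos (by omega), hco⟩ hl

/-- A criterion for the automorphism `γ` of order `4`; its inverse is `i ↦ n - swapFun i`. -/
theorem isMinimalSolution_D_of_gamma {n : ℕ} (hn : 4 ≤ n) (hn5 : 5 ≤ n) (b : ℕ → ℕ)
    (h1 : ∀ i, i ≤ n → (i ≠ 0 ∧ (i = 1 ∨ 2 * i ≤ n)) → ∑ j : Fin (n + 1), cartanD n j.val i *
      stepVec (fun i => if i ≤ 1 ∨ n ≤ i + 1 then 1 else 2) (fun i => n - swapFun i) b 1 i j.val =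
        b (n - swapFun i) - (b i + (1 : ℕ) * (if i ≤ 1 ∨ n ≤ i + 1 then 1 else 2 : ℕ)))
    (h2 : ∀ i, i ≤ n → ¬ (i ≠ 0 ∧ (i = 1 ∨ 2 * i ≤ n)) →
      b (n - swapFun i) = b i + 1 * (if i ≤ 1 ∨ n ≤ i + 1 then 1 else 2))
    (hl : ∃ l, l ≤ n ∧ b l < if l ≤ 1 ∨ n ≤ l + 1 then 1 else 2) :
    IsDiagramAut (.D1 n hn) (gammaD n) ∧ gammaD n ≠ 1 ∧
      IsMinimalSolution (.D1 n hn) (gammaD n) 1 (∑ i, b i.val • coroot (.D1 n hn) i) :=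
  isMinimalSolution_D hn (fun i => swapFun (n - i)) (fun i => n - swapFun i) b 1
    (fun i => i ≠ 0 ∧ (i = 1 ∨ 2 * i ≤ n)) (gammaD_val (by omega))
    (fun i hi => ⟨by omega, by
      have := swapFun_le (n := n) (by omega) hi
      rw [Nat.sub_sub_self this, swapFun_swapFun]⟩)
    (fun i j hi hj => by rw [cartanD_swapFun hn, cartanD_rev hn i j hi hj])
    (by simp only [Nat.sub_self, swapFun, if_true]; omega) (wordD_gammaD hn5) one_pos h1 h2
    isCoprime_one_left hl

theorem isMinimalSolution_D_gamma_even (n m : ℕ) (hn4 : 4 ≤ n) (hn : 5 ≤ n) (hm : n = 2 * m) :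
    IsDiagramAut (.D1 n hn4) (gammaD n) ∧ gammaD n ≠ 1 ∧
      IsMinimalSolution (.D1 n hn4) (gammaD n) 1 (∑ i,
        (if i.val = 0 then m - 2 else if i.val = 1 then m
        else if i.val ≤ m then 2 * (m - i.val)
        else if i.val ≤ n - 2 then 2 * (i.val - (m + 1))
        else if i.val = n - 1 then m - 1 else m - 3) • coroot (.D1 n hn4) i) := by
  refine isMinimalSolution_D_of_gamma hn4 hn (fun i => if i = 0 then m - 2 else if i = 1 then m
        else if i ≤ m then 2 * (m - i)
        else if i ≤ n - 2 then 2 * (i - (m + 1))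
        else if i = n - 1 then m - 1 else m - 3) (fun i hi hQ => ?_) (fun i hi hQ => ?_)
        ⟨m, by omega, by grind⟩
  · rw [sum_cartanD hn _ i hi]
    simp only [stepVec, swapFun]
    grind (splits := 60)
  · simp only [swapFun]
    grind (splits := 60)

theorem isMinimalSolution_D_gamma_odd (n m : ℕ) (hn4 : 4 ≤ n) (hn : 5 ≤ n) (hm : n = 2 * m + 1) :
    IsDiagramAut (.D1 n hn4) (gammaD n) ∧ gammaD n ≠ 1 ∧
      IsMinimalSolution (.D1 n hn4) (gammaD n) 1 (∑ i,
        (if i.val = 0 then m - 1 else if i.val = 1 then m + 1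
        else if i.val ≤ m + 1 then 2 * (m + 1 - i.val)
        else if i.val ≤ n - 2 then 2 * (i.val - (m + 1))
        else if i.val = n - 1 then m else m - 2) • coroot (.D1 n hn4) i) := by
  refine isMinimalSolution_D_of_gamma hn4 hn (fun i => if i = 0 then m - 1 else if i = 1 then m + 1
        else if i ≤ m + 1 then 2 * (m + 1 - i)
        else if i ≤ n - 2 then 2 * (i - (m + 1))
        else if i = n - 1 then m else m - 2) (fun i hi hQ => ?_) (fun i hi hQ => ?_)
        ⟨m + 1, by omega, by grind⟩
  · rw [sum_cartanD hn _ i hi]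
    simp only [stepVec, swapFun]
    grind (splits := 60)
  · simp only [swapFun]
    grind (splits := 60)

/-- A criterion for `γσ`, which is the reversal `i ↦ n - i`. -/
theorem isMinimalSolution_D_of_gamma_mul_sigma {n : ℕ} (hn : 4 ≤ n) (b : ℕ → ℕ)
    (h1 : ∀ i, i ≤ n → i ≤ n - i → ∑ j : Fin (n + 1), cartanD n j.val i *
      stepVec (fun i => if i ≤ 1 ∨ n ≤ i + 1 then 1 else 2) (fun i => n - i) b 1 i j.val =
        b (n - i) - (b i + (1 : ℕ) * (if i ≤ 1 ∨ n ≤ i + 1 then 1 else 2 : ℕ)))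
    (h2 : ∀ i, i ≤ n → ¬ i ≤ n - i → b (n - i) = b i + 1 * (if i ≤ 1 ∨ n ≤ i + 1 then 1 else 2))
    (hl : ∃ l, l ≤ n ∧ b l < if l ≤ 1 ∨ n ≤ l + 1 then 1 else 2) :
    IsDiagramAut (.D1 n hn) (gammaD n * sigmaD n) ∧ gammaD n * sigmaD n ≠ 1 ∧
      IsMinimalSolution (.D1 n hn) (gammaD n * sigmaD n) 1
        (∑ i, b i.val • coroot (.D1 n hn) i) :=
  isMinimalSolution_D hn (fun i => n - i) (fun i => n - i) b 1
    (fun i => i ≤ n - i) (gammaD_mul_sigmaD_val (by omega))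
    (fun i hi => by omega) (cartanD_rev hn) (by omega)
    (wordD_of_involutive (f := fun i => n - i) (by omega) (gammaD_mul_sigmaD_val (by omega))
      (fun i hi => by omega) (by omega)) one_pos h1 h2
    isCoprime_one_left hl

theorem isMinimalSolution_D_gamma_sigma_even (n m : ℕ) (hn4 : 4 ≤ n) (hn : 5 ≤ n)
    (hm : n = 2 * m) :
    IsDiagramAut (.D1 n hn4) (gammaD n * sigmaD n) ∧ gammaD n * sigmaD n ≠ 1 ∧
      IsMinimalSolution (.D1 n hn4) (gammaD n * sigmaD n) 1 (∑ i,
        (if i.val ≤ 1 then m - 1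
        else if i.val ≤ m then 2 * (m - i.val)
        else if i.val ≤ n - 2 then 2 * (i.val - (m + 1))
        else m - 2) • coroot (.D1 n hn4) i) := by
  refine isMinimalSolution_D_of_gamma_mul_sigma hn4 (fun i => if i ≤ 1 then m - 1
        else if i ≤ m then 2 * (m - i)
        else if i ≤ n - 2 then 2 * (i - (m + 1))
        else m - 2) (fun i hi hQ => ?_) (fun i hi hQ => by grind (splits := 60))
        ⟨m, by omega, by grind⟩
  rw [sum_cartanD hn _ i hi]
  simp only [stepVec]
  grind (splits := 60)

theorem isMinimalSolution_D_gamma_sigma_odd (n m : ℕ) (hn4 : 4 ≤ n) (hn : 5 ≤ n)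
    (hm : n = 2 * m + 1) :
    IsDiagramAut (.D1 n hn4) (gammaD n * sigmaD n) ∧ gammaD n * sigmaD n ≠ 1 ∧
      IsMinimalSolution (.D1 n hn4) (gammaD n * sigmaD n) 1 (∑ i,
        (if i.val ≤ 1 then m
        else if i.val ≤ m + 1 then 2 * (m + 1 - i.val)
        else if i.val ≤ n - 2 then 2 * (i.val - (m + 1))
        else m - 1) • coroot (.D1 n hn4) i) := by
  refine isMinimalSolution_D_of_gamma_mul_sigma hn4 (fun i => if i ≤ 1 then m
        else if i ≤ m + 1 then 2 * (m + 1 - i)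
        else if i ≤ n - 2 then 2 * (i - (m + 1))
        else m - 1) (fun i hi hQ => ?_) (fun i hi hQ => by grind (splits := 60))
        ⟨m + 1, by omega, by grind⟩
  rw [sum_cartanD hn _ i hi]
  simp only [stepVec]
  grind (splits := 60)

/-- A criterion for `γ²`, for which the word consists of the vertices `1, ..., n - 1`. -/
theorem isMinimalSolution_D_of_gamma_sq {n : ℕ} (hn : 4 ≤ n) (b : ℕ → ℕ) (k : ℕ) (hk : 0 < k)
    (h1 : ∀ i, 1 ≤ i → i < n → ∑ j : Fin (n + 1), cartanD n j.val i *
      stepVec (fun i => if i ≤ 1 ∨ n ≤ i + 1 then 1 else 2)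
        (endsFun n) b k i j.val =
        b (endsFun n i) -
          (b i + k * (if i ≤ 1 ∨ n ≤ i + 1 then 1 else 2 : ℕ)))
    (h01 : b 1 = b 0 + k) (hbn : b (n - 1) = k) (hb : b n = 0) (hco : IsCoprime (k : ℤ) (b 0)) :
    IsDiagramAut (.D1 n hn) (gammaD n ^ 2) ∧ gammaD n ^ 2 ≠ 1 ∧
      IsMinimalSolution (.D1 n hn) (gammaD n ^ 2) k (∑ i, b i.val • coroot (.D1 n hn) i) := by
  have hval : ∀ i : Fin (n + 1), ((gammaD n ^ 2) i).val = endsFun n i.val := gammaD_sq_val hn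
  refine isMinimalSolution_D hn (endsFun n) (endsFun n) b k
    (fun i => i ≠ 0 ∧ (endsFun n i = 0 ∨ i ≤ endsFun n i)) hval (fun i hi => endsFun_endsFun hn hi)
    (fun i j hi hj => ?_) (by grind [endsFun])
    (wordD_of_involutive_of_swap (by omega) hval (fun i hi => (endsFun_endsFun hn hi).2) rfl) hk
    (fun i hi hQ => h1 i (by omega) ?_) ?_ (by rw [hb, Nat.cast_zero, sub_zero]; exact hco)
    ⟨n, le_rfl, by rw [hb]; split_ifs <;> omega⟩
  · rw [endsFun_eq hn, endsFun_eq hn, cartanD_swapFun hn, cartanD_endFun hn i j hi hj]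
  · clear h1
    grind [endsFun]
  · intro i hi hQ
    clear h1
    have : i = 0 ∨ i = n := by grind [endsFun]
    rcases this with rfl | rfl
    · simp [endsFun, h01]
    · grind [endsFun]

theorem isMinimalSolution_D_gamma_sq_even (n m : ℕ) (hn4 : 4 ≤ n) (hn : 5 ≤ n) (hm : n = 2 * m) :
    IsDiagramAut (.D1 n hn4) (gammaD n ^ 2) ∧ gammaD n ^ 2 ≠ 1 ∧
      IsMinimalSolution (.D1 n hn4) (gammaD n ^ 2) 1 (∑ i,
        (if i.val = 0 then m - 1 else if i.val = 1 then m else n - i.val) •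
          coroot (.D1 n hn4) i) := by
  refine isMinimalSolution_D_of_gamma_sq hn4
    (fun i => if i = 0 then m - 1 else if i = 1 then m else n - i) 1 one_pos
    (fun i h1 hi => ?_) (by grind) (by grind) (by grind) isCoprime_one_left
  rw [sum_cartanD hn _ i hi.le]
  simp only [stepVec, endsFun]
  grind (splits := 60)

theorem isMinimalSolution_D_gamma_sq_odd (n m : ℕ) (hn4 : 4 ≤ n) (hn : 5 ≤ n)
    (hm : n = 2 * m + 1) :
    IsDiagramAut (.D1 n hn4) (gammaD n ^ 2) ∧ gammaD n ^ 2 ≠ 1 ∧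
      IsMinimalSolution (.D1 n hn4) (gammaD n ^ 2) 2 (∑ i,
        (if i.val = 0 then n - 2 else if i.val = 1 then n else 2 * (n - i.val)) •
          coroot (.D1 n hn4) i) := by
  refine isMinimalSolution_D_of_gamma_sq hn4
    (fun i => if i = 0 then n - 2 else if i = 1 then n else 2 * (n - i)) 2 two_pos
    (fun i h1 hi => ?_) (by grind) (by grind) (by grind) ?_
  · rw [sum_cartanD hn _ i hi.le]
    simp only [stepVec, endsFun]
    grind (splits := 60)
  · rw [Nat.isCoprime_iff_coprime, Nat.coprime_two_left]
    simp only [if_pos]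
    rw [Nat.odd_iff]
    omega

/-- A criterion for `σ`, for which the word consists of the vertices `0, ..., n - 1`. -/
theorem isMinimalSolution_D_of_sigma {n : ℕ} (hn : 4 ≤ n) (b : ℕ → ℕ) (k : ℕ) (hk : 0 < k)
    (h1 : ∀ i, i < n → ∑ j : Fin (n + 1), cartanD n j.val i *
      stepVec (fun i => if i ≤ 1 ∨ n ≤ i + 1 then 1 else 2)
        (endFun n) b k i j.val =
        b (endFun n i) -
          (b i + k * (if i ≤ 1 ∨ n ≤ i + 1 then 1 else 2 : ℕ)))
    (hbn : b (n - 1) = k) (hb : b n = 0) (hco : IsCoprime (k : ℤ) (b 0)) :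
    IsDiagramAut (.D1 n hn) (sigmaD n) ∧ sigmaD n ≠ 1 ∧
      IsMinimalSolution (.D1 n hn) (sigmaD n) k (∑ i, b i.val • coroot (.D1 n hn) i) := by
  have hval : ∀ i : Fin (n + 1), (sigmaD n i).val = endFun n i.val := sigmaD_val hn
  refine isMinimalSolution_D hn (endFun n) (endFun n) b k (fun i => i ≤ endFun n i) hval
    (fun i hi => endFun_endFun hn hi) (cartanD_endFun hn) (by grind [endFun])
    (wordD_of_involutive (by omega) hval (fun i hi => (endFun_endFun hn hi).2)
      (by grind [endFun])) hk (fun i hi hQ => h1 i ?_) ?_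
    (by rw [hb, Nat.cast_zero, sub_zero]; exact hco)
    ⟨n, le_rfl, by rw [hb]; split_ifs <;> omega⟩
  · clear h1
    grind [endFun]
  · intro i hi hQ
    clear h1
    have : i = n := by grind [endFun]
    subst this
    grind [endFun]

theorem isMinimalSolution_D_sigma_even (n m : ℕ) (hn4 : 4 ≤ n) (hn : 5 ≤ n) (hm : n = 2 * m) :
    IsDiagramAut (.D1 n hn4) (sigmaD n) ∧ sigmaD n ≠ 1 ∧
      IsMinimalSolution (.D1 n hn4) (sigmaD n) 2 (∑ i,
        (if i.val ≤ 1 then n - 1 else 2 * (n - i.val)) • coroot (.D1 n hn4) i) := by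
  refine isMinimalSolution_D_of_sigma hn4
    (fun i => if i ≤ 1 then n - 1 else 2 * (n - i)) 2 two_pos
    (fun i hi => ?_) (by grind) (by grind) ?_
  · rw [sum_cartanD hn _ i hi.le]
    simp only [stepVec, endFun]
    grind (splits := 60)
  · rw [Nat.isCoprime_iff_coprime, Nat.coprime_two_left]
    simp only [zero_le, if_true]
    rw [Nat.odd_iff]
    omega

theorem isMinimalSolution_D_sigma_odd (n m : ℕ) (hn4 : 4 ≤ n) (hn : 5 ≤ n) (hm : n = 2 * m + 1) :
    IsDiagramAut (.D1 n hn4) (sigmaD n) ∧ sigmaD n ≠ 1 ∧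
      IsMinimalSolution (.D1 n hn4) (sigmaD n) 1 (∑ i,
        (if i.val ≤ 1 then m else n - i.val) • coroot (.D1 n hn4) i) := by
  refine isMinimalSolution_D_of_sigma hn4 (fun i => if i ≤ 1 then m else n - i) 1 one_pos
    (fun i hi => ?_) (by grind) (by grind) isCoprime_one_left
  rw [sum_cartanD hn _ i hi.le]
  simp only [stepVec, endFun]
  grind (splits := 60)

/-! ### Types `D_4^{(1)}`, `E_6^{(1)}` and `E_7^{(1)}` -/

theorem isDiagramAut_of_entry {X : AffineType} {τ : Perm X.Node}
    (h : ∀ i j, X.entry (τ i) (τ j) = X.entry i j) : IsDiagramAut X τ := h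

theorem ne_one_of_apply_val_ne {n : ℕ} {τ : Perm (Fin n)} (i : Fin n) (h : (τ i).val ≠ i.val) :
    τ ≠ 1 :=
  fun h' => h (by rw [h', Perm.one_apply])

theorem isMinimalSolution_D4_gamma :
    IsDiagramAut (.D1 4 le_rfl) (gammaD 4) ∧ gammaD 4 ≠ 1 ∧
      IsMinimalSolution (.D1 4 le_rfl) (gammaD 4) 1
        (∑ i, (![1, 3, 2, 2, 0] : Fin 5 → ℕ) i • coroot (.D1 4 le_rfl) i) :=
  isMinimalSolution_of_step (X := .D1 4 le_rfl) (τ := gammaD 4) (isDiagramAut_of_entry (by decide))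
    (ne_one_of_apply_val_ne (0 : Fin 5) (by decide)) (fun i => i.val ∈ [1, 2]) (by decide)
    one_pos (![1, 3, 2, 2, 0] : Fin 5 → ℕ) (by decide) (by decide)
    (i := (0 : Fin 5)) (j := (0 : Fin 5)) (l := (4 : Fin 5)) rfl rfl
    isCoprime_one_left (by decide)

theorem isMinimalSolution_D4_gamma_sq :
    IsDiagramAut (.D1 4 le_rfl) (gammaD 4 ^ 2) ∧ gammaD 4 ^ 2 ≠ 1 ∧
      IsMinimalSolution (.D1 4 le_rfl) (gammaD 4 ^ 2) 1
        (∑ i, (![1, 2, 2, 1, 0] : Fin 5 → ℕ) i • coroot (.D1 4 le_rfl) i) :=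
  isMinimalSolution_of_step (X := .D1 4 le_rfl) (τ := gammaD 4 ^ 2) (isDiagramAut_of_entry (by decide))
    (ne_one_of_apply_val_ne (0 : Fin 5) (by decide)) (fun i => i.val ∈ [1, 2, 3]) (by decide)
    one_pos (![1, 2, 2, 1, 0] : Fin 5 → ℕ) (by decide) (by decide)
    (i := (0 : Fin 5)) (j := (0 : Fin 5)) (l := (4 : Fin 5)) rfl rfl
    isCoprime_one_left (by decide)

theorem isMinimalSolution_D4_sigma :
    IsDiagramAut (.D1 4 le_rfl) (sigmaD 4) ∧ sigmaD 4 ≠ 1 ∧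
      IsMinimalSolution (.D1 4 le_rfl) (sigmaD 4) 2
        (∑ i, (![3, 3, 4, 2, 0] : Fin 5 → ℕ) i • coroot (.D1 4 le_rfl) i) :=
  isMinimalSolution_of_step (X := .D1 4 le_rfl) (τ := sigmaD 4) (isDiagramAut_of_entry (by decide))
    (ne_one_of_apply_val_ne (4 : Fin 5) (by decide)) (fun i => i.val ∈ [0, 1, 2, 3]) (by decide)
    two_pos (![3, 3, 4, 2, 0] : Fin 5 → ℕ) (by decide) (by decide)
    (i := (0 : Fin 5)) (j := (4 : Fin 5)) (l := (4 : Fin 5)) rfl rfl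
    (Int.isCoprime_two_left.2 (by decide)) (by decide)

theorem isMinimalSolution_D4_rho :
    IsDiagramAut (.D1 4 le_rfl) rhoD4 ∧ rhoD4 ≠ 1 ∧
      IsMinimalSolution (.D1 4 le_rfl) rhoD4 1
        (∑ i, (![1, 2, 1, 1, 0] : Fin 5 → ℕ) i • coroot (.D1 4 le_rfl) i) :=
  isMinimalSolution_of_step (X := .D1 4 le_rfl) (τ := rhoD4) (isDiagramAut_of_entry (by decide))
    (ne_one_of_apply_val_ne (1 : Fin 5) (by decide)) (fun i => i.val ∈ [0, 1, 2]) (by decide)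
    one_pos (![1, 2, 1, 1, 0] : Fin 5 → ℕ) (by decide) (by decide)
    (i := (0 : Fin 5)) (j := (0 : Fin 5)) (l := (4 : Fin 5)) rfl rfl
    isCoprime_one_left (by decide)

theorem isMinimalSolution_E6_gamma :
    IsDiagramAut .E6 gammaE6 ∧ gammaE6 ≠ 1 ∧
      IsMinimalSolution .E6 gammaE6 1
        (∑ i, (![2, 4, 5, 3, 3, 3, 1] : Fin 7 → ℕ) i • coroot .E6 i) :=
  isMinimalSolution_of_step (X := .E6) (τ := gammaE6) (isDiagramAut_of_entry (by decide))
    (ne_one_of_apply_val_ne (0 : Fin 7) (by decide)) (fun i => i.val ∈ [1, 2, 3]) (by decide)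
    one_pos (![2, 4, 5, 3, 3, 3, 1] : Fin 7 → ℕ) (by decide) (by decide)
    (i := (0 : Fin 7)) (j := (0 : Fin 7)) (l := (6 : Fin 7)) rfl rfl
    isCoprime_one_left (by decide)

theorem isMinimalSolution_E6_sigma :
    IsDiagramAut .E6 sigmaE6 ∧ sigmaE6 ≠ 1 ∧
      IsMinimalSolution .E6 sigmaE6 1
        (∑ i, (![1, 3, 4, 3, 2, 2, 1] : Fin 7 → ℕ) i • coroot .E6 i) :=
  isMinimalSolution_of_step (X := .E6) (τ := sigmaE6) (isDiagramAut_of_entry (by decide))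
    (ne_one_of_apply_val_ne (1 : Fin 7) (by decide)) (fun i => i.val ∈ [0, 1, 2, 3, 6]) (by decide)
    one_pos (![1, 3, 4, 3, 2, 2, 1] : Fin 7 → ℕ) (by decide) (by decide)
    (i := (0 : Fin 7)) (j := (0 : Fin 7)) (l := (6 : Fin 7)) rfl rfl
    isCoprime_one_left (by decide)

theorem isMinimalSolution_E7_gamma :
    IsDiagramAut .E7 gammaE7 ∧ gammaE7 ≠ 1 ∧
      IsMinimalSolution .E7 gammaE7 1
        (∑ i, (![4, 6, 6, 4, 3, 4, 3, 1] : Fin 8 → ℕ) i • coroot .E7 i) :=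
  isMinimalSolution_of_step (X := .E7) (τ := gammaE7) (isDiagramAut_of_entry (by decide))
    (ne_one_of_apply_val_ne (0 : Fin 8) (by decide)) (fun i => i.val ∈ [0, 1, 2, 3, 7]) (by decide)
    one_pos (![4, 6, 6, 4, 3, 4, 3, 1] : Fin 8 → ℕ) (by decide) (by decide)
    (i := (0 : Fin 8)) (j := (0 : Fin 8)) (l := (7 : Fin 8)) rfl rfl
    isCoprime_one_left (by decide)

/-! ### Existence and uniqueness, and the table -/

theorem existsUnique_isMinimalSolution {X : AffineType} {τ : Perm X.Node} (hτ : IsDiagramAut X τ)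
    (hne : τ ≠ 1) : ∃! p : ℕ × Cartan' X, IsMinimalSolution X τ p.1 p.2 := by
  have hw := isTransversal_coxeterWord hτ hne
  obtain ⟨k, b, h⟩ := exists_isMinimalSolution X.isAffineMatrix hτ hw
  refine ⟨(k, b), h, fun p hp => ?_⟩
  obtain ⟨h1, h2⟩ := IsMinimalSolution.unique X.isAffineMatrix hτ hw hp h
  exact Prod.ext h1 h2

theorem TableRow.isMinimalSolution {X : AffineType} {τ : Perm X.Node} {k : ℕ} {b : X.Node → ℕ}
    (h : TableRow X τ k b) :
    IsDiagramAut X τ ∧ τ ≠ 1 ∧ IsMinimalSolution X τ k (∑ i, b i • coroot X i) := by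
  cases h with
  | A_gamma n l hn hl hln => exact isMinimalSolution_A_gamma _ _ hn hl hln
  | A_sigma_even n m hn hm => exact isMinimalSolution_A_sigma_even n m _ hn hm
  | A_sigma_odd n m hn hm => exact isMinimalSolution_A_sigma_odd n m _ hn hm
  | A_sigma_gamma_odd n m hn hm => exact isMinimalSolution_A_sigma_gamma_odd n m _ hn hm
  | B_even n m hn hm => exact isMinimalSolution_B_even n m hn hm
  | B_odd n m hn hm => exact isMinimalSolution_B_odd n m hn hm
  | C_even n m hn hm => exact isMinimalSolution_C_even n m hn hm
  | C_odd n m hn hm => exact isMinimalSolution_C_odd n m hn hm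
  | D4_gamma hn => exact isMinimalSolution_D4_gamma
  | D4_gamma_sq hn => exact isMinimalSolution_D4_gamma_sq
  | D4_sigma hn => exact isMinimalSolution_D4_sigma
  | D4_rho hn => exact isMinimalSolution_D4_rho
  | D_gamma_even n m hn hm => exact isMinimalSolution_D_gamma_even n m _ hn hm
  | D_gamma_sq_even n m hn hm => exact isMinimalSolution_D_gamma_sq_even n m _ hn hm
  | D_sigma_even n m hn hm => exact isMinimalSolution_D_sigma_even n m _ hn hm
  | D_gamma_sigma_even n m hn hm => exact isMinimalSolution_D_gamma_sigma_even n m _ hn hm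
  | D_gamma_odd n m hn hm => exact isMinimalSolution_D_gamma_odd n m _ hn hm
  | D_gamma_sq_odd n m hn hm => exact isMinimalSolution_D_gamma_sq_odd n m _ hn hm
  | D_sigma_odd n m hn hm => exact isMinimalSolution_D_sigma_odd n m _ hn hm
  | D_gamma_sigma_odd n m hn hm => exact isMinimalSolution_D_gamma_sigma_odd n m _ hn hm
  | E6_gamma => exact isMinimalSolution_E6_gamma
  | E6_sigma => exact isMinimalSolution_E6_sigma
  | E7_gamma => exact isMinimalSolution_E7_gamma
  | Aodd_even n m hn hm => exact isMinimalSolution_A2odd_even n m hn hm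
  | Aodd_odd n m hn hm => exact isMinimalSolution_A2odd_odd n m hn hm
  | D2_even n m hn hm => exact isMinimalSolution_D2_even n m hn hm
  | D2_odd n m hn hm => exact isMinimalSolution_D2_odd n m hn hm

end AffineCoxeter

theorem mainTheorem5 :
    (∀ (X : AffineCoxeter.AffineType) (τ : Equiv.Perm X.Node),
      AffineCoxeter.IsDiagramAut X τ → τ ≠ 1 →
        ∃! p : ℕ × AffineCoxeter.Cartan' X, AffineCoxeter.IsMinimalSolution X τ p.1 p.2) ∧
    (∀ (X : AffineCoxeter.AffineType) (τ : Equiv.Perm X.Node) (k : ℕ) (b : X.Node → ℕ),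
      AffineCoxeter.TableRow X τ k b →
        AffineCoxeter.IsDiagramAut X τ ∧ τ ≠ 1 ∧
        AffineCoxeter.IsMinimalSolution X τ k (∑ i, b i • AffineCoxeter.coroot X i)) :=
  ⟨fun _ _ hτ hne => AffineCoxeter.existsUnique_isMinimalSolution hτ hne,
    fun _ _ _ _ h => h.isMinimalSolution⟩
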